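/- Fix an integer $d\ge 2$. A circle endomorphism $f$ of degree $d$ with $f(1)=1$ is identified with its lift $F:\mathbb R\to\mathbb R$ (through $x\mapsto e^{2\pi i x}$), an increasing homeomorphism with $F(0)=0$ and $F(x+1)=F(x)+d$. Let $\mathcal C^{1+}$ be the set of those $f$ for which $F$ is $C^1$ with $F'$ $\alpha$-Hölder for some $0<\alpha\le 1$ (depending on $f$), and which are expanding: there are $C>0$, $\lambda>1$ with $(F^n)'(x)\ge C\lambda^n$ for all $x\in\mathbb R$, $n\ge1$. Let $q_d(z)=z^d$. For $f\in\mathcal C^{1+}$ let $h_f$ be the orientation-preserving homeomorphism of the unit circle $T$ with $h_f(1)=1$ and $f\circ h_f=h_f\circ q_d$. Write $(f,h_f)\sim_T(g,h_g)$ if $h_f\circ h_g^{-1}$ is a $C^1$-diffeomorphism, and let $\mathcal T\mathcal C^{1+}$ be the set of equivalence classes $[(f,h_f)]$, $f\in\mathcal C^{1+}$. For a word $w=i_0\cdots i_{n-1}$ in the digits $0,\dots,d-1$ let $I_w\subset[0,1]$ be the interval defined by $I_\emptyset=[0,1]$ and $I_{iw}=\{x: F(x)-i\in I_w\}$. Let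 $\Sigma^*$ be the set of left-infinite sequences $w^*=\cdots j_2j_1j_0$ of such digits. The dual derivative of $f$ is $$D^*(f)(w^*)=\lim_{n\to\infty}\frac{|I_{j_{n-1}\cdots j_1}|}{|I_{j_{n-1}\cdots j_1j_0}|}.$$ A function $\phi$ on $\Sigma^*$ is Hölder continuous if there are $C>0$, $0<\tau<1$ with $|\phi(w^*)-\phi(\tilde w^*)|\le C\tau^n$ whenever the last $n$ digits $j_{n-1}\cdots j_0$ of $w^*$ and $\tilde w^*$ agree. For an orientation-preserving homeomorphism $h$ of $T$ let $B_h\in[1,\infty]$ be its boundary dilatation: the infimum of $(1+k)/(1-k)$ over all quasiconformal extensions $\tilde h:U\to\mathbb C$ of $h$ to open neighborhoods $U$ of $T$ in $\mathbb C$, where $k=\|\tilde h_{\bar z}/\tilde h_z\|_{\infty,U}<1$. For $\Pi=[(f,h_f)]$ and $\Pi'=[(g,h_g)]$ put $d_{\mathcal T}(\Pi,\Pi')=\frac12\log B_{h_f\circ h_g^{-1}}$. **Theorem.** 1. For every $f\in\mathcal C^{1+}$ the homeomorphism $h_f$ exists and is unique, and $D^*(f)$ exists at every point of $\Sigma^*$,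 is positive and Hölder continuous. 2. For $f,g\in\mathcal C^{1+}$: $(f,h_f)\sim_T(g,h_g)$ if and only if $D^*(f)=D^*(g)$. 3. For $\Pi,\Pi'\in\mathcal T\mathcal C^{1+}$, and for any choice of the representatives $(f,h_f)\in\Pi$, $(g,h_g)\in\Pi'$ that are used to compute $d_{\mathcal T}(\Pi,\Pi')$: $d_{\mathcal T}(\Pi,\Pi')=0$ if and only if $\Pi=\Pi'$. 4. Hence $[(f,h_f)]\mapsto D^*(f)$ is a well-defined bijection from $\mathcal T\mathcal C^{1+}$ onto the space $\{D^*(f) : f\in\mathcal C^{1+}\}$ of Hölder continuous dual derivatives. -/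

import Mathlib

open MeasureTheory Filter Topology Set
open scoped ENNReal NNReal ContDiff

noncomputable section

namespace CircleDynamics

/-- A degree `d` circle endomorphism fixing the point `1` of the unit circle, given by its lift
`F` to the universal cover `ℝ` (the circle map is `e^{2πix} ↦ e^{2πiF(x)}`): an
orientation-preserving homeomorphism of `ℝ` (an order isomorphism of `ℝ` is the same thing as an
increasing homeomorphism) with `F 0 = 0` and `F (x + 1) = F x + d`. -/
structure CircleEndo (d : ℕ) where
  lift : ℝ ≃o ℝ
  map_zero : lift 0 = 0
  map_add_one : ∀ x, lift (x + 1) = lift x + d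

/-- The circle endomorphism is `C^{1+α}` for some `0 < α ≤ 1`. -/
def CircleEndo.IsC1Holder {d : ℕ} (F : CircleEndo d) : Prop :=
  ContDiff ℝ 1 F.lift ∧
    ∃ C α : ℝ≥0, 0 < α ∧ α ≤ 1 ∧ HolderWith C α (deriv F.lift)

/-- The circle endomorphism is expanding: `(F^n)' ≥ C λ^n` with `C > 0`, `λ > 1`. -/
def CircleEndo.IsExpanding {d : ℕ} (F : CircleEndo d) : Prop :=
  ∃ C l : ℝ, 0 < C ∧ 1 < l ∧ ∀ n : ℕ, 1 ≤ n → ∀ x : ℝ, C * l ^ n ≤ deriv (F.lift^[n]) x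

/-- The space `𝒞^{1+}` of all `C^{1+α}`, `0 < α ≤ 1`, expanding circle endomorphisms
of degree `d`. -/
def C1Plus (d : ℕ) : Type := {F : CircleEndo d // F.IsC1Holder ∧ F.IsExpanding}

/-- `H` is the lift, with `H 0 = 0`, of an orientation-preserving circle homeomorphism `h` with
`h(1) = 1` and `f ∘ h = h ∘ q_d`, where `q_d(z) = z^d` has the lift `x ↦ d x`. -/
structure IsMarking {d : ℕ} (F : CircleEndo d) (H : ℝ ≃o ℝ) : Prop where
  map_zero : H 0 = 0
  map_add_one : ∀ x, H (x + 1) = H x + 1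
  conj : ∀ x, F.lift (H x) = H (d * x)

/-- A marked `C^{1+}` circle endomorphism `(f, h_f)` by `q_d`. -/
structure MarkedMap (d : ℕ) where
  map : C1Plus d
  marking : ℝ ≃o ℝ
  isMarking : IsMarking map.1 marking

/-- The lift of the conjugacy `h_f ∘ h_g⁻¹`. -/
def MarkedMap.conjugacy {d : ℕ} (f g : MarkedMap d) : ℝ ≃o ℝ :=
  g.marking.symm.trans f.marking

/-- The lift `H` (and hence the circle homeomorphism) is a `C^1`-diffeomorphism. -/
def IsC1Diffeo (H : ℝ ≃o ℝ) : Prop := ContDiff ℝ 1 H ∧ ContDiff ℝ 1 H.symm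

/-- The Teichmüller equivalence relation: `h_f ∘ h_g⁻¹` is a `C^1`-diffeomorphism. -/
def TeichEquiv {d : ℕ} (f g : MarkedMap d) : Prop := IsC1Diffeo (f.conjugacy g)

theorem teichEquiv_equivalence (d : ℕ) : Equivalence (TeichEquiv (d := d)) where
  refl f := by
    have h : f.conjugacy f = OrderIso.refl ℝ := by
      ext x; simp [MarkedMap.conjugacy]
    have h' : (⇑(OrderIso.refl ℝ) : ℝ → ℝ) = fun x => x := rfl
    have h'' : (⇑(OrderIso.refl ℝ).symm : ℝ → ℝ) = fun x => x := rfl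
    unfold TeichEquiv IsC1Diffeo
    rw [h, h', h'']
    exact ⟨contDiff_id, contDiff_id⟩
  symm {f g} h := by
    have e : g.conjugacy f = (f.conjugacy g).symm := rfl
    unfold TeichEquiv IsC1Diffeo at *
    rw [e]
    exact ⟨h.2, h.1⟩
  trans {f g k} h₁ h₂ := by
    have e : (⇑(f.conjugacy k) : ℝ → ℝ) = f.conjugacy g ∘ g.conjugacy k := by
      ext x; simp [MarkedMap.conjugacy]
    have e' : (⇑(f.conjugacy k).symm : ℝ → ℝ)
        = (g.conjugacy k).symm ∘ (f.conjugacy g).symm := by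
      ext x; simp [MarkedMap.conjugacy]
    unfold TeichEquiv IsC1Diffeo at *
    rw [e, e']
    exact ⟨h₁.1.comp h₂.1, h₂.2.comp h₁.2⟩

/-- Marked `C^{1+}` maps with the Teichmüller equivalence relation. -/
instance teichSetoid (d : ℕ) : Setoid (MarkedMap d) := ⟨TeichEquiv, teichEquiv_equivalence d⟩

/-- The Teichmüller space `𝒯𝒞^{1+}` of smooth expanding circle endomorphisms of degree `d`. -/
def TeichSpace (d : ℕ) : Type := Quotient (teichSetoid d)

/-! ### Dual derivatives -/

/-- The dual symbolic space; the point `⋯ j₂ j₁ j₀` is the sequence `k ↦ j_k`. -/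
abbrev DualSpace (d : ℕ) : Type := ℕ → Fin d

/-- The right shift `⋯ j₂ j₁ j₀ ↦ ⋯ j₂ j₁`. -/
def dualShift {d : ℕ} (j : DualSpace d) : DualSpace d := fun k => j (k + 1)

/-- The Markov interval `I_w ⊆ [0,1]` of the word `w = i₀ i₁ ⋯ i_{n-1}`. The empty word gives
`[0,1]`, and `I_{iw}` is the part of `I_i = F⁻¹[i,i+1]` that `F`, modulo `1`, maps onto `I_w`. -/
def markovInterval {d : ℕ} (F : CircleEndo d) : List (Fin d) → Set ℝ
  | [] => Icc 0 1
  | i :: w => {x | F.lift x - ((i : ℕ) : ℝ) ∈ markovInterval F w}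

/-- The word `j_{n-1} ⋯ j₁ j₀` (so `i₀ = j_{n-1}`, …, `i_{n-1} = j₀`). -/
def dualWord {d : ℕ} (j : DualSpace d) : ℕ → List (Fin d)
  | 0 => []
  | n + 1 => j n :: dualWord j n

/-- The length of the interval of the word `j_{n-1} ⋯ j₁ j₀`. -/
def dualLength {d : ℕ} (F : CircleEndo d) (j : DualSpace d) (n : ℕ) : ℝ :=
  volume.real (markovInterval F (dualWord j n))

/-- The quotient `|I_{v_n}| / |I_{w_{n+1}}|`, where `w_{n+1} = j_n ⋯ j₁ j₀` and
`v_n = j_n ⋯ j₁` is `w_{n+1}` without its last digit. -/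
def preDualDerivative {d : ℕ} (F : CircleEndo d) (j : DualSpace d) (n : ℕ) : ℝ :=
  dualLength F (dualShift j) n / dualLength F j (n + 1)

/-- The limit which defines the dual derivative exists, and is positive, at every point of the
dual symbolic space. -/
def HasDualDerivative {d : ℕ} (F : CircleEndo d) : Prop :=
  ∀ j : DualSpace d, ∃ L : ℝ, 0 < L ∧ Tendsto (preDualDerivative F j) atTop (𝓝 L)

/-- The dual derivative `D^*(f)`. -/
def dualDerivative {d : ℕ} (F : CircleEndo d) : DualSpace d → ℝ :=
  fun j => limUnder atTop (preDualDerivative F j)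

/-- Hölder continuity of a function on the dual symbolic space. -/
def IsHolderDual {d : ℕ} (φ : DualSpace d → ℝ) : Prop :=
  ∃ C τ : ℝ, 0 < C ∧ 0 < τ ∧ τ < 1 ∧ ∀ (n : ℕ) (j j' : DualSpace d),
    (∀ k < n, j k = j' k) → |φ j - φ j'| ≤ C * τ ^ n

/-- The space of Hölder continuous dual derivatives of maps in `𝒞^{1+}`. -/
def HolderDualDerivatives (d : ℕ) : Set (DualSpace d → ℝ) :=
  {D | IsHolderDual D ∧ ∃ F : C1Plus d, HasDualDerivative F.1 ∧ D = dualDerivative F.1}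

/-! ### Quasiconformal extensions, boundary dilatation and the Teichmüller distance -/

/-- `g` is the weak derivative of `φ` on the open set `U ⊆ ℂ` in the direction `v`. -/
def HasWeakDeriv (φ : ℂ → ℂ) (U : Set ℂ) (v : ℂ) (g : ℂ → ℂ) : Prop :=
  ∀ ψ : ℂ → ℝ, ContDiff ℝ ∞ ψ → HasCompactSupport ψ → tsupport ψ ⊆ U →
    ∫ z, (fderiv ℝ ψ z v) • φ z = - ∫ z, ψ z • g z

/-- `φ` is quasiconformal on the open set `U` (a homeomorphism of `U` onto an open subset of `ℂ`
with weak partial derivatives `φ_x`, `φ_y` in `L²_loc(U)`) and its complex dilatation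
`μ = φ_{z̄} / φ_z` satisfies `‖μ‖_{∞,U} ≤ k < 1`, where `φ_z = (φ_x - i φ_y) / 2` and
`φ_{z̄} = (φ_x + i φ_y) / 2`. -/
structure IsQuasiconformalOn (φ : ℂ → ℂ) (U : Set ℂ) (k : ℝ) : Prop where
  isOpen : IsOpen U
  embedding : IsOpenEmbedding (U.domRestrict φ)
  nonneg : 0 ≤ k
  lt_one : k < 1
  dilatation : ∃ φx φy : ℂ → ℂ,
    (∀ A ⊆ U, IsCompact A →
      MemLp φx 2 (volume.restrict A) ∧ MemLp φy 2 (volume.restrict A)) ∧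
    HasWeakDeriv φ U 1 φx ∧ HasWeakDeriv φ U Complex.I φy ∧
    ∀ᵐ z ∂(volume.restrict U),
      ‖(φx z + Complex.I * φy z) / 2‖ ≤ k * ‖(φx z - Complex.I * φy z) / 2‖

/-- The covering map `x ↦ e^{2πix}` of the unit circle. -/
def circleCover (x : ℝ) : ℂ := Complex.exp (2 * Real.pi * Complex.I * x)

/-- `φ`, on the neighborhood `U` of the unit circle, is a quasiconformal extension, with
`‖μ‖_{∞,U} ≤ k`, of the circle homeomorphism with lift `H`. -/
structure IsQCExtension (H : ℝ ≃o ℝ) (U : Set ℂ) (φ : ℂ → ℂ) (k : ℝ) : Prop where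
  quasiconformal : IsQuasiconformalOn φ U k
  circle_subset : Metric.sphere (0 : ℂ) 1 ⊆ U
  extends_map : ∀ x : ℝ, φ (circleCover x) = circleCover (H x)

/-- The boundary dilatation `B_h` of the circle homeomorphism with lift `H`: the infimum of
`(1 + k) / (1 - k)` over all quasiconformal extensions to neighborhoods of the circle
(`∞` if there is none). -/
def boundaryDilatation (H : ℝ ≃o ℝ) : ℝ≥0∞ :=
  ⨅ (U : Set ℂ) (φ : ℂ → ℂ) (k : ℝ) (_ : IsQCExtension H U φ k),
    ENNReal.ofReal ((1 + k) / (1 - k))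

/-- The Teichmüller distance `½ log B_h`, `h = h_f ∘ h_g⁻¹`, of the points of the Teichmüller
space that are represented by `(f, h_f)` and `(g, h_g)`. -/
def teichDist {d : ℕ} (f g : MarkedMap d) : EReal :=
  ((1 / 2 : ℝ) : EReal) * ENNReal.log (boundaryDilatation (f.conjugacy g))

end CircleDynamics

end

open CircleDynamics

noncomputable section

namespace CircleDynamics

/-! ### Iterates of an expanding map and bounded distortion -/

/-! The engine is bounded distortion. When an expanding map has a Hölder derivative, all its inverse
iterates change ratios of lengths inside a region of size `L` by a factor at most `exp (A L^α)`,
whatever the number of iterations (`exists_distortion`). Adding digits on the left of a word applies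
further inverse branches, so the ratio of `|I_v|` to `|I_{vi}|` then moves by an amount
exponentially small in the length of `v`. Hence the dual derivative exists, is positive and is
Hölder. The marking is the inverse of the limit of `F^n / d^n`.

For rigidity, let `H` conjugate `G` to `F`. A single point with nonzero derivative already makes `H`
a `C^1`-diffeomorphism: inverse branches carry any pair of secants to arbitrarily small scale at
that point, where both slopes tend to the same number, and distortion compares the original slopes
(`IsConj.secant_le`). Such a point exists as soon as `|I_w(F)| ≤ C |I_w(G)|` for all words, since
then `H` is Lipschitz and its derivative on `[0,1]` has integral `1`
(`IsConj.isC1Diffeo_of_markovLength_le`). Equal dual derivatives give this bound by telescoping `log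
|I_w|` over prefixes, with geometrically summable errors. Conversely, if `H` is `C^1`, its slopes
over `I_v` and `I_{vi}` become asymptotically equal, so the dual derivatives agree.

For the distance, a `C^1` conjugacy extends to the plane as `H × H` in the coordinates `x ± y`; this
descends to an annulus and has small dilatation near the circle, so the boundary dilatation is `1`.
Conversely, boundary dilatation `1` makes `H` Hölder of every exponent `β < 1`. Indeed, the
isoperimetric inequality bounds the integral of the Jacobian over a disc by half the radius times
the boundary energy; integrated against `r^{-2β}`, this bounds a weighted Dirichlet energy, the
`∂_{z̄}` term being absorbed when the dilatation is small, and Morrey's argument gives the Hölder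
estimate. Finally, on repeated words `w^m` the lengths are multiplicative up to fixed factors, so
`m`-th roots remove the Hölder constant and `β → 1` gives `|I_w(F)| ≤ C |I_w(G)|`
(`IsConj.exists_markovLength_le_of_holder`). -/

/-- The `n`-th iterate of the lift, as an order isomorphism. -/
def CircleEndo.iter {d : ℕ} (F : CircleEndo d) : ℕ → ℝ ≃o ℝ
  | 0 => OrderIso.refl ℝ
  | n + 1 => (F.iter n).trans F.lift

namespace CircleEndo

variable {d : ℕ} {F : CircleEndo d}

@[simp] theorem iter_zero (x : ℝ) : F.iter 0 x = x := rfl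

theorem iter_succ (n : ℕ) (x : ℝ) : F.iter (n + 1) x = F.lift (F.iter n x) := rfl

theorem coe_iter (F : CircleEndo d) (n : ℕ) : ⇑(F.iter n) = F.lift^[n] := by
  induction n with
  | zero => rfl
  | succ n ih => ext x; rw [iter_succ, ih, Function.iterate_succ_apply']

theorem iter_add (m n : ℕ) (x : ℝ) : F.iter (m + n) x = F.iter m (F.iter n x) := by
  simp only [coe_iter, Function.iterate_add_apply]

theorem lift_add_nat (x : ℝ) (m : ℕ) : F.lift (x + m) = F.lift x + d * m := by
  induction m with
  | zero => simp
  | succ m ih =>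
    rw [Nat.cast_succ, ← add_assoc, F.map_add_one, ih]; ring

theorem lift_add_int (x : ℝ) (m : ℤ) : F.lift (x + m) = F.lift x + d * m := by
  obtain ⟨n, rfl | rfl⟩ := m.eq_nat_or_neg
  · exact_mod_cast lift_add_nat x n
  · have := lift_add_nat (F := F) (x - n) n
    push_cast
    rw [sub_add_cancel] at this
    rw [← sub_eq_add_neg]; linarith

theorem iter_add_int (n : ℕ) (x : ℝ) (m : ℤ) : F.iter n (x + m) = F.iter n x + d ^ n * m := by
  induction n with
  | zero => simp
  | succ n ih =>
    have h := lift_add_int (F := F) (F.iter n x) ((d : ℤ) ^ n * m)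
    push_cast at h
    rw [iter_succ, ih, h, iter_succ]; ring

@[simp] theorem iter_map_zero (n : ℕ) : F.iter n 0 = 0 := by
  induction n with
  | zero => rfl
  | succ n ih => rw [iter_succ, ih, F.map_zero]

theorem iter_symm_add_int (n : ℕ) (x : ℝ) (m : ℤ) :
    (F.iter n).symm (x + d ^ n * m) = (F.iter n).symm x + m := by
  rw [OrderIso.symm_apply_eq, iter_add_int, OrderIso.apply_symm_apply]

theorem IsC1Holder.differentiable (h : F.IsC1Holder) : Differentiable ℝ F.lift :=
  h.1.differentiable one_ne_zero

theorem IsExpanding.exists_le_deriv (h : F.IsExpanding) :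
    ∃ m : ℝ, 0 < m ∧ ∀ x, m ≤ deriv F.lift x := by
  obtain ⟨C, l, hC, hl, h⟩ := h
  exact ⟨C * l ^ 1, by positivity, fun x => by simpa using h 1 le_rfl x⟩

theorem hasDerivAt_iter (h : Differentiable ℝ F.lift) (n : ℕ) (x : ℝ) :
    HasDerivAt (F.iter n) (∏ k ∈ Finset.range n, deriv F.lift (F.iter k x)) x := by
  induction n with
  | zero =>
    rw [Finset.range_zero, Finset.prod_empty]
    exact hasDerivAt_id x
  | succ n ih =>
    rw [Finset.prod_range_succ, mul_comm]
    exact (h (F.iter n x)).hasDerivAt.comp x ih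

theorem IsExpanding.exists_le_iter_sub (h1 : F.IsC1Holder) (h2 : F.IsExpanding) :
    ∃ C l : ℝ, 0 < C ∧ 1 < l ∧ ∀ (n : ℕ) (x y : ℝ), x ≤ y →
      C * l ^ n * (y - x) ≤ F.iter n y - F.iter n x := by
  obtain ⟨C, l, hC, hl, h⟩ := h2
  -- Expansion is only assumed for `n ≥ 1`; the cap at `1` covers `n = 0`, where the derivative is
  -- `1`.
  refine ⟨min C 1, l, by positivity, hl, fun n x y hxy => ?_⟩
  have hd := hasDerivAt_iter h1.differentiable n
  refine Convex.mul_sub_le_image_sub_of_le_deriv convex_univ (f := F.iter n)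
    (fun z _ => (hd z).continuousAt.continuousWithinAt)
    (fun z _ => (hd z).differentiableAt.differentiableWithinAt) ?_ x (mem_univ _) y (mem_univ _) hxy
  intro z _
  rcases Nat.eq_zero_or_pos n with rfl | hn
  · rw [(hd z).deriv]; simp
  · rw [coe_iter]
    exact (mul_le_mul_of_nonneg_right (min_le_left _ _) (by positivity)).trans (h n hn z)

/-- Since `log t ≤ t - 1`, the difference of logarithms is at most the difference of the derivatives
divided by their positive lower bound. -/
theorem exists_log_deriv_holder (h1 : F.IsC1Holder) (h2 : F.IsExpanding) :
    ∃ K α : ℝ, 0 ≤ K ∧ 0 < α ∧ ∀ u v : ℝ,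
      Real.log (deriv F.lift u) - Real.log (deriv F.lift v) ≤ K * |u - v| ^ α := by
  obtain ⟨m, hm, hml⟩ := h2.exists_le_deriv
  obtain ⟨-, C, α, hα, -, hH⟩ := h1
  refine ⟨C / m, α, by positivity, by exact_mod_cast hα, fun u v => ?_⟩
  have hu := hm.trans_le (hml u)
  have hv := hm.trans_le (hml v)
  rw [← Real.log_div hu.ne' hv.ne']
  refine (Real.log_le_sub_one_of_pos (div_pos hu hv)).trans ?_
  have h3 := hH.dist_le u v
  rw [Real.dist_eq, Real.dist_eq] at h3
  have h4 : deriv F.lift u / deriv F.lift v - 1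
      = (deriv F.lift u - deriv F.lift v) / deriv F.lift v := by field_simp
  rw [h4, div_le_iff₀ hv]
  have h5 : 0 ≤ (C : ℝ) * |u - v| ^ (α : ℝ) := by positivity
  calc _ ≤ (C : ℝ) * |u - v| ^ (α : ℝ) := (le_abs_self _).trans h3
    _ = (C / m * |u - v| ^ (α : ℝ)) * m := by field_simp
    _ ≤ _ := by gcongr; exact hml v

/-- Expansion read backwards makes the distance of the `k`-th iterates at most a constant times
`l^{-(n-k)}` times that of the `n`-th. The Hölder bounds for `log F'` along the two orbits therefore
sum to a geometric series, independent of `n`. -/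
theorem exists_prod_deriv_le (h1 : F.IsC1Holder) (h2 : F.IsExpanding) :
    ∃ A α : ℝ, 0 ≤ A ∧ 0 < α ∧ ∀ (n : ℕ) (x y : ℝ),
      ∏ k ∈ Finset.range n, deriv F.lift (F.iter k x) ≤
        Real.exp (A * |F.iter n x - F.iter n y| ^ α) *
          ∏ k ∈ Finset.range n, deriv F.lift (F.iter k y) := by
  obtain ⟨K, α, hK, hα, hH⟩ := exists_log_deriv_holder h1 h2
  obtain ⟨C, l, hC, hl, hE⟩ := h2.exists_le_iter_sub h1
  obtain ⟨m, hm, hml⟩ := h2.exists_le_deriv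
  have hpos : ∀ x, 0 < deriv F.lift x := fun x => hm.trans_le (hml x)
  have hl0 : 0 < l := one_pos.trans hl
  set ρ : ℝ := (l ^ α)⁻¹ with hρ
  have hρ0 : 0 < ρ := by positivity
  have hρ1 : ρ < 1 := inv_lt_one_of_one_lt₀ (Real.one_lt_rpow hl hα)
  refine ⟨K * (C⁻¹ ^ α) * (1 - ρ)⁻¹, α, ?_, hα, fun n x y => ?_⟩
  · have : 0 < 1 - ρ := by linarith
    positivity
  have hEabs : ∀ (k : ℕ) (u v : ℝ), |u - v| ≤ C⁻¹ * (l ^ k)⁻¹ * |F.iter k u - F.iter k v| := by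
    intro k u v
    have hck : 0 < C * l ^ k := by positivity
    rw [← mul_inv, inv_mul_eq_div, le_div_iff₀ hck, mul_comm]
    rcases le_total u v with h | h
    · have := hE k u v h
      rw [abs_sub_comm, abs_of_nonneg (sub_nonneg.2 h), abs_sub_comm]
      exact this.trans (le_abs_self _)
    · have := hE k v u h
      rw [abs_of_nonneg (sub_nonneg.2 h)]
      exact this.trans (le_abs_self _)
  -- One power of `l` is given away (`n - 1 - k` in place of `n - k`) so that reversing the range
  -- turns the sum into a plain geometric one.
  have hterm : ∀ k ∈ Finset.range n,
      Real.log (deriv F.lift (F.iter k x)) - Real.log (deriv F.lift (F.iter k y)) ≤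
        K * (C⁻¹ ^ α) * |F.iter n x - F.iter n y| ^ α * ρ ^ (n - 1 - k) := by
    intro k hk
    have hk' : k < n := Finset.mem_range.1 hk
    refine (hH _ _).trans ?_
    have h3 := hEabs (n - k) (F.iter k x) (F.iter k y)
    rw [← iter_add, ← iter_add, Nat.sub_add_cancel hk'.le] at h3
    have h4 : |F.iter k x - F.iter k y| ^ α ≤
        (C⁻¹ * (l ^ (n - 1 - k))⁻¹ * |F.iter n x - F.iter n y|) ^ α := by
      refine Real.rpow_le_rpow (abs_nonneg _) (h3.trans ?_) hα.le
      gcongr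
      · exact hl.le
      · omega
    rw [Real.mul_rpow (by positivity) (abs_nonneg _), Real.mul_rpow (by positivity) (by positivity)]
      at h4
    have h5 : ((l ^ (n - 1 - k))⁻¹) ^ α = ρ ^ (n - 1 - k) := by
      rw [hρ, Real.inv_rpow (by positivity), ← Real.rpow_natCast, ← Real.rpow_mul hl0.le, mul_comm,
        Real.rpow_mul hl0.le, Real.rpow_natCast, inv_pow]
    rw [h5] at h4
    calc _ ≤ K * (C⁻¹ ^ α * ρ ^ (n - 1 - k) * |F.iter n x - F.iter n y| ^ α) := by gcongr
      _ = _ := by ring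
  have hsum := Finset.sum_le_sum hterm
  rw [← Finset.mul_sum, Finset.sum_range_reflect (fun k => ρ ^ k) n, Finset.sum_sub_distrib,
    ← Real.log_prod (fun k _ => (hpos _).ne'), ← Real.log_prod (fun k _ => (hpos _).ne')] at hsum
  have hgeo : ∑ k ∈ Finset.range n, ρ ^ k ≤ (1 - ρ)⁻¹ := by
    rw [← tsum_geometric_of_lt_one hρ0.le hρ1]
    exact (summable_geometric_of_lt_one hρ0.le hρ1).sum_le_tsum _ (fun i _ => by positivity)
  have hpx : 0 < ∏ k ∈ Finset.range n, deriv F.lift (F.iter k x) :=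
    Finset.prod_pos fun k _ => hpos _
  have hpy : 0 < ∏ k ∈ Finset.range n, deriv F.lift (F.iter k y) :=
    Finset.prod_pos fun k _ => hpos _
  rw [← Real.exp_log hpx, ← Real.exp_log hpy, ← Real.exp_add, Real.exp_le_exp]
  have : K * (C⁻¹ ^ α) * |F.iter n x - F.iter n y| ^ α * ∑ k ∈ Finset.range n, ρ ^ k ≤
      K * (C⁻¹ ^ α) * |F.iter n x - F.iter n y| ^ α * (1 - ρ)⁻¹ := by gcongr
  linarith

/-- Bounded distortion: inverse iterates distort the ratios of nearby secant lengths by a factor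
which tends to `1` with the size of the region, uniformly in the number of iterations. -/
theorem exists_distortion (h1 : F.IsC1Holder) (h2 : F.IsExpanding) :
    ∃ A α : ℝ, 0 ≤ A ∧ 0 < α ∧ ∀ (n : ℕ) (c L p q r s : ℝ), p < q → r < s →
      p ∈ Icc c (c + L) → q ∈ Icc c (c + L) → r ∈ Icc c (c + L) → s ∈ Icc c (c + L) →
      ((F.iter n).symm q - (F.iter n).symm p) * (s - r) ≤
        Real.exp (A * L ^ α) * ((F.iter n).symm s - (F.iter n).symm r) * (q - p) := by
  obtain ⟨A, α, hA, hα, hD⟩ := exists_prod_deriv_le h1 h2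
  refine ⟨A, α, hA, hα, fun n c L p q r s hpq hrs hp hq hr hs => ?_⟩
  have hd := hasDerivAt_iter h1.differentiable n
  -- A secant of the inverse iterate is the reciprocal of the derivative at an intermediate point
  -- whose `n`-th image lies in `[u, v]`; distortion of derivatives thus becomes distortion of
  -- lengths.
  have mvt : ∀ u v : ℝ, u < v → ∃ ξ, F.iter n ξ ∈ Icc u v ∧
      v - u = (∏ k ∈ Finset.range n, deriv F.lift (F.iter k ξ)) *
        ((F.iter n).symm v - (F.iter n).symm u) := by
    intro u v huv
    obtain ⟨ξ, hξ, he⟩ := exists_hasDerivAt_eq_slope (F.iter n) _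
      ((F.iter n).symm.strictMono huv) (F.iter n).continuous.continuousOn (fun z _ => hd z)
    refine ⟨ξ, ⟨?_, ?_⟩, ?_⟩
    · simpa using (F.iter n).monotone hξ.1.le
    · simpa using (F.iter n).monotone hξ.2.le
    · have : 0 < (F.iter n).symm v - (F.iter n).symm u :=
        sub_pos.2 ((F.iter n).symm.strictMono huv)
      rw [he]; simp [this.ne']
  obtain ⟨ξ, hξ, e1⟩ := mvt p q hpq
  obtain ⟨η, hη, e2⟩ := mvt r s hrs
  have h3 := hD n η ξ
  have h4 : |F.iter n η - F.iter n ξ| ≤ L := by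
    rw [abs_le]
    constructor <;> linarith [hξ.1, hξ.2, hη.1, hη.2, hp.1, hq.2, hr.1, hs.2]
  have h5 : Real.exp (A * |F.iter n η - F.iter n ξ| ^ α) ≤ Real.exp (A * L ^ α) := by
    gcongr
  have h6 : 0 < (F.iter n).symm q - (F.iter n).symm p := sub_pos.2 ((F.iter n).symm.strictMono hpq)
  have h7 : 0 < (F.iter n).symm s - (F.iter n).symm r := sub_pos.2 ((F.iter n).symm.strictMono hrs)
  have hpξ : 0 < ∏ k ∈ Finset.range n, deriv F.lift (F.iter k ξ) := by
    by_contra hcon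
    have := mul_nonpos_of_nonpos_of_nonneg (not_lt.1 hcon) h6.le
    linarith
  rw [e1, e2]
  calc _ = ((F.iter n).symm q - (F.iter n).symm p) * ((F.iter n).symm s - (F.iter n).symm r) *
        ∏ k ∈ Finset.range n, deriv F.lift (F.iter k η) := by ring
    _ ≤ ((F.iter n).symm q - (F.iter n).symm p) * ((F.iter n).symm s - (F.iter n).symm r) *
        (Real.exp (A * L ^ α) * ∏ k ∈ Finset.range n, deriv F.lift (F.iter k ξ)) := by
        have := h3.trans (mul_le_mul_of_nonneg_right h5 hpξ.le)
        gcongr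
    _ = _ := by ring

/-! ### The marking -/

theorem abs_sub_le_of_map_int {K : ℝ → ℝ} (hK : Monotone K) {D : ℝ} (hD : 0 ≤ D)
    (h : ∀ m : ℤ, K m = D * m) (x : ℝ) : |K x - D * x| ≤ D := by
  have h1 := hK (Int.floor_le x)
  have h2 := hK (Int.lt_floor_add_one x).le
  have h3 := h (⌊x⌋ + 1)
  push_cast at h3
  rw [h] at h1
  rw [h3] at h2
  rw [abs_le]
  constructor <;> nlinarith [Int.floor_le x, Int.lt_floor_add_one x]

theorem iter_int (n : ℕ) (m : ℤ) : F.iter n m = d ^ n * m := by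
  have := iter_add_int (F := F) n 0 m
  simpa using this

theorem abs_iter_sub_le (n : ℕ) (x : ℝ) : |F.iter n x - d ^ n * x| ≤ d ^ n :=
  abs_sub_le_of_map_int (F.iter n).monotone (by positivity) (iter_int n) x

/-- The inverse of the marking is `K x = lim F^n x / d^n`. The sequence is uniformly Cauchy because
`F^m` stays within `d^m` of `d^m x`, so `K` is continuous and monotone, commutes with integer
translations, and satisfies `K (F x) = d K x`. -/
theorem exists_isMarking (hd : 2 ≤ d) (h1 : F.IsC1Holder) (h2 : F.IsExpanding) :
    ∃ H : ℝ ≃o ℝ, IsMarking F H := by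
  have hd0 : (0 : ℝ) < d := by positivity
  have hd1 : (1 : ℝ) < d := by exact_mod_cast (by omega : 1 < d)
  have hinv : Tendsto (fun n : ℕ => ((d : ℝ) ^ n)⁻¹) atTop (𝓝 0) :=
    (tendsto_pow_atTop_atTop_of_one_lt hd1).inv_tendsto_atTop
  set a : ℕ → ℝ → ℝ := fun n x => F.iter n x / d ^ n with ha
  have hstep : ∀ (n m : ℕ) (x : ℝ), |a (m + n) x - a n x| ≤ ((d : ℝ) ^ n)⁻¹ := by
    intro n m x
    have h := abs_iter_sub_le (F := F) m (F.iter n x)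
    have e : a (m + n) x - a n x =
        (F.iter m (F.iter n x) - d ^ m * F.iter n x) / (d ^ m * d ^ n) := by
      simp only [ha, iter_add, pow_add]; field_simp
    rw [e, abs_div, abs_of_pos (by positivity : (0 : ℝ) < d ^ m * d ^ n),
      div_le_iff₀ (by positivity)]
    calc _ ≤ (d : ℝ) ^ m := h
      _ = _ := by field_simp
  have hlim : ∀ x, ∃ y, Tendsto (fun n => a n x) atTop (𝓝 y) := by
    intro x
    refine cauchySeq_tendsto_of_complete (cauchySeq_of_le_tendsto_0' _ (fun n m hnm => ?_) hinv)
    obtain ⟨k, rfl⟩ := Nat.exists_eq_add_of_le' hnm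
    rw [dist_comm]
    exact hstep n k x
  choose K hK using hlim
  have hKa : ∀ n x, |K x - a n x| ≤ ((d : ℝ) ^ n)⁻¹ := fun n x =>
    le_of_tendsto (((hK x).comp (tendsto_add_atTop_nat n)).sub_const _).abs
      (Eventually.of_forall fun m => hstep n m x)
  have hmono : Monotone K := fun x y hxy => le_of_tendsto_of_tendsto' (hK x) (hK y) fun n => by
    simp only [ha]; gcongr
  have hKint : ∀ x (m : ℤ), K (x + m) = K x + m := fun x m => by
    refine tendsto_nhds_unique (hK _) (((hK x).add_const (m : ℝ)).congr fun n => ?_)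
    simp only [ha, iter_add_int]; field_simp
  have hK0 : K 0 = 0 := tendsto_nhds_unique (hK 0) (by simp [ha])
  have hKF : ∀ x, K (F.lift x) = d * K x := fun x => by
    refine tendsto_nhds_unique (hK _)
      ((((hK x).comp (tendsto_add_atTop_nat 1)).const_mul (d : ℝ)).congr fun n => ?_)
    have : F.iter (n + 1) x = F.iter n (F.lift x) := by rw [iter_add]; rfl
    simp only [ha, Function.comp, this]; field_simp; ring
  have hcont : Continuous K := by
    have : TendstoUniformly a K atTop := by
      rw [Metric.tendstoUniformly_iff]
      intro ε hε
      filter_upwards [hinv.eventually (gt_mem_nhds hε)] with n hn x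
      exact (hKa n x).trans_lt hn
    exact this.continuous (Eventually.of_forall fun n => (F.iter n).continuous.div_const _).frequently
  -- If `K x = K y` with `x < y`, expansion separates `F^n x` and `F^n y` by at least `1` for some
  -- `n`, so `K` differs by at least `1` there; yet both values are `d^n` times the same number.
  have hstrict : StrictMono K := by
    refine hmono.strictMono_of_injective fun x y hxy => ?_
    by_contra hne
    wlog hlt : x < y generalizing x y
    · exact this y x hxy.symm (Ne.symm hne) (lt_of_le_of_ne (not_lt.1 hlt) (Ne.symm hne))
    obtain ⟨C, l, hC, hl, hE⟩ := h2.exists_le_iter_sub h1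
    have hKn : ∀ n z, K (F.iter n z) = d ^ n * K z := by
      intro n z
      induction n with
      | zero => simp
      | succ n ih => rw [iter_succ, hKF, ih]; ring
    obtain ⟨n, hn⟩ := pow_unbounded_of_one_lt ((C * (y - x))⁻¹) hl
    have hp : 0 < C * (y - x) := mul_pos hC (sub_pos.2 hlt)
    have h3 : 1 < C * l ^ n * (y - x) := by
      rw [inv_lt_iff_one_lt_mul₀ hp] at hn; linarith
    have h4 := hmono (show F.iter n x + (1 : ℤ) ≤ F.iter n y by
      have := hE n x y hlt.le; push_cast; linarith)
    rw [hKint, hKn, hKn, hxy] at h4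
    norm_num at h4
  have hbd : ∀ x, |K x - x| ≤ 1 := fun x => by simpa [ha] using hKa 0 x
  have hsurj : Function.Surjective K := by
    refine hcont.surjective ?_ ?_
    · exact tendsto_atTop_mono (fun x => by have := (abs_le.1 (hbd x)).1; simp only [id]; linarith)
        (tendsto_atTop_add_const_right _ (-1 : ℝ) tendsto_id)
    · exact tendsto_atBot_mono (fun x => by have := (abs_le.1 (hbd x)).2; simp only [id]; linarith)
        (tendsto_atBot_add_const_right _ (1 : ℝ) tendsto_id)
  set e : ℝ ≃o ℝ := hstrict.orderIsoOfSurjective K hsurj with he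
  have hee : ∀ x, e x = K x := fun _ => rfl
  refine ⟨e.symm, ?_, fun x => ?_, fun x => ?_⟩
  · rw [OrderIso.symm_apply_eq, hee, hK0]
  · have := hKint (e.symm x) 1
    push_cast at this
    rw [OrderIso.symm_apply_eq, hee, this, ← hee, OrderIso.apply_symm_apply]
  · rw [eq_comm, OrderIso.symm_apply_eq, hee, hKF, ← hee, OrderIso.apply_symm_apply]

end CircleEndo

/-! ### Uniqueness of the marking -/

namespace IsMarking

variable {d : ℕ} {F : CircleEndo d} {H H' : ℝ ≃o ℝ}

theorem map_add_int (h : ∀ x, H (x + 1) = H x + 1) (x : ℝ) (m : ℤ) : H (x + m) = H x + m := by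
  have hn : ∀ (n : ℕ) (x : ℝ), H (x + n) = H x + n := by
    intro n x
    induction n with
    | zero => simp
    | succ n ih => rw [Nat.cast_succ, ← add_assoc, h, ih, add_assoc]
  obtain ⟨n, rfl | rfl⟩ := m.eq_nat_or_neg
  · exact_mod_cast hn n x
  · have := hn n (x - n)
    push_cast
    rw [sub_add_cancel] at this
    rw [← sub_eq_add_neg]; linarith

theorem abs_symm_sub_le (hH : IsMarking F H) (x : ℝ) : |H.symm x - x| ≤ 1 := by
  have h : ∀ m : ℤ, H.symm m = 1 * m := fun m => by
    rw [OrderIso.symm_apply_eq]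
    simpa [hH.map_zero] using (map_add_int hH.map_add_one 0 m).symm
  simpa using CircleEndo.abs_sub_le_of_map_int H.symm.monotone zero_le_one h x

theorem symm_iter (hH : IsMarking F H) (n : ℕ) (x : ℝ) :
    H.symm (F.iter n x) = d ^ n * H.symm x := by
  induction n with
  | zero => simp
  | succ n ih =>
    have h := hH.conj (H.symm (F.iter n x))
    rw [OrderIso.apply_symm_apply] at h
    rw [CircleEndo.iter_succ, h, OrderIso.symm_apply_apply, ih]; ring

/-- Both inverses stay within `1` of the identity and turn `F^n` into multiplication by `d^n`; a
discrepancy at `x` would be multiplied by `d^n` at `F^n x` while remaining at most `2`. -/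
theorem unique (hd : 2 ≤ d) (hH : IsMarking F H) (hH' : IsMarking F H') : H = H' := by
  have hd1 : (1 : ℝ) < d := by exact_mod_cast (by omega : 1 < d)
  have : H.symm = H'.symm := by
    ext x
    by_contra hne
    have hpos : 0 < |H.symm x - H'.symm x| := abs_pos.2 (sub_ne_zero.2 hne)
    obtain ⟨n, hn⟩ := pow_unbounded_of_one_lt (2 / |H.symm x - H'.symm x|) hd1
    rw [div_lt_iff₀ hpos] at hn
    have h1 := hH.abs_symm_sub_le (F.iter n x)
    have h2 := hH'.abs_symm_sub_le (F.iter n x)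
    rw [hH.symm_iter] at h1
    rw [hH'.symm_iter] at h2
    have h3 : (d : ℝ) ^ n * |H.symm x - H'.symm x| ≤ 2 := by
      rw [← abs_of_pos (by positivity : (0 : ℝ) < d ^ n), ← abs_mul, mul_sub]
      rw [abs_le] at *
      constructor <;> linarith [h1.1, h1.2, h2.1, h2.2]
    linarith
  rw [← H.symm_symm, this, H'.symm_symm]

end IsMarking

/-! ### Regularity from control of secant slopes -/

/-- Secant slopes of a function near a point of differentiability, between points whose distance
is comparable with the distance to that point. -/
theorem tendsto_secant_of_hasDerivAt {H : ℝ → ℝ} {a z M : ℝ} (hz : HasDerivAt H a z)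
    {p q : ℕ → ℝ} (hpq : ∀ n, p n < q n) (hp : Tendsto p atTop (𝓝 z)) (hq : Tendsto q atTop (𝓝 z))
    (hpM : ∀ n, |p n - z| ≤ M * (q n - p n)) (hqM : ∀ n, |q n - z| ≤ M * (q n - p n)) :
    Tendsto (fun n => (H (q n) - H (p n)) / (q n - p n)) atTop (𝓝 a) := by
  have ho := hz.isLittleO
  have hbig : ∀ u : ℕ → ℝ, (∀ n, |u n - z| ≤ M * (q n - p n)) →
      (fun n => u n - z) =O[atTop] fun n => q n - p n := fun u hu =>
    Asymptotics.IsBigO.of_bound M (Eventually.of_forall fun n => by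
      rw [Real.norm_eq_abs, Real.norm_eq_abs, abs_of_pos (sub_pos.2 (hpq n))]; exact hu n)
  have h1 := (ho.comp_tendsto hp).trans_isBigO (hbig p hpM)
  have h2 := (ho.comp_tendsto hq).trans_isBigO (hbig q hqM)
  have h3 := (h2.sub h1).tendsto_div_nhds_zero
  have h4 := h3.add_const a
  rw [zero_add] at h4
  refine h4.congr fun n => ?_
  have : q n - p n ≠ 0 := (sub_pos.2 (hpq n)).ne'
  simp only [Function.comp, smul_eq_mul]
  field_simp
  ring

/-- Slopes near a point agree up to a factor `1 + ε`, so they form a Cauchy family. The same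
comparison between a slope and nearby limits makes the derivative positive and continuous. -/
theorem exists_hasDerivAt_of_secant {H : ℝ → ℝ} (hH : StrictMono H)
    (hs : ∀ x, ∀ ε > 0, ∃ δ > 0, ∀ p q r s : ℝ, p < q → r < s →
      p ∈ Icc (x - δ) (x + δ) → q ∈ Icc (x - δ) (x + δ) → r ∈ Icc (x - δ) (x + δ) →
      s ∈ Icc (x - δ) (x + δ) → slope H p q ≤ (1 + ε) * slope H r s) :
    ∃ D : ℝ → ℝ, Continuous D ∧ (∀ x, 0 < D x) ∧ ∀ x, HasDerivAt H (D x) x := by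
  have hpos : ∀ p q, p ≠ q → 0 < slope H p q := by
    intro p q hpq
    wlog h : p < q generalizing p q
    · rw [slope_comm]; exact this q p hpq.symm (lt_of_le_of_ne (not_lt.1 h) hpq.symm)
    rw [slope_def_field]
    exact div_pos (sub_pos.2 (hH h)) (sub_pos.2 h)
  have hs' : ∀ x, ∀ ε > 0, ∃ δ > 0, ∀ p q r s : ℝ, p ≠ q → r ≠ s →
      p ∈ Icc (x - δ) (x + δ) → q ∈ Icc (x - δ) (x + δ) → r ∈ Icc (x - δ) (x + δ) →
      s ∈ Icc (x - δ) (x + δ) → slope H p q ≤ (1 + ε) * slope H r s := by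
    intro x ε hε
    obtain ⟨δ, hδ, h⟩ := hs x ε hε
    refine ⟨δ, hδ, fun p q r s hpq hrs hp hq hr hs => ?_⟩
    rcases lt_or_gt_of_ne hpq with h1 | h1 <;> rcases lt_or_gt_of_ne hrs with h2 | h2
    · exact h p q r s h1 h2 hp hq hr hs
    · rw [slope_comm H r]; exact h p q s r h1 h2 hp hq hs hr
    · rw [slope_comm H p]; exact h q p r s h1 h2 hq hp hr hs
    · rw [slope_comm H p, slope_comm H r]; exact h q p s r h1 h2 hq hp hs hr
  have hlim : ∀ x, ∃ D, Tendsto (slope H x) (𝓝[≠] x) (𝓝 D) := by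
    intro x
    rw [← cauchy_map_iff_exists_tendsto, Metric.cauchy_iff]
    refine ⟨inferInstance, fun ε hε => ?_⟩
    -- The crude case `ε = 1` bounds all nearby slopes at `x` by `2M`; a relative error `ε / (4M)`
    -- is then an absolute error of at most `ε / 2`.
    obtain ⟨δ₀, hδ₀, h0⟩ := hs' x 1 one_pos
    set M := slope H x (x + δ₀) with hM
    have hMpos : 0 < M := hpos _ _ (by linarith)
    obtain ⟨δ, hδ, h⟩ := hs' x (ε / (4 * M)) (by positivity)
    have hmem : Icc (x - min δ δ₀) (x + min δ δ₀) ∈ 𝓝 x :=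
      Icc_mem_nhds (by linarith [lt_min hδ hδ₀]) (by linarith [lt_min hδ hδ₀])
    refine ⟨slope H x '' (Icc (x - min δ δ₀) (x + min δ δ₀) ∩ {x}ᶜ),
      image_mem_map (inter_mem (mem_nhdsWithin_of_mem_nhds hmem) self_mem_nhdsWithin), ?_⟩
    have key : ∀ y ∈ Icc (x - min δ δ₀) (x + min δ δ₀) ∩ {x}ᶜ,
        ∀ y' ∈ Icc (x - min δ δ₀) (x + min δ δ₀) ∩ {x}ᶜ, slope H x y - slope H x y' < ε := by
      rintro y ⟨hy, hyx⟩ y' ⟨hy', hyx'⟩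
      have hyx1 : x ≠ y := fun e => hyx e.symm
      have hyx2 : x ≠ y' := fun e => hyx' e.symm
      have m1 := min_le_left δ δ₀
      have m2 := min_le_right δ δ₀
      have h3 := h x y x y' hyx1 hyx2 ⟨by linarith, by linarith⟩ ⟨by linarith [hy.1], by linarith [hy.2]⟩
        ⟨by linarith, by linarith⟩ ⟨by linarith [hy'.1], by linarith [hy'.2]⟩
      have h4 := h0 x y' x (x + δ₀) hyx2 (by linarith) ⟨by linarith, by linarith⟩
        ⟨by linarith [hy'.1], by linarith [hy'.2]⟩ ⟨by linarith, by linarith⟩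
        ⟨by linarith, by linarith⟩
      rw [← hM] at h4
      have h5 : ε / (4 * M) * slope H x y' ≤ ε / (4 * M) * ((1 + 1) * M) := by gcongr
      have h6 : ε / (4 * M) * ((1 + 1) * M) = ε / 2 := by field_simp; ring
      linarith
    rintro _ ⟨y, hy, rfl⟩ _ ⟨y', hy', rfl⟩
    rw [Real.dist_eq, abs_lt]
    constructor <;> linarith [key y hy y' hy', key y' hy' y hy]
  choose D hD using hlim
  have hDs : ∀ x, ∀ ε > 0, ∃ δ > 0, ∀ y ∈ Ioo (x - δ) (x + δ), ∀ r ∈ Icc (x - δ) (x + δ),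
      ∀ s ∈ Icc (x - δ) (x + δ), r ≠ s →
        D y ≤ (1 + ε) * slope H r s ∧ slope H r s ≤ (1 + ε) * D y := by
    intro x ε hε
    obtain ⟨δ, hδ, h⟩ := hs' x ε hε
    refine ⟨δ, hδ, fun y hy r hr s hs hrs => ⟨le_of_tendsto (hD y) ?_,
      ge_of_tendsto ((hD y).const_mul _) ?_⟩⟩
    · filter_upwards [mem_nhdsWithin_of_mem_nhds (Icc_mem_nhds hy.1 hy.2), self_mem_nhdsWithin]
        with u hu hne
      exact h y u r s (fun e => hne e.symm) hrs ⟨hy.1.le, hy.2.le⟩ hu hr hs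
    · filter_upwards [mem_nhdsWithin_of_mem_nhds (Icc_mem_nhds hy.1 hy.2), self_mem_nhdsWithin]
        with u hu hne
      exact h r s y u hrs (fun e => hne e.symm) hr hs ⟨hy.1.le, hy.2.le⟩ hu
  have hDpos : ∀ x, 0 < D x := by
    intro x
    obtain ⟨δ, hδ, h⟩ := hDs x 1 one_pos
    have h1 := (h x ⟨by linarith, by linarith⟩ x ⟨by linarith, by linarith⟩ (x + δ)
      ⟨by linarith, by linarith⟩ (by linarith)).2
    have h2 := hpos x (x + δ) (by linarith)
    linarith
  refine ⟨D, ?_, hDpos, fun x => hasDerivAt_iff_tendsto_slope.2 (hD x)⟩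
  rw [continuous_iff_continuousAt]
  intro x
  rw [ContinuousAt, Metric.tendsto_nhds]
  intro ε hε
  have hDx := hDpos x
  -- Capping the relative error `η` at `1` gives `D y ≤ 2 D x`, so that `η D x ≤ ε / 3` and `η D y ≤
  -- 2 ε / 3`.
  obtain ⟨δ, hδ, h⟩ := hDs x (min 1 (ε / (3 * D x))) (by positivity)
  have h' : ∀ y ∈ Ioo (x - δ) (x + δ),
      D y ≤ (1 + min 1 (ε / (3 * D x))) * D x ∧ D x ≤ (1 + min 1 (ε / (3 * D x))) * D y := by
    refine fun y hy => ⟨?_, ?_⟩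
    · refine ge_of_tendsto ((hD x).const_mul _) ?_
      filter_upwards [mem_nhdsWithin_of_mem_nhds (Icc_mem_nhds (by linarith : x - δ < x)
        (by linarith : x < x + δ)), self_mem_nhdsWithin] with u hu hne
      exact (h y hy x ⟨by linarith, by linarith⟩ u hu (fun e => hne e.symm)).1
    · refine le_of_tendsto (hD x) ?_
      filter_upwards [mem_nhdsWithin_of_mem_nhds (Icc_mem_nhds (by linarith : x - δ < x)
        (by linarith : x < x + δ)), self_mem_nhdsWithin] with u hu hne
      exact (h y hy x ⟨by linarith, by linarith⟩ u hu (fun e => hne e.symm)).2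
  filter_upwards [Ioo_mem_nhds (by linarith : x - δ < x) (by linarith : x < x + δ)] with y hy
  obtain ⟨h1, h2⟩ := h' y hy
  set η := min 1 (ε / (3 * D x)) with hη
  have hη0 : 0 < η := by positivity
  have hη1 : η ≤ 1 := min_le_left _ _
  have hηD : η * D x ≤ ε / 3 := by
    have : η * D x ≤ ε / (3 * D x) * D x := by gcongr; exact min_le_right _ _
    have e : ε / (3 * D x) * D x = ε / 3 := by field_simp
    linarith
  have hDy := hDpos y
  have h3 : η * D y ≤ 2 * (ε / 3) := by
    have : η * D y ≤ η * ((1 + η) * D x) := by gcongr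
    nlinarith
  rw [Real.dist_eq, abs_lt]
  constructor <;> linarith

theorem isC1Diffeo_of_hasDerivAt (H : ℝ ≃o ℝ) {D : ℝ → ℝ} (hD : Continuous D)
    (hpos : ∀ x, 0 < D x) (hH : ∀ x, HasDerivAt H (D x) x) : IsC1Diffeo H := by
  have h2 : ∀ y, HasDerivAt H.symm (D (H.symm y))⁻¹ y := fun y =>
    HasDerivAt.of_local_left_inverse H.symm.continuous.continuousAt (hH _) (hpos _).ne'
      (Eventually.of_forall fun z => H.apply_symm_apply z)
  constructor
  · rw [contDiff_one_iff_deriv]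
    exact ⟨fun x => (hH x).differentiableAt, by rwa [show deriv H = D from funext fun x => (hH x).deriv]⟩
  · rw [contDiff_one_iff_deriv]
    refine ⟨fun x => (h2 x).differentiableAt, ?_⟩
    rw [show deriv H.symm = fun y => (D (H.symm y))⁻¹ from funext fun x => (h2 x).deriv]
    exact (hD.comp H.symm.continuous).inv₀ fun y => (hpos _).ne'

/-! ### Conjugacies -/

/-- `H` is the lift of a circle homeomorphism that conjugates `G` to `F`. -/
structure IsConj {d : ℕ} (F G : CircleEndo d) (H : ℝ ≃o ℝ) : Prop where
  map_zero : H 0 = 0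
  map_add_one : ∀ x, H (x + 1) = H x + 1
  conj : ∀ x, F.lift (H x) = H (G.lift x)

theorem MarkedMap.isConj {d : ℕ} (f g : MarkedMap d) :
    IsConj f.map.1 g.map.1 (f.conjugacy g) := by
  have hf := f.isMarking
  have hg := g.isMarking
  refine ⟨?_, ?_, ?_⟩
  · have h0 : g.marking.symm 0 = 0 := by rw [OrderIso.symm_apply_eq, hg.map_zero]
    simp only [MarkedMap.conjugacy, OrderIso.trans_apply, h0, hf.map_zero]
  · intro x
    have h1 := hg.map_add_one (g.marking.symm x)
    rw [OrderIso.apply_symm_apply] at h1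
    simp only [MarkedMap.conjugacy, OrderIso.trans_apply]
    rw [← h1, OrderIso.symm_apply_apply, hf.map_add_one]
  · intro x
    have h1 := hg.conj (g.marking.symm x)
    rw [OrderIso.apply_symm_apply] at h1
    simp only [MarkedMap.conjugacy, OrderIso.trans_apply]
    rw [h1, OrderIso.symm_apply_apply, hf.conj]

namespace IsConj

variable {d : ℕ} {F G : CircleEndo d} {H : ℝ ≃o ℝ}

theorem iter (h : IsConj F G H) (n : ℕ) (x : ℝ) : F.iter n (H x) = H (G.iter n x) := by
  induction n with
  | zero => rfl
  | succ n ih => rw [CircleEndo.iter_succ, ih, h.conj, CircleEndo.iter_succ]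

theorem iter_symm (h : IsConj F G H) (n : ℕ) (x : ℝ) :
    (F.iter n).symm (H x) = H ((G.iter n).symm x) := by
  rw [OrderIso.symm_apply_eq, h.iter, OrderIso.apply_symm_apply]

theorem map_add_int (h : IsConj F G H) (x : ℝ) (m : ℤ) : H (x + m) = H x + m :=
  IsMarking.map_add_int h.map_add_one x m

/-- Around a point of differentiability with nonzero derivative, the dynamics makes every secant
slope the limit of a slope at arbitrarily small scale; bounded distortion then controls all
secant slopes. -/
theorem secant_le (h : IsConj F G H) (hF1 : F.IsC1Holder) (hF2 : F.IsExpanding)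
    (hG1 : G.IsC1Holder) (hG2 : G.IsExpanding) {z a : ℝ} (hz : HasDerivAt H a z) (ha : a ≠ 0) :
    ∃ A α B β : ℝ, 0 ≤ A ∧ 0 < α ∧ 0 ≤ B ∧ 0 < β ∧ ∀ c L p q r s : ℝ, p < q → r < s →
      p ∈ Icc c (c + L) → q ∈ Icc c (c + L) → r ∈ Icc c (c + L) → s ∈ Icc c (c + L) →
      slope H p q ≤ Real.exp (A * (H (c + L) - H c) ^ α + B * L ^ β) * slope H r s := by
  obtain ⟨A, α, hA, hα, hF⟩ := CircleEndo.exists_distortion hF1 hF2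
  obtain ⟨B, β, hB, hβ, hG⟩ := CircleEndo.exists_distortion hG1 hG2
  obtain ⟨C, l, hC, hl, hE⟩ := hG2.exists_le_iter_sub hG1
  refine ⟨A, α, B, β, hA, hα, hB, hβ, fun c L p q r s hpq hrs hp hq hr hs => ?_⟩
  have ha0 : 0 < a := lt_of_le_of_ne (by
    rw [← hz.deriv]; exact H.monotone.deriv_nonneg) ha.symm
  -- The integer shift selects the inverse branch `T n` of `G^n` that maps `[0,1]` onto an interval
  -- containing `z`.
  set N : ℕ → ℤ := fun n => ⌊G.iter n z⌋ with hN
  set T : ℕ → ℝ → ℝ := fun n x => (G.iter n).symm (x + N n) with hT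
  have hTm : ∀ n, StrictMono (T n) := fun n x y hxy => (G.iter n).symm.strictMono (by linarith)
  have hzT : ∀ n, T n 0 ≤ z ∧ z ≤ T n 1 := fun n => by
    constructor
    · rw [hT, ← (G.iter n).symm_apply_apply z]
      exact (G.iter n).symm.monotone (by simpa using Int.floor_le _)
    · rw [hT, ← (G.iter n).symm_apply_apply z]
      exact (G.iter n).symm.monotone (by
        simp only [hN]; linarith [Int.lt_floor_add_one (G.iter n z)])
  have hTlen : ∀ n x y, x ≤ y → T n y - T n x ≤ (y - x) * (C⁻¹ * (l⁻¹) ^ n) := by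
    intro n x y hxy
    have := hE n (T n x) (T n y) ((hTm n).monotone hxy)
    simp only [hT, OrderIso.apply_symm_apply] at this ⊢
    rw [inv_pow, ← mul_inv, ← div_eq_mul_inv, le_div_iff₀ (by positivity)]
    linarith
  have hsec : ∀ u v : ℝ, u < v →
      Tendsto (fun n => (H (T n v) - H (T n u)) / (T n v - T n u)) atTop (𝓝 a) := by
    intro u v huv
    set P := min u 0
    set Q := max v 1
    have hPu : P ≤ u := min_le_left _ _
    have hP0 : P ≤ 0 := min_le_right _ _
    have hvQ : v ≤ Q := le_max_left _ _
    have h1Q : 1 ≤ Q := le_max_right _ _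
    have hz0 : Tendsto (fun n => (Q - P) * (C⁻¹ * (l⁻¹) ^ n)) atTop (𝓝 0) := by
      have := (tendsto_pow_atTop_nhds_zero_of_lt_one (inv_nonneg.2 (by linarith : (0 : ℝ) ≤ l))
        (inv_lt_one_of_one_lt₀ hl)).const_mul C⁻¹
      simpa using this.const_mul (Q - P)
    have habs : ∀ x ∈ Icc P Q, ∀ n, |T n x - z| ≤ T n Q - T n P := by
      intro x hx n
      have h1 := (hTm n).monotone hx.1
      have h2 := (hTm n).monotone hx.2
      have h3 := (hTm n).monotone hP0
      have h4 := (hTm n).monotone h1Q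
      rw [abs_le]
      constructor <;> linarith [(hzT n).1, (hzT n).2]
    have htend : ∀ x ∈ Icc P Q, Tendsto (fun n => T n x) atTop (𝓝 z) := by
      intro x hx
      rw [tendsto_iff_norm_sub_tendsto_zero]
      exact squeeze_zero (fun n => norm_nonneg _)
        (fun n => (habs x hx n).trans (hTlen n P Q (by linarith))) hz0
    -- The enlarged interval `[P, Q]` contains `[0,1]`, so its image contains `z`. Distortion of `G`
    -- keeps that image comparable with the image of `[u, v]`, as the secant limit at `z` requires.
    have hM : ∀ n, T n Q - T n P ≤
        (Real.exp (B * (Q - P) ^ β) * (Q - P) / (v - u)) * (T n v - T n u) := by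
      intro n
      have h3 := hG n (P + N n) (Q - P) (P + N n) (Q + N n) (u + N n) (v + N n) (by linarith)
        (by linarith) ⟨by linarith, by linarith⟩ ⟨by linarith, by linarith⟩
        ⟨by linarith, by linarith⟩ ⟨by linarith, by linarith⟩
      rw [div_mul_eq_mul_div, le_div_iff₀ (by linarith)]
      simp only [add_sub_add_right_eq_sub] at h3
      simp only [hT]
      linarith
    exact tendsto_secant_of_hasDerivAt hz (fun n => hTm n huv)
      (htend u ⟨hPu, by linarith⟩) (htend v ⟨by linarith, hvQ⟩)
      (fun n => (habs u ⟨hPu, by linarith⟩ n).trans (hM n))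
      (fun n => (habs v ⟨by linarith, hvQ⟩ n).trans (hM n))
  set e1 := Real.exp (A * (H (c + L) - H c) ^ α) with he1
  set e2 := Real.exp (B * L ^ β) with he2
  have hHpq : 0 < H q - H p := sub_pos.2 (H.strictMono hpq)
  have hHrs : 0 < H s - H r := sub_pos.2 (H.strictMono hrs)
  -- Up to integers, `H` carries `T n` to the corresponding inverse branch of `F^n`. Multiplying the
  -- distortion bounds of `F` (for lengths after `H`) and of `G` (before `H`) compares the original
  -- slopes with those at level `n`.
  have hineq : ∀ n, (H (T n s) - H (T n r)) / (T n s - T n r) * ((H q - H p) * (s - r)) ≤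
      (H (T n q) - H (T n p)) / (T n q - T n p) * (e1 * e2 * (H s - H r) * (q - p)) := by
    intro n
    have hb : ∀ x ∈ Icc c (c + L), H x + N n ∈ Icc (H c + N n) (H c + N n + (H (c + L) - H c)) := by
      intro x hx
      have h1 := H.monotone hx.1
      have h2 := H.monotone hx.2
      constructor <;> linarith
    have h1 := hF n (H c + N n) (H (c + L) - H c) (H r + N n) (H s + N n) (H p + N n) (H q + N n)
      (by linarith) (by linarith) (hb r hr) (hb s hs) (hb p hp) (hb q hq)
    simp only [← h.map_add_int, h.iter_symm] at h1
    simp only [h.map_add_int, add_sub_add_right_eq_sub] at h1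
    have h2 := hG n (c + N n) L (p + N n) (q + N n) (r + N n) (s + N n) (by linarith) (by linarith)
      ⟨by linarith [hp.1], by linarith [hp.2]⟩ ⟨by linarith [hq.1], by linarith [hq.2]⟩
      ⟨by linarith [hr.1], by linarith [hr.2]⟩ ⟨by linarith [hs.1], by linarith [hs.2]⟩
    simp only [add_sub_add_right_eq_sub] at h2
    change (H (T n s) - H (T n r)) * (H q - H p) ≤ e1 * (H (T n q) - H (T n p)) * (H s - H r) at h1
    change (T n q - T n p) * (s - r) ≤ e2 * (T n s - T n r) * (q - p) at h2
    have hX : 0 < T n q - T n p := sub_pos.2 (hTm n hpq)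
    have hY : 0 < T n s - T n r := sub_pos.2 (hTm n hrs)
    have hHX : 0 < H (T n q) - H (T n p) := sub_pos.2 (H.strictMono (hTm n hpq))
    rw [div_mul_eq_mul_div, div_mul_eq_mul_div, div_le_div_iff₀ hY hX]
    calc _ = ((H (T n s) - H (T n r)) * (H q - H p)) * ((T n q - T n p) * (s - r)) := by ring
      _ ≤ (e1 * (H (T n q) - H (T n p)) * (H s - H r)) * (e2 * (T n s - T n r) * (q - p)) := by
          have : 0 ≤ (T n q - T n p) * (s - r) := by
            have := sub_pos.2 hrs; positivity
          gcongr
      _ = _ := by ring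
  have hfin := le_of_tendsto_of_tendsto' ((hsec r s hrs).mul_const _) ((hsec p q hpq).mul_const _)
    hineq
  have hfin2 := le_of_mul_le_mul_left hfin ha0
  rw [Real.exp_add, ← he1, ← he2, slope_def_field, slope_def_field, ← mul_div_assoc,
    div_le_div_iff₀ (sub_pos.2 hpq) (sub_pos.2 hrs)]
  linarith

/-- The distortion factor in `secant_le` tends to `1` as the interval shrinks to a point, which is
exactly the secant criterion for a continuous positive derivative. -/
theorem isC1Diffeo_of_hasDerivAt_ne_zero (h : IsConj F G H) (hF1 : F.IsC1Holder)
    (hF2 : F.IsExpanding) (hG1 : G.IsC1Holder) (hG2 : G.IsExpanding) {z a : ℝ}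
    (hz : HasDerivAt H a z) (ha : a ≠ 0) : IsC1Diffeo H := by
  obtain ⟨A, α, B, β, hA, hα, hB, hβ, hs⟩ := h.secant_le hF1 hF2 hG1 hG2 hz ha
  obtain ⟨D, h1, h2, h3⟩ := exists_hasDerivAt_of_secant H.strictMono (fun x ε hε => by
    have hlim : Tendsto (fun δ : ℝ => Real.exp (A * (H (x - δ + 2 * δ) - H (x - δ)) ^ α +
        B * (2 * δ) ^ β)) (𝓝 0) (𝓝 1) := by
      have hc : Continuous fun δ : ℝ => Real.exp (A * (H (x - δ + 2 * δ) - H (x - δ)) ^ α +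
          B * (2 * δ) ^ β) := by
        have := H.continuous
        refine Real.continuous_exp.comp (((Continuous.rpow_const (by fun_prop) fun _ =>
          Or.inr hα.le).const_mul _).add ((Continuous.rpow_const (by fun_prop) fun _ =>
          Or.inr hβ.le).const_mul _))
      convert hc.tendsto 0 using 2
      simp [Real.zero_rpow hα.ne', Real.zero_rpow hβ.ne']
    have hev := (hlim.mono_left (nhdsWithin_le_nhds (s := Ioi 0))).eventually
      (ge_mem_nhds (by linarith : 1 < 1 + ε))
    obtain ⟨δ, hδ, hδ0⟩ := (hev.and self_mem_nhdsWithin).exists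
    refine ⟨δ, hδ0, fun p q r s hpq hrs hp hq hr hs' => ?_⟩
    have e : x + δ = x - δ + 2 * δ := by ring
    rw [e] at hp hq hr hs'
    refine (hs _ _ p q r s hpq hrs hp hq hr hs').trans ?_
    have : 0 ≤ slope H r s := by
      rw [slope_def_field]
      exact div_nonneg (sub_nonneg.2 (H.monotone hrs.le)) (sub_nonneg.2 hrs.le)
    gcongr)
  exact isC1Diffeo_of_hasDerivAt H h1 h2 h3

end IsConj

/-! ### Markov intervals -/

/-- The integer with the given `d`-adic digits. -/
def wordNum {d : ℕ} : List (Fin d) → ℕ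
  | [] => 0
  | i :: w => d ^ w.length * i + wordNum w

/-- The inverse branch of the iterate `F^{|w|}` modulo `1` onto the Markov interval of `w`. -/
def branch {d : ℕ} (F : CircleEndo d) (w : List (Fin d)) (y : ℝ) : ℝ :=
  (F.iter w.length).symm (y + wordNum w)

/-- The length of the Markov interval of `w`. -/
def markovLength {d : ℕ} (F : CircleEndo d) (w : List (Fin d)) : ℝ := branch F w 1 - branch F w 0

section Words

variable {d : ℕ} {F : CircleEndo d}

theorem wordNum_append (u w : List (Fin d)) :
    wordNum (u ++ w) = d ^ w.length * wordNum u + wordNum w := by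
  induction u with
  | nil => simp [wordNum]
  | cons i u ih =>
    rw [List.cons_append, wordNum, wordNum, ih, List.length_append, pow_add]; ring

theorem wordNum_lt (w : List (Fin d)) : wordNum w < d ^ w.length := by
  induction w with
  | nil => simp [wordNum]
  | cons i w ih =>
    have hi := i.2
    rw [wordNum, List.length_cons, pow_succ]
    calc _ < d ^ w.length * i + d ^ w.length := by omega
      _ = d ^ w.length * (i + 1) := by ring
      _ ≤ _ := Nat.mul_le_mul_left _ hi

theorem exists_wordNum_eq (hd : 2 ≤ d) (n N : ℕ) (hN : N < d ^ n) :
    ∃ w : List (Fin d), w.length = n ∧ wordNum w = N := by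
  induction n generalizing N with
  | zero => exact ⟨[], rfl, by simp at hN; simp [wordNum, hN]⟩
  | succ n ih =>
    have hpos : 0 < d ^ n := by positivity
    obtain ⟨w, hw, hwN⟩ := ih (N % d ^ n) (Nat.mod_lt _ hpos)
    refine ⟨⟨N / d ^ n, ?_⟩ :: w, by simp [hw], ?_⟩
    · rw [Nat.div_lt_iff_lt_mul hpos, ← pow_succ']; exact hN
    · simp only [wordNum, hw, hwN]; exact Nat.div_add_mod _ _

theorem strictMono_branch (w : List (Fin d)) : StrictMono (branch F w) := fun _ _ h =>
  (F.iter w.length).symm.strictMono (by linarith)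

theorem markovLength_pos (w : List (Fin d)) : 0 < markovLength F w :=
  sub_pos.2 (strictMono_branch w one_pos)

/-- Unrolling the recursion, the shifts by single digits accumulate to the integer `wordNum w` in
base `d`, so that `I_w` is the preimage of a unit interval under one iterate. -/
theorem markovInterval_eq (w : List (Fin d)) :
    markovInterval F w = Icc (branch F w 0) (branch F w 1) := by
  have h : markovInterval F w = {x | F.iter w.length x - wordNum w ∈ Icc (0 : ℝ) 1} := by
    induction w with
    | nil => ext x; simp [markovInterval, wordNum]
    | cons i w ih =>
      ext x
      have h1 := CircleEndo.iter_add_int (F := F) w.length (F.lift x) (-(i : ℕ))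
      push_cast at h1
      rw [markovInterval, mem_ofPred_eq, ih, mem_ofPred_eq, mem_ofPred_eq, sub_eq_add_neg (F.lift x),
        h1, List.length_cons, CircleEndo.iter_add, wordNum]
      have h2 : F.iter 1 x = F.lift x := rfl
      rw [h2]
      push_cast
      rw [show (F.iter w.length) (F.lift x) + ↑d ^ w.length * -((i : ℕ) : ℝ) - (wordNum w : ℝ) =
        (F.iter w.length) (F.lift x) - (↑d ^ w.length * ((i : ℕ) : ℝ) + (wordNum w : ℝ)) by ring]
  rw [h]
  ext x
  rw [mem_ofPred_eq, mem_Icc, mem_Icc, branch, branch, OrderIso.symm_apply_le, OrderIso.le_symm_apply]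
  constructor <;> rintro ⟨h1, h2⟩ <;> constructor <;> linarith

theorem volume_markovInterval (w : List (Fin d)) :
    volume.real (markovInterval F w) = markovLength F w := by
  rw [markovInterval_eq, Real.volume_real_Icc_of_le (strictMono_branch w one_pos).le, markovLength]

theorem branch_append (u w : List (Fin d)) (y : ℝ) :
    branch F (u ++ w) y = branch F u (branch F w y) := by
  have h1 := CircleEndo.iter_symm_add_int (F := F) w.length (y + wordNum w) (wordNum u)
  push_cast at h1
  simp only [branch]
  rw [← h1, OrderIso.symm_apply_eq, List.length_append, add_comm u.length, CircleEndo.iter_add,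
    OrderIso.apply_symm_apply, OrderIso.apply_symm_apply, wordNum_append]
  push_cast
  ring

theorem branch_nil (y : ℝ) : branch F [] y = y := by simp [branch, wordNum, OrderIso.symm_apply_eq]

theorem markovLength_nil : markovLength F [] = 1 := by simp [markovLength, branch_nil]

theorem branch_zero_nonneg (w : List (Fin d)) : 0 ≤ branch F w 0 := by
  rw [branch, OrderIso.le_symm_apply, CircleEndo.iter_map_zero]
  positivity

theorem branch_one_le (w : List (Fin d)) : branch F w 1 ≤ 1 := by
  have h := CircleEndo.iter_int (F := F) w.length 1
  push_cast at h
  rw [branch, OrderIso.symm_apply_le, h]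
  have : (wordNum w : ℝ) + 1 ≤ d ^ w.length := by exact_mod_cast wordNum_lt w
  linarith

/-- The recursion adds digits on the left; peeling `j 0` off on the right exhibits the two words in
the dual derivative as `v` and `vi`. -/
theorem dualWord_succ (j : DualSpace d) (n : ℕ) :
    dualWord j (n + 1) = dualWord (dualShift j) n ++ [j 0] := by
  induction n with
  | zero => rfl
  | succ n ih => rw [dualWord, ih]; rfl

theorem length_dualWord (j : DualSpace d) (n : ℕ) : (dualWord j n).length = n := by
  induction n with
  | zero => rfl
  | succ n ih => rw [dualWord, List.length_cons, ih]

theorem exists_dualWord_add (j : DualSpace d) (m n : ℕ) :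
    ∃ u, dualWord j (m + n) = u ++ dualWord j n := by
  induction m with
  | zero => exact ⟨[], by simp⟩
  | succ m ih =>
    obtain ⟨u, hu⟩ := ih
    exact ⟨j (m + n) :: u, by rw [Nat.add_right_comm, dualWord, hu]; rfl⟩

theorem dualWord_congr {j j' : DualSpace d} {n : ℕ} (h : ∀ k < n, j k = j' k) :
    dualWord j n = dualWord j' n := by
  induction n with
  | zero => rfl
  | succ n ih => rw [dualWord, dualWord, h n n.lt_succ_self, ih fun k hk => h k (by omega)]

theorem exists_dualWord_eq (hd : 2 ≤ d) (w : List (Fin d)) :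
    ∃ j : DualSpace d, dualWord j w.length = w := by
  induction w with
  | nil => exact ⟨fun _ => ⟨0, by omega⟩, rfl⟩
  | cons i w ih =>
    obtain ⟨j, hj⟩ := ih
    refine ⟨fun k => if k = w.length then i else j k, ?_⟩
    rw [List.length_cons, dualWord, dualWord_congr (j' := j) fun k hk => by simp [hk.ne], hj]
    simp

/-! ### Ratios of lengths of nested Markov intervals -/

/-- The quotient of the lengths of the Markov intervals of `v` and of `vi`. -/
def lengthRatio (F : CircleEndo d) (v : List (Fin d)) (i : Fin d) : ℝ :=
  markovLength F v / markovLength F (v ++ [i])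

theorem lengthRatio_pos (v : List (Fin d)) (i : Fin d) : 0 < lengthRatio F v i :=
  div_pos (markovLength_pos _) (markovLength_pos _)

theorem preDualDerivative_eq (j : DualSpace d) (n : ℕ) :
    preDualDerivative F j n = lengthRatio F (dualWord (dualShift j) n) (j 0) := by
  rw [preDualDerivative, dualLength, dualLength, volume_markovInterval, volume_markovInterval,
    dualWord_succ, lengthRatio]

theorem exists_markovLength_le (h1 : F.IsC1Holder) (h2 : F.IsExpanding) :
    ∃ C τ : ℝ, 0 < C ∧ 0 < τ ∧ τ < 1 ∧ ∀ (n : ℕ) (x y : ℝ), x ≤ y →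
      (F.iter n).symm y - (F.iter n).symm x ≤ C * τ ^ n * (y - x) := by
  obtain ⟨C, l, hC, hl, hE⟩ := h2.exists_le_iter_sub h1
  have hl0 : 0 < l := by linarith
  refine ⟨C⁻¹, l⁻¹, by positivity, by positivity, inv_lt_one_of_one_lt₀ hl, fun n x y hxy => ?_⟩
  have := hE n _ _ ((F.iter n).symm.monotone hxy)
  rw [OrderIso.apply_symm_apply, OrderIso.apply_symm_apply] at this
  rw [inv_pow, ← mul_inv, inv_mul_eq_div, le_div_iff₀ (by positivity)]
  linarith

theorem markovLength_append (u v : List (Fin d)) :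
    markovLength F (u ++ v) = branch F u (branch F v 1) - branch F u (branch F v 0) := by
  rw [markovLength, branch_append, branch_append]

theorem branch_append_mem (v w : List (Fin d)) {y : ℝ} (hy : y ∈ Icc (0 : ℝ) 1) :
    branch F (v ++ w) y ∈ Icc (branch F v 0) (branch F v 1) := by
  rw [branch_append]
  exact ⟨(strictMono_branch v).monotone ((branch_zero_nonneg w).trans
      ((strictMono_branch w).monotone hy.1)),
    (strictMono_branch v).monotone (((strictMono_branch w).monotone hy.2).trans (branch_one_le w))⟩

/-- Bounded distortion of the inverse branch of `u` on the region `I_v`, applied to `I_v` itself and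
to its subinterval `I_{vw}`. -/
theorem exists_branch_distortion (h1 : F.IsC1Holder) (h2 : F.IsExpanding) :
    ∃ A α : ℝ, 0 ≤ A ∧ 0 < α ∧ ∀ (u v w : List (Fin d)),
      markovLength F (u ++ v) * markovLength F (v ++ w) ≤
        Real.exp (A * markovLength F v ^ α) * markovLength F (u ++ (v ++ w)) * markovLength F v ∧
      markovLength F (u ++ (v ++ w)) * markovLength F v ≤
        Real.exp (A * markovLength F v ^ α) * markovLength F (u ++ v) * markovLength F (v ++ w) := by
  obtain ⟨A, α, hA, hα, hD⟩ := CircleEndo.exists_distortion h1 h2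
  refine ⟨A, α, hA, hα, fun u v w => ?_⟩
  have hs := strictMono_branch (F := F) v one_pos
  have hs' := strictMono_branch (F := F) (v ++ w) one_pos
  have m0 : (0 : ℝ) ∈ Icc (0 : ℝ) 1 := by simp
  have m1 : (1 : ℝ) ∈ Icc (0 : ℝ) 1 := by simp
  have e : branch F v 0 + markovLength F v = branch F v 1 := by rw [markovLength]; ring
  have key := fun p q r s hpq hrs hp hq hr hs => hD u.length (branch F v 0 + wordNum u)
    (markovLength F v) (p + wordNum u) (q + wordNum u) (r + wordNum u) (s + wordNum u)
      (add_lt_add_left hpq _) (add_lt_add_left hrs _) hp hq hr hs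
  simp only [add_sub_add_right_eq_sub] at key
  have hmem : ∀ y ∈ Icc (branch F v 0) (branch F v 1), y + wordNum u ∈
      Icc (branch F v 0 + wordNum u) (branch F v 0 + wordNum u + markovLength F v) := fun y hy => by
    rw [add_right_comm, e]
    exact ⟨by linarith [hy.1], by linarith [hy.2]⟩
  have i0 := hmem _ (left_mem_Icc.2 hs.le)
  have i1 := hmem _ (right_mem_Icc.2 hs.le)
  have j0 := hmem _ (branch_append_mem v w m0)
  have j1 := hmem _ (branch_append_mem v w m1)
  rw [markovLength_append u v, markovLength_append u (v ++ w)]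
  exact ⟨key _ _ _ _ hs hs' i0 i1 j0 j1, key _ _ _ _ hs' hs j0 j1 i0 i1⟩

/-- A prefix `u` changes the ratio by at most `exp (A |I_v|^α)`, and `|I_v|` decays exponentially in
the length of `v`. -/
theorem exists_log_lengthRatio (h1 : F.IsC1Holder) (h2 : F.IsExpanding) :
    ∃ A τ : ℝ, 0 < A ∧ 0 < τ ∧ τ < 1 ∧ ∀ (u v : List (Fin d)) (i : Fin d),
      |Real.log (lengthRatio F (u ++ v) i) - Real.log (lengthRatio F v i)| ≤ A * τ ^ v.length := by
  obtain ⟨A, α, hA, hα, hD⟩ := exists_branch_distortion h1 h2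
  obtain ⟨C, τ, hC, hτ, hτ1, hL⟩ := exists_markovLength_le h1 h2
  -- The `+ 1` only keeps the constant positive if `A = 0`.
  refine ⟨A * C ^ α + 1, τ ^ α, by positivity, by positivity, Real.rpow_lt_one hτ.le hτ1 hα,
    fun u v i => ?_⟩
  have hlen : markovLength F v ≤ C * τ ^ v.length := by
    have := hL v.length (0 + wordNum v) (1 + wordNum v) (by linarith)
    simpa [markovLength, branch] using this
  have hpow : A * markovLength F v ^ α ≤ (A * C ^ α + 1) * (τ ^ α) ^ v.length := by
    have h3 : markovLength F v ^ α ≤ (C * τ ^ v.length) ^ α :=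
      Real.rpow_le_rpow (markovLength_pos v).le hlen hα.le
    rw [Real.mul_rpow hC.le (by positivity), ← Real.rpow_natCast, ← Real.rpow_mul hτ.le, mul_comm _ α,
      Real.rpow_mul hτ.le, Real.rpow_natCast] at h3
    calc _ ≤ A * (C ^ α * (τ ^ α) ^ v.length) := by gcongr
      _ ≤ _ := by
        have : 0 < (τ ^ α) ^ v.length := by positivity
        linarith
  refine le_trans ?_ hpow
  obtain ⟨ha, hb⟩ := hD u v [i]
  have p1 := markovLength_pos (F := F) v
  have p2 := markovLength_pos (F := F) (v ++ [i])
  have p3 := markovLength_pos (F := F) (u ++ v)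
  have p4 := markovLength_pos (F := F) (u ++ (v ++ [i]))
  rw [← Real.log_div (lengthRatio_pos _ _).ne' (lengthRatio_pos _ _).ne', abs_le, lengthRatio,
    lengthRatio, List.append_assoc]
  constructor
  · rw [Real.le_log_iff_exp_le (by positivity), Real.exp_neg, div_div_div_eq,
      le_div_iff₀ (by positivity), inv_mul_le_iff₀ (Real.exp_pos _)]
    linarith
  · rw [Real.log_le_iff_le_exp (by positivity), div_div_div_eq, div_le_iff₀ (by positivity)]
    linarith

/-! ### Dual derivatives -/

/-- Passing to a larger `n` only adds a prefix to the word, so the logarithms of the quotients are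
Cauchy with a rate that does not depend on the point. -/
theorem exists_dualDerivative (h1 : F.IsC1Holder) (h2 : F.IsExpanding) :
    ∃ A τ : ℝ, 0 < A ∧ 0 < τ ∧ τ < 1 ∧ ∀ j : DualSpace d, 0 < dualDerivative F j ∧
      Tendsto (preDualDerivative F j) atTop (𝓝 (dualDerivative F j)) ∧
      ∀ n, |Real.log (preDualDerivative F j n) - Real.log (dualDerivative F j)| ≤ A * τ ^ n := by
  obtain ⟨A, τ, hA, hτ, hτ1, hR⟩ := exists_log_lengthRatio h1 h2
  refine ⟨A, τ, hA, hτ, hτ1, fun j => ?_⟩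
  have hstep : ∀ n m : ℕ, n ≤ m → dist (Real.log (preDualDerivative F j n))
      (Real.log (preDualDerivative F j m)) ≤ A * τ ^ n := by
    intro n m hnm
    obtain ⟨k, rfl⟩ := Nat.exists_eq_add_of_le' hnm
    obtain ⟨u, hu⟩ := exists_dualWord_add (dualShift j) k n
    rw [dist_comm, preDualDerivative_eq, preDualDerivative_eq, hu, Real.dist_eq]
    simpa [length_dualWord] using hR u (dualWord (dualShift j) n) (j 0)
  have hz : Tendsto (fun n => A * τ ^ n) atTop (𝓝 0) := by
    simpa using (tendsto_pow_atTop_nhds_zero_of_lt_one hτ.le hτ1).const_mul A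
  obtain ⟨l, hl⟩ := cauchySeq_tendsto_of_complete (cauchySeq_of_le_tendsto_0' _ hstep hz)
  have hpos : ∀ n, 0 < preDualDerivative F j n := fun n => by
    rw [preDualDerivative_eq]; exact lengthRatio_pos _ _
  have hlim : Tendsto (preDualDerivative F j) atTop (𝓝 (Real.exp l)) :=
    ((Real.continuous_exp.tendsto l).comp hl).congr fun n => Real.exp_log (hpos n)
  have heq : dualDerivative F j = Real.exp l := hlim.limUnder_eq
  rw [heq, Real.log_exp]
  refine ⟨Real.exp_pos _, hlim, fun n => ?_⟩
  exact le_of_tendsto ((hl.const_sub _).abs) ((eventually_ge_atTop n).mono fun m hm => hstep n m hm)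

theorem hasDualDerivative (h1 : F.IsC1Holder) (h2 : F.IsExpanding) : HasDualDerivative F := by
  obtain ⟨_, _, _, _, _, h⟩ := exists_dualDerivative h1 h2
  exact fun j => ⟨_, (h j).1, (h j).2.1⟩

/-- If `n + 1` digits agree, the quotients at level `n` coincide and both limits are exponentially
close to them. The logarithm of the dual derivative is bounded, so the estimate survives
exponentiation. -/
theorem isHolderDual (h1 : F.IsC1Holder) (h2 : F.IsExpanding) :
    IsHolderDual (dualDerivative F) := by
  obtain ⟨A, τ, hA, hτ, hτ1, h⟩ := exists_dualDerivative h1 h2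
  -- At level `0` the quotient depends on one digit only, so it takes finitely many values, and
  -- every limit lies within `A` of one of them on the logarithmic scale.
  obtain ⟨M₀, hM₀⟩ := (Set.finite_range fun i : Fin d => |Real.log (lengthRatio F [] i)|).bddAbove
  set M := |M₀| + A with hM
  have hlogM : ∀ j, |Real.log (dualDerivative F j)| ≤ M := fun j => by
    have h3 := (h j).2.2 0
    rw [preDualDerivative_eq] at h3
    have h4 : |Real.log (lengthRatio F [] (j 0))| ≤ M₀ := hM₀ ⟨j 0, rfl⟩
    have h5 := le_abs_self M₀
    simp only [dualWord, pow_zero, mul_one] at h3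
    rw [abs_le] at *
    constructor <;> linarith [h3.1, h3.2, h4.1, h4.2]
  have hexp : ∀ j j', |dualDerivative F j - dualDerivative F j'| ≤
      Real.exp M * |Real.log (dualDerivative F j) - Real.log (dualDerivative F j')| := by
    have key : ∀ j j', dualDerivative F j - dualDerivative F j' ≤
        Real.exp M * |Real.log (dualDerivative F j) - Real.log (dualDerivative F j')| := by
      intro j j'
      have e1 := Real.exp_log (h j).1
      have h5 := Real.add_one_le_exp
        (Real.log (dualDerivative F j') - Real.log (dualDerivative F j))
      have h6 : dualDerivative F j ≤ Real.exp M := by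
        rw [← e1, Real.exp_le_exp]; exact (le_abs_self _).trans (hlogM j)
      rw [Real.exp_sub, Real.exp_log (h j).1, Real.exp_log (h j').1, le_div_iff₀ (h j).1] at h5
      calc _ ≤ dualDerivative F j *
            (Real.log (dualDerivative F j) - Real.log (dualDerivative F j')) := by linarith
        _ ≤ dualDerivative F j *
            |Real.log (dualDerivative F j) - Real.log (dualDerivative F j')| :=
            mul_le_mul_of_nonneg_left (le_abs_self _) (h j).1.le
        _ ≤ _ := by gcongr
    intro j j'
    rw [abs_le]
    have := key j' j
    rw [abs_sub_comm (Real.log _)] at this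
    constructor <;> linarith [key j j']
  have hM0 : 0 < M := by positivity
  -- `2 * A / τ` pays for the shift from `n + 1` common digits to level `n`; `2 * M` covers `n = 0`,
  -- where nothing agrees.
  refine ⟨Real.exp M * (2 * A / τ + 2 * M), τ, by positivity, hτ, hτ1, fun n j j' hj => ?_⟩
  refine (hexp j j').trans ?_
  rw [mul_assoc]
  gcongr
  rcases n with _ | n
  · have h3 := hlogM j
    have h4 := hlogM j'
    have : 0 < 2 * A / τ := by positivity
    rw [pow_zero, mul_one]
    rw [abs_le] at *
    constructor <;> linarith [h3.1, h3.2, h4.1, h4.2]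
  · have h3 := (h j).2.2 n
    have h4 := (h j').2.2 n
    have e : preDualDerivative F j n = preDualDerivative F j' n := by
      rw [preDualDerivative_eq, preDualDerivative_eq, hj 0 (by omega),
        dualWord_congr (j := dualShift j) (j' := dualShift j') fun k hk => hj (k + 1) (by omega)]
    rw [e] at h3
    have h5 : 2 * (A * τ ^ n) ≤ (2 * A / τ + 2 * M) * τ ^ (n + 1) := by
      have : 2 * A / τ * τ ^ (n + 1) = 2 * (A * τ ^ n) := by rw [pow_succ]; field_simp
      have h6 : 0 ≤ 2 * M * τ ^ (n + 1) := by positivity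
      linarith
    refine le_trans ?_ h5
    rw [abs_le] at *
    constructor <;> linarith [h3.1, h3.2, h4.1, h4.2]

end Words

namespace IsConj

variable {d : ℕ} {F G : CircleEndo d} {H : ℝ ≃o ℝ}

theorem map_branch (h : IsConj F G H) (w : List (Fin d)) (y : ℝ) :
    branch F w (H y) = H (branch G w y) := by
  have := h.map_add_int y (wordNum w)
  push_cast at this
  rw [branch, ← this, h.iter_symm, branch]

theorem map_one (h : IsConj F G H) : H 1 = 1 := by
  simpa [h.map_zero] using h.map_add_one 0

theorem markovLength_eq (h : IsConj F G H) (w : List (Fin d)) :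
    markovLength F w = H (branch G w 1) - H (branch G w 0) := by
  rw [markovLength, ← h.map_branch, ← h.map_branch, h.map_one, h.map_zero]

/-! ### Equality of dual derivatives -/

/-- The slope of `H` over a Markov interval of `G` is the quotient of the lengths for `F` and `G`.
Secant control on the shrinking intervals `I_{v_n}` makes the slopes over `I_v` and `I_{vi}`
asymptotically equal, which is equality of the limiting ratios. -/
theorem dualDerivative_eq (h : IsConj F G H) (hF1 : F.IsC1Holder) (hF2 : F.IsExpanding)
    (hG1 : G.IsC1Holder) (hG2 : G.IsExpanding) {z a : ℝ} (hz : HasDerivAt H a z) (ha : a ≠ 0) :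
    dualDerivative F = dualDerivative G := by
  obtain ⟨A, α, B, β, hA, hα, hB, hβ, hs⟩ := h.secant_le hF1 hF2 hG1 hG2 hz ha
  obtain ⟨_, _, _, _, _, hDF⟩ := exists_dualDerivative hF1 hF2
  obtain ⟨_, _, _, _, _, hDG⟩ := exists_dualDerivative hG1 hG2
  have hlen : ∀ {E : CircleEndo d}, E.IsC1Holder → E.IsExpanding → ∀ j : DualSpace d,
      Tendsto (fun n => markovLength E (dualWord j n)) atTop (𝓝 0) := by
    intro E h1 h2 j
    obtain ⟨C, τ, hC, hτ, hτ1, hL⟩ := exists_markovLength_le h1 h2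
    have hz : Tendsto (fun n => C * τ ^ n) atTop (𝓝 0) := by
      simpa using (tendsto_pow_atTop_nhds_zero_of_lt_one hτ.le hτ1).const_mul C
    refine squeeze_zero (fun n => (markovLength_pos _).le) (fun n => ?_) hz
    have := hL n (0 + wordNum (dualWord j n)) (1 + wordNum (dualWord j n)) (by linarith)
    simpa [markovLength, branch, length_dualWord] using this
  funext j
  set v := fun n => dualWord (dualShift j) n with hv
  set e : ℕ → ℝ := fun n => Real.exp (A * markovLength F (v n) ^ α + B * markovLength G (v n) ^ β)
  have he : Tendsto e atTop (𝓝 1) := by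
    have h1 := ((hlen hF1 hF2 (dualShift j)).rpow_const (p := α) (Or.inr hα.le)).const_mul A
    have h2 := ((hlen hG1 hG2 (dualShift j)).rpow_const (p := β) (Or.inr hβ.le)).const_mul B
    have h3 := (Real.continuous_exp.tendsto _).comp (h1.add h2)
    rw [Real.zero_rpow hα.ne', Real.zero_rpow hβ.ne', mul_zero, mul_zero, add_zero, Real.exp_zero] at h3
    exact h3
  have hineq : ∀ n, preDualDerivative F j n ≤ e n * preDualDerivative G j n ∧
      preDualDerivative G j n ≤ e n * preDualDerivative F j n := by
    intro n
    have hs0 := strictMono_branch (F := G) (v n) one_pos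
    have hs1 := strictMono_branch (F := G) (v n ++ [j 0]) one_pos
    have j0 := branch_append_mem (F := G) (v n) [j 0] (y := 0) (by simp)
    have j1 := branch_append_mem (F := G) (v n) [j 0] (y := 1) (by simp)
    have i0 := left_mem_Icc.2 hs0.le
    have i1 := right_mem_Icc.2 hs0.le
    have e1 : branch G (v n) 1 = branch G (v n) 0 + markovLength G (v n) := by
      rw [markovLength]; ring
    have em : Icc (branch G (v n) 0) (branch G (v n) 1) =
        Icc (branch G (v n) 0) (branch G (v n) 0 + markovLength G (v n)) := by rw [← e1]
    rw [em] at i0 i1 j0 j1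
    have k1 := hs _ _ _ _ _ _ hs0 hs1 i0 i1 j0 j1
    have k2 := hs _ _ _ _ _ _ hs1 hs0 j0 j1 i0 i1
    rw [← e1, ← h.markovLength_eq, slope_def_field, slope_def_field, ← h.markovLength_eq,
      ← h.markovLength_eq] at k1 k2
    change markovLength F (v n) / markovLength G (v n) ≤
      e n * (markovLength F (v n ++ [j 0]) / markovLength G (v n ++ [j 0])) at k1
    change markovLength F (v n ++ [j 0]) / markovLength G (v n ++ [j 0]) ≤
      e n * (markovLength F (v n) / markovLength G (v n)) at k2
    rw [preDualDerivative_eq, preDualDerivative_eq, lengthRatio, lengthRatio]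
    have p1 := markovLength_pos (F := F) (v n)
    have p2 := markovLength_pos (F := G) (v n)
    have p3 := markovLength_pos (F := F) (v n ++ [j 0])
    have p4 := markovLength_pos (F := G) (v n ++ [j 0])
    rw [← mul_div_assoc, div_le_div_iff₀ (by positivity) (by positivity)] at k1 k2
    constructor
    · rw [← mul_div_assoc, div_le_div_iff₀ (by positivity) (by positivity)]
      linarith
    · rw [← mul_div_assoc, div_le_div_iff₀ (by positivity) (by positivity)]
      linarith
  have tF := (hDF j).2.1
  have tG := (hDG j).2.1
  apply le_antisymm
  · simpa using le_of_tendsto_of_tendsto' tF (he.mul tG) fun n => (hineq n).1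
  · simpa using le_of_tendsto_of_tendsto' tG (he.mul tF) fun n => (hineq n).2

/-- Starting from `|I_∅| = 1`, `log |I_w|` is minus the sum of the logarithms of the ratios along
the prefixes of `w`. Each ratio is exponentially close to a value of the dual derivative; these
values cancel between `F` and `G`, and the errors sum to a bound independent of `w`. -/
theorem exists_markovLength_le_of_dualDerivative_eq (hd : 2 ≤ d) (hF1 : F.IsC1Holder)
    (hF2 : F.IsExpanding) (hG1 : G.IsC1Holder) (hG2 : G.IsExpanding)
    (hD : dualDerivative F = dualDerivative G) :
    ∃ C : ℝ, 0 < C ∧ ∀ w : List (Fin d), markovLength F w ≤ C * markovLength G w := by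
  obtain ⟨A, τ, hA, hτ, hτ1, hDF⟩ := exists_dualDerivative hF1 hF2
  obtain ⟨B, σ, hB, hσ, hσ1, hDG⟩ := exists_dualDerivative hG1 hG2
  have key : ∀ w : List (Fin d), |Real.log (markovLength F w) - Real.log (markovLength G w)| ≤
      ∑ k ∈ Finset.range w.length, (A * τ ^ k + B * σ ^ k) := by
    intro w
    induction w using List.reverseRecOn with
    | nil => simp [markovLength_nil]
    | append_singleton w i ih =>
      -- Any dual point ending in `wi` serves: its quotient at level `|w|` is exactly the ratio for
      -- `w` and `wi`.
      obtain ⟨j, hj⟩ := exists_dualWord_eq hd (w ++ [i])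
      rw [List.length_append, List.length_singleton, dualWord_succ] at hj
      obtain ⟨hj1, hj2⟩ := List.append_inj' hj rfl
      have hj2 : j 0 = i := by simpa using hj2
      have h1 := (hDF j).2.2 w.length
      have h2 := (hDG j).2.2 w.length
      rw [preDualDerivative_eq, hj1, hj2, lengthRatio, Real.log_div (markovLength_pos _).ne'
        (markovLength_pos _).ne'] at h1 h2
      rw [hD] at h1
      rw [List.length_append, List.length_singleton, Finset.sum_range_succ]
      rw [abs_le] at *
      constructor <;> linarith [h1.1, h1.2, h2.1, h2.2, ih.1, ih.2]
  have hsum : ∀ n, ∑ k ∈ Finset.range n, (A * τ ^ k + B * σ ^ k) ≤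
      A * (1 - τ)⁻¹ + B * (1 - σ)⁻¹ := by
    intro n
    rw [Finset.sum_add_distrib, ← Finset.mul_sum, ← Finset.mul_sum,
      ← tsum_geometric_of_lt_one hτ.le hτ1, ← tsum_geometric_of_lt_one hσ.le hσ1]
    gcongr
    · exact (summable_geometric_of_lt_one hτ.le hτ1).sum_le_tsum _ fun i _ => by positivity
    · exact (summable_geometric_of_lt_one hσ.le hσ1).sum_le_tsum _ fun i _ => by positivity
  refine ⟨Real.exp (A * (1 - τ)⁻¹ + B * (1 - σ)⁻¹), Real.exp_pos _, fun w => ?_⟩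
  have h1 := (le_abs_self _).trans ((key w).trans (hsum _))
  rw [← Real.log_div (markovLength_pos _).ne' (markovLength_pos _).ne', Real.log_le_iff_le_exp
    (div_pos (markovLength_pos _) (markovLength_pos _)), div_le_iff₀ (markovLength_pos _)] at h1
  exact h1

/-! ### Comparable Markov intervals -/

/-- `H` carries Markov intervals of `G` to those of `F`. Integer translates of the level-`n`
intervals tile the line, so the bound telescopes over unions of them, and these approximate every
interval. -/
theorem lipschitzWith_of_markovLength_le (hd : 2 ≤ d) (h : IsConj F G H) (hG1 : G.IsC1Holder)
    (hG2 : G.IsExpanding) {C : ℝ} (hC0 : 0 < C)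
    (hC : ∀ w : List (Fin d), markovLength F w ≤ C * markovLength G w) :
    LipschitzWith C.toNNReal H := by
  have hstep : ∀ (n : ℕ) (N : ℤ), H ((G.iter n).symm (N + 1)) - H ((G.iter n).symm N) ≤
      C * ((G.iter n).symm (N + 1) - (G.iter n).symm N) := by
    intro n N
    -- Only `N` modulo `d^n` matters, as adding `d^n` to `N` translates the cell by `1`; the
    -- remainder is the number of a word of length `n`.
    have hpos : (0 : ℤ) < (d : ℤ) ^ n := by positivity
    have h0 := Int.emod_nonneg N hpos.ne'
    have h1 := Int.emod_lt_of_pos N hpos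
    obtain ⟨w, hw, hwN⟩ := exists_wordNum_eq hd n (N % (d : ℤ) ^ n).toNat (by zify; omega)
    have e : (N : ℝ) = wordNum w + d ^ n * (N / (d : ℤ) ^ n : ℤ) := by
      rw [hwN]
      have h2 : ((N % (d : ℤ) ^ n).toNat : ℤ) = N % (d : ℤ) ^ n := Int.toNat_of_nonneg h0
      have h3 : (((N % (d : ℤ) ^ n).toNat : ℕ) : ℝ) = ((N % (d : ℤ) ^ n : ℤ) : ℝ) := by
        exact_mod_cast congrArg (Int.cast (R := ℝ)) h2
      rw [h3]
      exact_mod_cast (Int.emod_add_mul_ediv N ((d : ℤ) ^ n)).symm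
    have h4 := hC w
    rw [h.markovLength_eq, markovLength, branch, branch, hw] at h4
    rw [e, add_right_comm, CircleEndo.iter_symm_add_int, CircleEndo.iter_symm_add_int,
      h.map_add_int, h.map_add_int]
    rw [add_comm (1 : ℝ), zero_add] at h4
    linarith
  have htel : ∀ (n : ℕ) (N : ℤ) (m : ℕ), H ((G.iter n).symm (N + m)) - H ((G.iter n).symm N) ≤
      C * ((G.iter n).symm (N + m) - (G.iter n).symm N) := by
    intro n N m
    induction m with
    | zero => simp
    | succ m ih =>
      have := hstep n (N + m)
      push_cast at this ⊢
      rw [← add_assoc]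
      linarith
  obtain ⟨K, τ, hK, hτ, hτ1, hL⟩ := exists_markovLength_le hG1 hG2
  have hle : ∀ x y, x ≤ y → H y - H x ≤ C * (y - x) := by
    intro x y hxy
    -- Rounding `x` and `y` outwards to the level-`n` grid costs at most one cell, of length at most
    -- `K τ^n`, at each end.
    have hz : Tendsto (fun n => C * (y - x + 2 * (K * τ ^ n))) atTop (𝓝 (C * (y - x))) := by
      have := ((((tendsto_pow_atTop_nhds_zero_of_lt_one hτ.le hτ1).const_mul K).const_mul
        2).const_add (y - x)).const_mul C
      simpa using this
    refine ge_of_tendsto' hz fun n => ?_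
    set N := ⌊G.iter n x⌋
    set N' := ⌊G.iter n y⌋
    have hNN : N ≤ N' := Int.floor_mono ((G.iter n).monotone hxy)
    obtain ⟨m, hm⟩ := Int.le.dest hNN
    have h1 := htel n N (m + 1)
    have em : (N : ℝ) + ((m + 1 : ℕ) : ℝ) = N' + 1 := by rw [← hm]; push_cast; ring
    rw [em] at h1
    have h2 : (G.iter n).symm N ≤ x := by
      rw [OrderIso.symm_apply_le]; exact Int.floor_le _
    have h3 : y ≤ (G.iter n).symm (N' + 1) := by
      rw [OrderIso.le_symm_apply]; exact (Int.lt_floor_add_one _).le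
    have h4 : x ≤ (G.iter n).symm (N + 1) := by
      rw [OrderIso.le_symm_apply]; exact (Int.lt_floor_add_one _).le
    have h5 : (G.iter n).symm N' ≤ y := by
      rw [OrderIso.symm_apply_le]; exact Int.floor_le _
    have h6 := hL n N (N + 1) (by linarith)
    have h7 := hL n N' (N' + 1) (by linarith)
    have h8 := H.monotone h2
    have h9 := H.monotone h3
    have h10 : C * ((G.iter n).symm (N' + 1) - (G.iter n).symm N) ≤
        C * (y - x + 2 * (K * τ ^ n)) := by gcongr; linarith
    linarith
  refine LipschitzWith.of_dist_le_mul fun x y => ?_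
  rw [Real.coe_toNNReal _ hC0.le, Real.dist_eq, Real.dist_eq]
  rcases le_total x y with hxy | hxy
  · rw [abs_sub_comm, abs_of_nonneg (sub_nonneg.2 (H.monotone hxy)), abs_sub_comm,
      abs_of_nonneg (sub_nonneg.2 hxy)]
    exact hle x y hxy
  · rw [abs_of_nonneg (sub_nonneg.2 (H.monotone hxy)), abs_of_nonneg (sub_nonneg.2 hxy)]
    exact hle y x hxy

/-- A Lipschitz function is absolutely continuous, so `H'` has integral `H 1 - H 0 = 1` over `[0,1]`
and cannot vanish everywhere. One point with nonzero derivative is enough. -/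
theorem isC1Diffeo_of_markovLength_le (hd : 2 ≤ d) (h : IsConj F G H) (hF1 : F.IsC1Holder)
    (hF2 : F.IsExpanding) (hG1 : G.IsC1Holder) (hG2 : G.IsExpanding) {C : ℝ} (hC0 : 0 < C)
    (hC : ∀ w : List (Fin d), markovLength F w ≤ C * markovLength G w) : IsC1Diffeo H := by
  have hLip := h.lipschitzWith_of_markovLength_le hd hG1 hG2 hC0 hC
  have hac := (hLip.lipschitzOnWith (s := uIcc 0 1)).absolutelyContinuousOnInterval
  have hint := hac.integral_deriv_eq_sub
  rw [h.map_one, h.map_zero, sub_zero] at hint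
  obtain ⟨z, hz⟩ : ∃ z, deriv H z ≠ 0 := by
    by_contra hcon
    push Not at hcon
    simp [hcon] at hint
  exact h.isC1Diffeo_of_hasDerivAt_ne_zero hF1 hF2 hG1 hG2
    (differentiableAt_of_deriv_ne_zero hz).hasDerivAt hz

/-- The Hölder constants may blow up as the exponent tends to `1`; the power trick removes them. On
the `m`-fold repetition of `w`, lengths for `F` are at least, and for `G` at most, `m`-th powers of
the length for `w` times a fixed factor. Taking `m`-th roots eliminates the Hölder constant before
the exponent tends to `1`. -/
theorem exists_markovLength_le_of_holder (h : IsConj F G H) (hF1 : F.IsC1Holder)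
    (hF2 : F.IsExpanding) (hG1 : G.IsC1Holder) (hG2 : G.IsExpanding)
    (hH : ∀ b ∈ Ioo (0 : ℝ) 1, ∃ C : ℝ, ∀ x ∈ Icc (0 : ℝ) 1, ∀ y ∈ Icc (0 : ℝ) 1,
      |H x - H y| ≤ C * |x - y| ^ b) :
    ∃ C : ℝ, 0 < C ∧ ∀ w : List (Fin d), markovLength F w ≤ C * markovLength G w := by
  obtain ⟨A, α, hA, hα, hDF⟩ := exists_branch_distortion hF1 hF2
  obtain ⟨B, β, hB, hβ, hDG⟩ := exists_branch_distortion hG1 hG2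
  -- Distortion over the empty word, whose interval has length `1`: lengths are multiplicative under
  -- concatenation up to a uniform factor.
  have hF : ∀ u w : List (Fin d),
      Real.exp (-A) * markovLength F w * markovLength F u ≤ markovLength F (w ++ u) := by
    intro u w
    have := (hDF w [] u).1
    simp only [List.nil_append, List.append_nil, markovLength_nil, Real.one_rpow, mul_one] at this
    rw [mul_assoc, Real.exp_neg, inv_mul_le_iff₀ (Real.exp_pos _)]
    exact this
  have hG : ∀ u w : List (Fin d),
      markovLength G (w ++ u) ≤ Real.exp B * markovLength G w * markovLength G u := by
    intro u w
    have := (hDG w [] u).2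
    simpa only [List.nil_append, List.append_nil, markovLength_nil, Real.one_rpow, mul_one] using this
  refine ⟨Real.exp A * Real.exp B, by positivity, fun w => ?_⟩
  have hb : ∀ b ∈ Ioo (0 : ℝ) 1, Real.exp (-A) * markovLength F w ≤
      (Real.exp B * markovLength G w) ^ b := by
    intro b hbm
    obtain ⟨C, hC⟩ := hH b hbm
    set X := Real.exp (-A) * markovLength F w
    set Y := (Real.exp B * markovLength G w) ^ b with hY
    have pF := markovLength_pos (F := F) w
    have pG := markovLength_pos (F := G) w
    have hX0 : 0 < X := by positivity
    have hY0 : 0 < Y := by positivity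
    have hpow : ∀ m : ℕ, X ^ m ≤ C * Y ^ m := by
      intro m
      set W := (List.replicate m w).flatten with hW
      have h1 : X ^ m ≤ markovLength F W := by
        rw [hW]
        clear hW W
        induction m with
        | zero => simp [markovLength_nil]
        | succ m ih =>
          rw [List.replicate_succ, List.flatten_cons, pow_succ']
          exact (mul_le_mul_of_nonneg_left ih hX0.le).trans (hF _ _)
      have h2 : markovLength G W ≤ (Real.exp B * markovLength G w) ^ m := by
        rw [hW]
        clear hW h1 W
        induction m with
        | zero => simp [markovLength_nil]
        | succ m ih =>
          rw [List.replicate_succ, List.flatten_cons, pow_succ']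
          exact (hG _ _).trans (mul_le_mul_of_nonneg_left ih (by positivity))
      have hs := (strictMono_branch (F := G) W one_pos).le
      have h0 := branch_zero_nonneg (F := G) W
      have h01 := branch_one_le (F := G) W
      have h3 := hC (branch G W 1) ⟨by linarith, h01⟩ (branch G W 0) ⟨h0, by linarith⟩
      have h3' := (le_abs_self _).trans h3
      rw [← h.markovLength_eq, ← markovLength, abs_of_pos (markovLength_pos _)] at h3'
      have hC0 : 0 ≤ C := by
        by_contra hneg
        have := mul_neg_of_neg_of_pos (not_le.1 hneg)
          (Real.rpow_pos_of_pos (markovLength_pos (F := G) W) b)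
        linarith [markovLength_pos (F := F) W]
      have h4 : markovLength G W ^ b ≤ Y ^ m := by
        rw [hY, ← Real.rpow_natCast, ← Real.rpow_mul (by positivity), mul_comm b,
          Real.rpow_mul (by positivity), Real.rpow_natCast]
        exact Real.rpow_le_rpow (markovLength_pos _).le h2 hbm.1.le
      calc _ ≤ C * markovLength G W ^ b := h1.trans h3'
        _ ≤ _ := by gcongr
    -- `(X / Y)^m` is bounded by `C` for all `m`, so `X / Y` cannot exceed `1`.
    by_contra hcon
    have hXY : 1 < X / Y := by rw [one_lt_div hY0]; exact not_le.1 hcon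
    obtain ⟨m, hm⟩ := pow_unbounded_of_one_lt C hXY
    rw [div_pow, lt_div_iff₀ (by positivity)] at hm
    linarith [hpow m]
  have hlim : Real.exp (-A) * markovLength F w ≤ Real.exp B * markovLength G w := by
    have pG := markovLength_pos (F := G) w
    have hp : Tendsto (fun b : ℝ => (Real.exp B * markovLength G w) ^ b) (𝓝[<] 1)
        (𝓝 ((Real.exp B * markovLength G w) ^ (1 : ℝ))) :=
      ((Real.continuousAt_const_rpow (by positivity)).tendsto).mono_left nhdsWithin_le_nhds
    rw [Real.rpow_one] at hp
    refine ge_of_tendsto hp ?_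
    filter_upwards [Ioo_mem_nhdsLT (zero_lt_one' ℝ)] with b hbm
    exact hb b hbm
  rw [Real.exp_neg, inv_mul_le_iff₀ (Real.exp_pos _)] at hlim
  linarith

end IsConj

/-! ### Weak derivatives of continuously differentiable functions -/

theorem integrable_smul_of_continuousOn {U : Set ℂ} {η : ℂ → ℝ} {g : ℂ → ℂ}
    (hη : Continuous η) (hc : HasCompactSupport η) (hs : tsupport η ⊆ U) (hg : ContinuousOn g U) :
    Integrable fun z => η z • g z := by
  have h : IntegrableOn (fun z => η z • g z) (tsupport η) :=
    (hη.continuousOn.smul (hg.mono hs)).integrableOn_compact hc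
  refine (integrableOn_iff_integrable_of_support_subset fun z hz => subset_tsupport η ?_).1 h
  intro h0
  exact hz (by simp [h0])

theorem hasWeakDeriv_of_contDiffOn {φ : ℂ → ℂ} {U : Set ℂ} (hU : IsOpen U)
    (hφ : ContDiffOn ℝ 1 φ U) (v : ℂ) : HasWeakDeriv φ U v fun z => fderiv ℝ φ z v := by
  intro ψ hψ hc hs
  have hφ' : ContinuousOn (fun z => fderiv ℝ φ z v) U :=
    (hφ.continuousOn_fderiv_of_isOpen hU le_rfl).clm_apply continuousOn_const
  have hψd : Differentiable ℝ ψ := hψ.differentiable (by simp)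
  have hψ' : Continuous fun z => fderiv ℝ ψ z v :=
    (hψ.continuous_fderiv (by simp)).clm_apply continuous_const
  have hc' : HasCompactSupport fun z => fderiv ℝ ψ z v :=
    hc.fderiv_apply (𝕜 := ℝ) v
  have hs' : tsupport (fun z => fderiv ℝ ψ z v) ⊆ U :=
    (tsupport_fderiv_apply_subset ℝ v).trans hs
  refine integral_bilinear_hasFDerivAt_right_eq_neg_left_of_integrable (f := φ) (g := ψ)
    (f' := fderiv ℝ φ) (g' := fderiv ℝ ψ) (v := v) (μ := volume)
    (B := (ContinuousLinearMap.lsmul ℝ ℝ (E := ℂ)).flip) ?_ ?_ ?_ ?_ ?_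
  · exact integrable_smul_of_continuousOn hψ.continuous hc hs hφ'
  · exact integrable_smul_of_continuousOn hψ' hc' hs' hφ.continuousOn
  · exact integrable_smul_of_continuousOn hψ.continuous hc hs hφ.continuousOn
  · intro z hz
    exact ((hφ.differentiableOn one_ne_zero).differentiableAt (hU.mem_nhds (hs hz))).hasFDerivAt
  · intro z _
    exact (hψd z).hasFDerivAt

/-- A real linear map of `ℂ` in terms of its complex linear and antilinear parts. -/
def wirtingerCLM (P Q : ℂ) : ℂ →L[ℝ] ℂ :=
  P • ContinuousLinearMap.id ℝ ℂ + Q • (Complex.conjCLE : ℂ →L[ℝ] ℂ)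

theorem wirtingerCLM_apply (P Q v : ℂ) :
    wirtingerCLM P Q v = P * v + Q * (starRingEnd ℂ) v := by
  simp [wirtingerCLM]

/-! ### Quasiconformal extension of a smooth circle diffeomorphism -/

/-- The extension `(x, y) ↦ ((H(x+y) + H(x-y)) / 2, (H(x+y) - H(x-y)) / 2)` of `H` to the plane. -/
def planeExtension (H : ℝ → ℝ) (z : ℂ) : ℂ :=
  ⟨(H (z.re + z.im) + H (z.re - z.im)) / 2, (H (z.re + z.im) - H (z.re - z.im)) / 2⟩

theorem planeExtension_ofReal (H : ℝ → ℝ) (x : ℝ) : planeExtension H x = H x := by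
  apply Complex.ext <;> simp [planeExtension]

theorem planeExtension_add_int {H : ℝ → ℝ} (h : ∀ x (m : ℤ), H (x + m) = H x + m) (z : ℂ) (m : ℤ) :
    planeExtension H (z + m) = planeExtension H z + m := by
  have h1 := h (z.re + z.im) m
  have h2 := h (z.re - z.im) m
  apply Complex.ext
  · simp only [planeExtension, Complex.add_re, Complex.add_im, Complex.intCast_re,
      Complex.intCast_im, add_zero]
    rw [show z.re + m + z.im = z.re + z.im + m by ring,
      show z.re + m - z.im = z.re - z.im + m by ring, h1, h2]; ring
  · simp only [planeExtension, Complex.add_re, Complex.add_im, Complex.intCast_re,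
      Complex.intCast_im, add_zero]
    rw [show z.re + m + z.im = z.re + z.im + m by ring,
      show z.re + m - z.im = z.re - z.im + m by ring, h1, h2]; ring

/-- In the coordinates `x + y` and `x - y` the extension acts as `H` on each factor, hence respects
composition; in particular the extension of the inverse is the inverse. -/
theorem planeExtension_comp (H K : ℝ → ℝ) (z : ℂ) :
    planeExtension H (planeExtension K z) = planeExtension (H ∘ K) z := by
  simp only [planeExtension, Function.comp]
  congr 2 <;> ring_nf

/-- The plane extension of a homeomorphism is a homeomorphism. -/
def planeHomeomorph (H : ℝ ≃o ℝ) : ℂ ≃ₜ ℂ where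
  toFun := planeExtension H
  invFun := planeExtension H.symm
  left_inv z := by
    rw [planeExtension_comp]
    apply Complex.ext <;> simp [planeExtension]
  right_inv z := by
    rw [planeExtension_comp]
    apply Complex.ext <;> simp [planeExtension]
  continuous_toFun := by
    have := H.continuous
    have e : planeExtension H = fun z => Complex.equivRealProdCLM.symm
        ((H (z.re + z.im) + H (z.re - z.im)) / 2, (H (z.re + z.im) - H (z.re - z.im)) / 2) := rfl
    rw [e]
    fun_prop
  continuous_invFun := by
    have := H.symm.continuous
    have e : planeExtension H.symm = fun z => Complex.equivRealProdCLM.symm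
        ((H.symm (z.re + z.im) + H.symm (z.re - z.im)) / 2,
          (H.symm (z.re + z.im) - H.symm (z.re - z.im)) / 2) := rfl
    rw [e]
    fun_prop

theorem contDiff_planeExtension {H : ℝ → ℝ} (hH : ContDiff ℝ 1 H) :
    ContDiff ℝ 1 (planeExtension H) := by
  have e : planeExtension H = fun z => Complex.equivRealProdCLM.symm
      ((H (z.re + z.im) + H (z.re - z.im)) / 2, (H (z.re + z.im) - H (z.re - z.im)) / 2) := rfl
  have hre : ContDiff ℝ 1 Complex.re := Complex.reCLM.contDiff
  have him : ContDiff ℝ 1 Complex.im := Complex.imCLM.contDiff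
  have h1 : ContDiff ℝ 1 fun z : ℂ => H (z.re + z.im) := hH.comp (hre.add him)
  have h2 : ContDiff ℝ 1 fun z : ℂ => H (z.re - z.im) := hH.comp (hre.sub him)
  rw [e]
  exact Complex.equivRealProdCLM.symm.contDiff.comp
    (((h1.add h2).div_const 2).prodMk ((h1.sub h2).div_const 2))

/-- The `∂_{z̄}` part is the difference of `H'` at `x + y` and `x - y`, the `∂_z` part their sum, up
to the same factor in modulus. With `H'` continuous and positive, the dilatation tends to `0` at the
real axis. -/
theorem hasFDerivAt_planeExtension {H D : ℝ → ℝ} (hH : ∀ x, HasDerivAt H (D x) x) (z : ℂ) :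
    HasFDerivAt (planeExtension H) (wirtingerCLM
      ((D (z.re + z.im) + D (z.re - z.im)) / 2 : ℝ)
      (Complex.I * ((D (z.re + z.im) - D (z.re - z.im)) / 2 : ℝ))) z := by
  have e : planeExtension H = fun z => Complex.equivRealProdCLM.symm
      ((H (z.re + z.im) + H (z.re - z.im)) / 2, (H (z.re + z.im) - H (z.re - z.im)) / 2) := rfl
  have hre : HasFDerivAt Complex.re Complex.reCLM z := Complex.reCLM.hasFDerivAt
  have him : HasFDerivAt Complex.im Complex.imCLM z := Complex.imCLM.hasFDerivAt
  have h1 := (hH (z.re + z.im)).comp_hasFDerivAt z (hre.add him)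
  have h2 := (hH (z.re - z.im)).comp_hasFDerivAt z (hre.sub him)
  have h3 := Complex.equivRealProdCLM.symm.hasFDerivAt.comp z
    (((h1.add h2).mul_const 2⁻¹).prodMk ((h1.sub h2).mul_const 2⁻¹))
  rw [e]
  refine (h3.congr_fderiv ?_)
  ext v
  apply Complex.ext <;> simp [wirtingerCLM_apply] <;> ring

/-! ### The covering map of the punctured plane and the induced map -/

/-- The covering map `z ↦ e^{2πiz}` of the punctured plane. -/
def planeCover (z : ℂ) : ℂ := Complex.exp (2 * Real.pi * Complex.I * z)

/-- A branch of the inverse of the covering map near the image of `z`. -/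
def coverBranch (z w : ℂ) : ℂ := z + Complex.log (w / planeCover z) / (2 * Real.pi * Complex.I)

theorem planeCover_ne_zero (z : ℂ) : planeCover z ≠ 0 := Complex.exp_ne_zero _

theorem planeCover_coverBranch (z : ℂ) {w : ℂ} (hw : w ≠ 0) :
    planeCover (coverBranch z w) = w := by
  rw [planeCover, coverBranch, mul_add, mul_div_cancel₀ _ Complex.two_pi_I_ne_zero, Complex.exp_add,
    ← planeCover, Complex.exp_log (div_ne_zero hw (planeCover_ne_zero z)),
    mul_div_cancel₀ _ (planeCover_ne_zero z)]

theorem coverBranch_self (z : ℂ) : coverBranch z (planeCover z) = z := by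
  simp [coverBranch, planeCover_ne_zero]

theorem planeCover_eq_iff {z w : ℂ} : planeCover z = planeCover w ↔ ∃ n : ℤ, z = w + n := by
  rw [planeCover, planeCover, Complex.exp_eq_exp_iff_exists_int]
  refine exists_congr fun n => ?_
  rw [← mul_right_inj' Complex.two_pi_I_ne_zero (b := z)]
  constructor <;> intro h <;> rw [h] <;> ring

theorem norm_planeCover (z : ℂ) : ‖planeCover z‖ = Real.exp (-(2 * Real.pi * z.im)) := by
  rw [planeCover, Complex.norm_exp]
  congr 1
  simp [mul_assoc]

theorem hasDerivAt_planeCover (z : ℂ) :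
    HasDerivAt planeCover (planeCover z * (2 * Real.pi * Complex.I)) z := by
  have := ((hasDerivAt_id' z).const_mul (2 * Real.pi * Complex.I)).cexp
  rwa [mul_one] at this

theorem contDiffAt_coverBranch (z : ℂ) : ContDiffAt ℂ 1 (coverBranch z) (planeCover z) := by
  unfold coverBranch
  have h1 : ContDiffAt ℂ 1 Complex.log (planeCover z / planeCover z) := by
    refine Complex.contDiffAt_log ?_
    simp [planeCover_ne_zero]
  exact contDiffAt_const.add
    ((ContDiffAt.comp (g := Complex.log) (f := fun w => w / planeCover z) _ h1
      (contDiffAt_id.div_const (planeCover z))).div_const _)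

theorem isOpenMap_planeCover : IsOpenMap planeCover :=
  Complex.isOpenMap_exp.comp (isOpenMap_smul₀ Complex.two_pi_I_ne_zero)

/-- The map of the punctured plane induced by the plane extension of `H`. -/
def annulusExtension (H : ℝ → ℝ) (w : ℂ) : ℂ := planeCover (planeExtension H (coverBranch 0 w))

section Annulus

variable {H : ℝ ≃o ℝ}

theorem annulusExtension_planeCover (h : ∀ x (m : ℤ), H (x + m) = H x + m) (z : ℂ) :
    annulusExtension H (planeCover z) = planeCover (planeExtension H z) := by
  obtain ⟨n, hn⟩ := planeCover_eq_iff.1 (planeCover_coverBranch 0 (planeCover_ne_zero z))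
  rw [annulusExtension, hn, planeExtension_add_int h]
  exact planeCover_eq_iff.2 ⟨n, rfl⟩

theorem annulusExtension_eq (h : ∀ x (m : ℤ), H (x + m) = H x + m) (z : ℂ) {w : ℂ} (hw : w ≠ 0) :
    annulusExtension H w = planeCover (planeExtension H (coverBranch z w)) := by
  rw [← annulusExtension_planeCover h, planeCover_coverBranch z hw]

theorem contDiffAt_annulusExtension (h : ∀ x (m : ℤ), H (x + m) = H x + m)
    (hH : ContDiff ℝ 1 H) (z : ℂ) : ContDiffAt ℝ 1 (annulusExtension H) (planeCover z) := by
  have h1 : ContDiff ℝ 1 planeCover := by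
    unfold planeCover
    exact (Complex.contDiff_exp.comp (contDiff_const.mul contDiff_id))
  have h2 : ContDiffAt ℝ 1 (fun w => planeCover (planeExtension H (coverBranch z w)))
      (planeCover z) :=
    h1.contDiffAt.comp _ ((contDiff_planeExtension hH).contDiffAt.comp _
      ((contDiffAt_coverBranch z).restrict_scalars ℝ))
  refine h2.congr_of_eventuallyEq ?_
  filter_upwards [isOpen_ne.mem_nhds (planeCover_ne_zero z)] with w hw
  exact annulusExtension_eq h z hw

/-- In logarithmic coordinates the map is the plane extension. Composition with a holomorphic map on
either side multiplies the complex derivatives by factors that change the dilatation only by a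
unimodular number `b`. -/
theorem fderiv_annulusExtension (h : ∀ x (m : ℤ), H (x + m) = H x + m) {D : ℝ → ℝ}
    (hH : ∀ x, HasDerivAt H (D x) x) (z : ℂ) :
    ∃ a b : ℂ, ‖b‖ = 1 ∧ ∀ v : ℂ, fderiv ℝ (annulusExtension H) (planeCover z) v =
      a * (((D (z.re + z.im) + D (z.re - z.im)) / 2 : ℝ) * v +
        b * ((D (z.re + z.im) - D (z.re - z.im)) / 2 : ℝ) * (starRingEnd ℂ) v) := by
  have hL : DifferentiableAt ℂ (coverBranch z) (planeCover z) :=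
    (contDiffAt_coverBranch z).differentiableAt one_ne_zero
  set l := deriv (coverBranch z) (planeCover z) with hl
  have hl0 : l ≠ 0 := by
    have h1 : HasDerivAt (planeCover ∘ coverBranch z)
        (planeCover (coverBranch z (planeCover z)) * (2 * Real.pi * Complex.I) * l) (planeCover z) :=
      (hasDerivAt_planeCover _).comp _ hL.hasDerivAt
    have h2 : HasDerivAt (planeCover ∘ coverBranch z) 1 (planeCover z) := by
      refine (hasDerivAt_id _).congr_of_eventuallyEq ?_
      filter_upwards [isOpen_ne.mem_nhds (planeCover_ne_zero z)] with w hw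
      exact planeCover_coverBranch z hw
    intro h0
    rw [h0, mul_zero] at h1
    exact one_ne_zero (h2.unique h1)
  set c := planeCover (planeExtension H z) * (2 * Real.pi * Complex.I) with hc
  refine ⟨c * l, Complex.I * ((starRingEnd ℂ) l / l), by
    rw [norm_mul, norm_div, Complex.norm_I, RCLike.norm_conj, div_self (norm_ne_zero_iff.2 hl0),
      mul_one], fun v => ?_⟩
  have hL' : HasFDerivAt (coverBranch z)
      ((ContinuousLinearMap.toSpanSingleton ℂ l).restrictScalars ℝ) (planeCover z) :=
    hL.hasDerivAt.hasFDerivAt.restrictScalars ℝ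
  have hP := hasFDerivAt_planeExtension hH (coverBranch z (planeCover z))
  have hE : HasFDerivAt planeCover ((ContinuousLinearMap.toSpanSingleton ℂ c).restrictScalars ℝ)
      (planeExtension H (coverBranch z (planeCover z))) := by
    rw [coverBranch_self]
    exact (hasDerivAt_planeCover _).hasFDerivAt.restrictScalars ℝ
  have hcomp := (hE.comp (planeCover z) (hP.comp (planeCover z) hL')).congr_of_eventuallyEq (f₁ := annulusExtension H) (by
    filter_upwards [isOpen_ne.mem_nhds (planeCover_ne_zero z)] with w hw
    exact annulusExtension_eq h z hw)
  rw [hcomp.fderiv]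
  simp only [coverBranch_self, ContinuousLinearMap.comp_apply,
    ContinuousLinearMap.coe_restrictScalars', ContinuousLinearMap.toSpanSingleton_apply,
    wirtingerCLM_apply, smul_eq_mul, map_mul]
  field_simp

theorem injective_annulusExtension (h : ∀ x (m : ℤ), H (x + m) = H x + m) {w w' : ℂ} (hw : w ≠ 0)
    (hw' : w' ≠ 0) (he : annulusExtension H w = annulusExtension H w') : w = w' := by
  rw [annulusExtension, annulusExtension, planeCover_eq_iff] at he
  obtain ⟨n, hn⟩ := he
  rw [← planeExtension_add_int h] at hn
  have h1 := (planeHomeomorph H).injective hn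
  rw [← planeCover_coverBranch 0 hw, ← planeCover_coverBranch 0 hw', planeCover_eq_iff]
  exact ⟨n, h1⟩

/-- Lifting `V` to the cover writes the map as a homeomorphism of the plane followed by the open
covering map. -/
theorem isOpen_image_annulusExtension (h : ∀ x (m : ℤ), H (x + m) = H x + m) {V : Set ℂ}
    (hV : IsOpen V) (h0 : ∀ w ∈ V, w ≠ 0) : IsOpen (annulusExtension H '' V) := by
  have e : annulusExtension H '' V =
      planeCover '' (planeHomeomorph H '' (planeCover ⁻¹' V)) := by
    ext u
    constructor
    · rintro ⟨w, hw, rfl⟩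
      exact ⟨_, ⟨coverBranch 0 w, by rwa [mem_preimage, planeCover_coverBranch 0 (h0 w hw)], rfl⟩,
        rfl⟩
    · rintro ⟨_, ⟨z, hz, rfl⟩, rfl⟩
      exact ⟨planeCover z, hz, annulusExtension_planeCover h z⟩
  have hc : Continuous planeCover := by unfold planeCover; fun_prop
  rw [e]
  exact isOpenMap_planeCover _ ((planeHomeomorph H).isOpenMap _ (hV.preimage hc))

end Annulus

/-- The periodic function `H'` is uniformly continuous and bounded below by a positive constant, so
on a thin annulus around the circle the dilatation of the induced map is below any prescribed `k`.
-/
theorem exists_isQCExtension (H : ℝ ≃o ℝ) (h1 : ∀ x, H (x + 1) = H x + 1) (hH : IsC1Diffeo H)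
    {k : ℝ} (hk0 : 0 < k) (hk1 : k < 1) : ∃ U φ, IsQCExtension H U φ k := by
  have h : ∀ x (m : ℤ), H (x + m) = H x + m := IsMarking.map_add_int h1
  set D := deriv H with hD
  have hDd : ∀ x, HasDerivAt H (D x) x := fun x => (hH.1.differentiable one_ne_zero x).hasDerivAt
  have hDc : Continuous D := hH.1.continuous_deriv le_rfl
  have hDper : Function.Periodic D 1 := fun x => by
    have e : (fun x => H (x + 1)) = fun x => H x + 1 := funext h1
    have h2 := congrArg (fun f => deriv f x) e
    simpa [deriv_comp_add_const, hD] using h2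
  have hDpos : ∀ x, 0 < D x := by
    intro x
    refine lt_of_le_of_ne H.monotone.deriv_nonneg fun h0 => ?_
    have h2 := (hH.2.differentiable one_ne_zero (H x)).hasDerivAt.comp x (hDd x)
    rw [← h0, mul_zero] at h2
    have h3 : HasDerivAt (H.symm ∘ H) 1 x :=
      (hasDerivAt_id x).congr_of_eventuallyEq (Eventually.of_forall fun y => H.symm_apply_apply y)
    exact one_ne_zero (h3.unique h2)
  obtain ⟨x₀, -, hx₀⟩ := isCompact_Icc.exists_isMinOn (nonempty_Icc.2 (zero_le_one' ℝ))
    hDc.continuousOn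
  have hmin : ∀ x, D x₀ ≤ D x := by
    intro x
    obtain ⟨y, hy, he⟩ := hDper.exists_mem_Ico₀ one_pos x
    rw [he]
    exact hx₀ (Ico_subset_Icc_self hy)
  -- By periodicity any two points at distance less than `1` can be moved together into `[-1, 2]`,
  -- where compactness applies.
  have hDu : UniformContinuous D := by
    have hcs := (isCompact_Icc (a := (-1 : ℝ)) (b := 2)).uniformContinuousOn_of_continuous
      hDc.continuousOn
    rw [Metric.uniformContinuousOn_iff] at hcs
    rw [Metric.uniformContinuous_iff]
    intro ε hε
    obtain ⟨δ, hδ, hh⟩ := hcs ε hε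
    refine ⟨min δ 1, by positivity, fun {a b} hab => ?_⟩
    have e1 := hDper.sub_zsmul_eq ⌊a⌋ (x := a)
    have e2 := hDper.sub_zsmul_eq ⌊a⌋ (x := b)
    rw [zsmul_one] at e1 e2
    rw [← e1, ← e2]
    have hab1 := lt_of_lt_of_le hab (min_le_left _ _)
    have hab2 := lt_of_lt_of_le hab (min_le_right _ _)
    rw [Real.dist_eq, abs_lt] at hab2
    have f1 := Int.floor_le a
    have f2 := Int.lt_floor_add_one a
    refine hh _ ⟨by linarith, by linarith⟩ _ ⟨by linarith, by linarith⟩ ?_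
    rwa [Real.dist_eq, sub_sub_sub_cancel_right, ← Real.dist_eq]
  -- A variation of `H'` below `2k` times its minimum makes half the difference at most `k` times
  -- half the sum.
  obtain ⟨δ, hδ, hδD⟩ := Metric.uniformContinuous_iff.1 hDu (2 * k * D x₀)
    (by have := hDpos x₀; positivity)
  have hpi := Real.pi_pos
  -- In the cover this is the strip `2 |Im z| < δ`, and `2 |Im z|` is the distance between the two
  -- arguments of `H'`.
  set U : Set ℂ := {w | Real.exp (-(Real.pi * δ)) < ‖w‖ ∧ ‖w‖ < Real.exp (Real.pi * δ)} with hUdef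
  have hUo : IsOpen U := (isOpen_lt continuous_const continuous_norm).inter
    (isOpen_lt continuous_norm continuous_const)
  have hU0 : ∀ w ∈ U, w ≠ 0 := fun w hw h0 => by
    have := hw.1
    rw [h0, norm_zero] at this
    exact absurd this (Real.exp_pos _).le.not_gt
  have hUim : ∀ z, planeCover z ∈ U → dist (z.re + z.im) (z.re - z.im) < δ := by
    intro z hz
    have h2 := hz.1
    have h3 := hz.2
    rw [norm_planeCover, Real.exp_lt_exp] at h2 h3
    rw [Real.dist_eq, abs_lt]
    constructor <;> nlinarith
  have hcd : ContDiffOn ℝ 1 (annulusExtension H) U := fun w hw => by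
    have := contDiffAt_annulusExtension h hH.1 (coverBranch 0 w)
    rw [planeCover_coverBranch 0 (hU0 w hw)] at this
    exact this.contDiffWithinAt
  refine ⟨U, annulusExtension H, ⟨hUo, ?_, hk0.le, hk1, fun w => fderiv ℝ (annulusExtension H) w 1,
    fun w => fderiv ℝ (annulusExtension H) w Complex.I, ?_, hasWeakDeriv_of_contDiffOn hUo hcd _,
    hasWeakDeriv_of_contDiffOn hUo hcd _, ?_⟩, ?_, ?_⟩
  · refine IsOpenEmbedding.of_continuous_injective_isOpenMap hcd.continuousOn.domRestrict ?_ ?_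
    · intro a b hab
      exact Subtype.ext (injective_annulusExtension h (hU0 _ a.2) (hU0 _ b.2) hab)
    · intro V hV
      have e : U.domRestrict (annulusExtension H) '' V =
          annulusExtension H '' (Subtype.val '' V) := by rw [image_image]; rfl
      rw [e]
      refine isOpen_image_annulusExtension h (hUo.isOpenMap_subtype_val V hV) ?_
      rintro _ ⟨w, -, rfl⟩
      exact hU0 _ w.2
  · intro A hA hAc
    have hb : ∀ v : ℂ, MemLp (fun w => fderiv ℝ (annulusExtension H) w v) 2
        (volume.restrict A) := by
      intro v
      have hco : ContinuousOn (fun z => fderiv ℝ (annulusExtension H) z v) A :=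
        ((hcd.continuousOn_fderiv_of_isOpen hUo le_rfl).clm_apply continuousOn_const).mono hA
      obtain ⟨C, hC⟩ := hAc.exists_bound_of_continuousOn hco
      have : IsFiniteMeasure (volume.restrict A) := ⟨by
        rw [Measure.restrict_apply_univ]; exact hAc.measure_lt_top⟩
      exact MemLp.of_bound (hco.aestronglyMeasurable hAc.measurableSet) C
        ((ae_restrict_iff' hAc.measurableSet).2 (Eventually.of_forall hC))
    exact ⟨hb 1, hb Complex.I⟩
  · refine (ae_restrict_iff' hUo.measurableSet).2 (Eventually.of_forall fun w hw => ?_)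
    obtain ⟨z, rfl⟩ : ∃ z, planeCover z = w := ⟨_, planeCover_coverBranch 0 (hU0 w hw)⟩
    obtain ⟨a, b, hb, hv⟩ := fderiv_annulusExtension h hDd z
    set P := (D (z.re + z.im) + D (z.re - z.im)) / 2
    set Q := (D (z.re + z.im) - D (z.re - z.im)) / 2
    have hQP : |Q| ≤ k * P := by
      have h2 := hδD (hUim z hw)
      rw [Real.dist_eq] at h2
      have h3 := hmin (z.re + z.im)
      have h4 := hmin (z.re - z.im)
      have h5 : |Q| = |D (z.re + z.im) - D (z.re - z.im)| / 2 := by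
        rw [abs_div, abs_two]
      have h6 : D x₀ ≤ P := by simp only [P]; linarith
      have h7 : k * D x₀ ≤ k * P := by gcongr
      linarith
    have hP0 : 0 ≤ P := by
      have := hDpos (z.re + z.im)
      have := hDpos (z.re - z.im)
      simp only [P]; linarith
    have e1 : (fderiv ℝ (annulusExtension H) (planeCover z) 1 +
        Complex.I * fderiv ℝ (annulusExtension H) (planeCover z) Complex.I) / 2 = a * (b * Q) := by
      rw [hv, hv, Complex.conj_I, map_one]
      linear_combination (a * (P - b * Q)) / 2 * Complex.I_mul_I
    have e2 : (fderiv ℝ (annulusExtension H) (planeCover z) 1 -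
        Complex.I * fderiv ℝ (annulusExtension H) (planeCover z) Complex.I) / 2 = a * P := by
      rw [hv, hv, Complex.conj_I, map_one]
      linear_combination -(a * (P - b * Q)) / 2 * Complex.I_mul_I
    rw [e1, e2, norm_mul, norm_mul, norm_mul, hb, one_mul, Complex.norm_real, Complex.norm_real,
      Real.norm_eq_abs, Real.norm_eq_abs, abs_of_nonneg hP0]
    calc _ ≤ ‖a‖ * (k * P) := by gcongr
      _ = _ := by ring
  · intro w hw
    have : ‖w‖ = 1 := by simpa using hw
    have hp : 0 < Real.pi * δ := by positivity
    rw [hUdef, mem_ofPred_eq, this]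
    exact ⟨Real.exp_lt_one_iff.2 (by linarith), Real.one_lt_exp_iff.2 hp⟩
  · intro x
    have := annulusExtension_planeCover h (x : ℂ)
    rwa [planeExtension_ofReal] at this

/-! ### Boundary dilatation equal to one -/

theorem one_le_boundaryDilatation (H : ℝ ≃o ℝ) : 1 ≤ boundaryDilatation H := by
  refine le_iInf fun U => le_iInf fun φ => le_iInf fun k => le_iInf fun h => ?_
  have h0 := h.quasiconformal.nonneg
  have h1 := h.quasiconformal.lt_one
  rw [ENNReal.one_le_ofReal, le_div_iff₀ (by linarith)]
  linarith

theorem boundaryDilatation_eq_one (H : ℝ ≃o ℝ) (h1 : ∀ x, H (x + 1) = H x + 1)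
    (hH : IsC1Diffeo H) : boundaryDilatation H = 1 := by
  refine le_antisymm ?_ (one_le_boundaryDilatation H)
  have hle : ∀ k ∈ Ioo (0 : ℝ) 1, boundaryDilatation H ≤ ENNReal.ofReal ((1 + k) / (1 - k)) := by
    intro k hk
    obtain ⟨U, φ, h⟩ := exists_isQCExtension H h1 hH hk.1 hk.2
    exact iInf_le_of_le U (iInf_le_of_le φ (iInf_le_of_le k (iInf_le_of_le h le_rfl)))
  have hlim : Tendsto (fun k : ℝ => ENNReal.ofReal ((1 + k) / (1 - k))) (𝓝[>] 0) (𝓝 1) := by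
    have hc : ContinuousAt (fun k : ℝ => (1 + k) / (1 - k)) 0 :=
      ContinuousAt.div (by fun_prop) (by fun_prop) (by norm_num)
    have := ENNReal.tendsto_ofReal (hc.tendsto.mono_left (nhdsWithin_le_nhds (s := Ioi 0)))
    simpa using this
  refine ge_of_tendsto hlim ?_
  filter_upwards [Ioo_mem_nhdsGT (zero_lt_one' ℝ)] with k hk
  exact hle k hk

theorem exists_isQCExtension_of_boundaryDilatation_eq_one {H : ℝ ≃o ℝ}
    (h : boundaryDilatation H = 1) {k₀ : ℝ} (hk₀ : 0 < k₀) (hk₁ : k₀ < 1) :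
    ∃ U φ k, k < k₀ ∧ IsQCExtension H U φ k := by
  have hlt : boundaryDilatation H < ENNReal.ofReal ((1 + k₀) / (1 - k₀)) := by
    rw [h, ENNReal.one_lt_ofReal, lt_div_iff₀ (by linarith)]
    linarith
  simp only [boundaryDilatation, iInf_lt_iff] at hlt
  obtain ⟨U, φ, k, hq, hlt⟩ := hlt
  refine ⟨U, φ, k, ?_, hq⟩
  have h1 := hq.quasiconformal.lt_one
  have h0 := hq.quasiconformal.nonneg
  rw [ENNReal.ofReal_lt_ofReal_iff (by apply div_pos <;> linarith),
    div_lt_div_iff₀ (by linarith) (by linarith)] at hlt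
  nlinarith

/-! ### The isoperimetric inequality in Fourier form -/

/-- **Wirtinger's inequality** for closed curves of mean zero. -/
theorem integral_norm_sq_le_of_mean_zero {γ γ' : ℝ → ℂ} {a b : ℝ} (hab : b - a = 2 * Real.pi)
    (hγ : ∀ θ, HasDerivAt γ (γ' θ) θ) (hγ' : Continuous γ') (hper : γ a = γ b)
    (hmean : ∫ θ in a..b, γ θ = 0) :
    ∫ θ in a..b, ‖γ θ‖ ^ 2 ≤ ∫ θ in a..b, ‖γ' θ‖ ^ 2 := by
  have hlt : a < b := by linarith [Real.pi_pos]
  have hc : Continuous γ := continuous_iff_continuousAt.2 fun θ => (hγ θ).continuousAt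
  have hL : ∀ {f : ℝ → ℂ}, Continuous f → MemLp f 2 (volume.restrict (Ioc a b)) := by
    intro f hf
    obtain ⟨C, hC⟩ := (isCompact_Icc (a := a) (b := b)).exists_bound_of_continuousOn hf.continuousOn
    exact MemLp.of_bound hf.aestronglyMeasurable C ((ae_restrict_iff' measurableSet_Ioc).2
      (Eventually.of_forall fun x hx => hC x (Ioc_subset_Icc_self hx)))
  have h1 := hasSum_sq_fourierCoeffOn hlt (hL hc)
  have h2 := hasSum_sq_fourierCoeffOn hlt (hL hγ')
  -- Periodicity kills the boundary term, so the `n`-th coefficient of `γ` is that of `γ'` divided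
  -- by `n` in modulus; the coefficient at `n = 0`, where this fails, vanishes by the mean-zero
  -- hypothesis.
  have hle : ∀ n : ℤ, ‖fourierCoeffOn hlt γ n‖ ^ 2 ≤ ‖fourierCoeffOn hlt γ' n‖ ^ 2 := by
    intro n
    rcases eq_or_ne n 0 with rfl | hn
    · have : fourierCoeffOn hlt γ 0 = 0 := by
        rw [fourierCoeffOn_eq_integral]
        simp [hmean]
      rw [this]; simp
    · have h3 := fourierCoeffOn_of_hasDerivAt hlt hn (fun x _ => hγ x)
        (hγ'.intervalIntegrable _ _)
      rw [hper, sub_self, mul_zero, zero_sub, ← Complex.ofReal_sub, hab] at h3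
      have h4 : fourierCoeffOn hlt γ n = -(Complex.I / n) * fourierCoeffOn hlt γ' n := by
        rw [h3]
        have hpi : (Real.pi : ℂ) ≠ 0 := by exact_mod_cast Real.pi_ne_zero
        have hn' : (n : ℂ) ≠ 0 := by exact_mod_cast hn
        have hI := Complex.I_ne_zero
        push_cast
        field_simp
        rw [Complex.I_sq]; ring
      have h5 : ‖(n : ℂ)‖ ≥ 1 := by
        rw [Complex.norm_intCast]
        exact_mod_cast Int.one_le_abs hn
      have h6 : ‖fourierCoeffOn hlt γ n‖ ≤ ‖fourierCoeffOn hlt γ' n‖ := by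
        rw [h4, norm_mul, norm_neg, norm_div, Complex.norm_I]
        exact mul_le_of_le_one_left (norm_nonneg _) (by rw [div_le_one (by linarith)]; exact h5)
      gcongr
  have h7 := hasSum_le hle h1 h2
  rw [smul_eq_mul, smul_eq_mul] at h7
  exact le_of_mul_le_mul_left h7 (inv_pos.2 (by linarith))

/-- The isoperimetric inequality: the oriented area enclosed by a closed curve is controlled by
its energy. -/
theorem integral_im_conj_mul_le {γ γ' : ℝ → ℂ} {a b : ℝ} (hab : b - a = 2 * Real.pi)
    (hγ : ∀ θ, HasDerivAt γ (γ' θ) θ) (hγ' : Continuous γ') (hper : γ a = γ b) :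
    ∫ θ in a..b, ((starRingEnd ℂ) (γ θ) * γ' θ).im ≤ ∫ θ in a..b, ‖γ' θ‖ ^ 2 := by
  have hlt : a < b := by linarith [Real.pi_pos]
  have hc : Continuous γ := continuous_iff_continuousAt.2 fun θ => (hγ θ).continuousAt
  -- The area integral is unchanged by translating the closed curve, since `γ'` has integral `0`;
  -- centring at the mean makes Wirtinger's inequality available.
  set m : ℂ := (2 * Real.pi : ℝ)⁻¹ • ∫ θ in a..b, γ θ with hm
  have hmean : ∫ θ in a..b, (γ θ - m) = 0 := by
    rw [intervalIntegral.integral_sub (hc.intervalIntegrable _ _) (by simp),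
      intervalIntegral.integral_const, hab, hm, smul_smul,
      mul_inv_cancel₀ (by have := Real.pi_pos; positivity), one_smul, sub_self]
  have hW := integral_norm_sq_le_of_mean_zero hab (fun θ => (hγ θ).sub_const m) hγ'
    (by rw [hper]) hmean
  have h0 : ∫ θ in a..b, γ' θ = 0 := by
    rw [intervalIntegral.integral_eq_sub_of_hasDerivAt (fun θ _ => hγ θ)
      (hγ'.intervalIntegrable _ _), hper, sub_self]
  have h1 : ∫ θ in a..b, ((starRingEnd ℂ) m * γ' θ).im = 0 := by
    have h2 := Complex.imCLM.intervalIntegral_comp_comm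
      ((hγ'.const_mul ((starRingEnd ℂ) m)).intervalIntegrable (μ := volume) a b)
    simp only [Complex.imCLM_apply] at h2
    rw [h2, intervalIntegral.integral_const_mul, h0]; simp
  have hcc : Continuous fun θ => ((starRingEnd ℂ) (γ θ - m) * γ' θ).im := by fun_prop
  have h3 : ∫ θ in a..b, ((starRingEnd ℂ) (γ θ) * γ' θ).im =
      ∫ θ in a..b, ((starRingEnd ℂ) (γ θ - m) * γ' θ).im := by
    rw [← add_zero (∫ θ in a..b, ((starRingEnd ℂ) (γ θ - m) * γ' θ).im), ← h1,
      ← intervalIntegral.integral_add (hcc.intervalIntegrable _ _)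
        (Continuous.intervalIntegrable (by fun_prop) _ _)]
    refine intervalIntegral.integral_congr fun θ _ => ?_
    simp only [map_sub, ← Complex.add_im]
    ring_nf
  rw [h3]
  have h4 : ∫ θ in a..b, ((starRingEnd ℂ) (γ θ - m) * γ' θ).im ≤
      ∫ θ in a..b, (‖γ θ - m‖ ^ 2 + ‖γ' θ‖ ^ 2) / 2 := by
    refine intervalIntegral.integral_mono_on hlt.le (hcc.intervalIntegrable _ _)
      (Continuous.intervalIntegrable (by fun_prop) _ _) fun θ _ => ?_
    have h5 := Complex.abs_im_le_norm ((starRingEnd ℂ) (γ θ - m) * γ' θ)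
    rw [norm_mul, RCLike.norm_conj] at h5
    have h6 := le_abs_self ((starRingEnd ℂ) (γ θ - m) * γ' θ).im
    nlinarith [sq_nonneg (‖γ θ - m‖ - ‖γ' θ‖)]
  rw [intervalIntegral.integral_div, intervalIntegral.integral_add
    (Continuous.intervalIntegrable (by fun_prop) _ _)
    (Continuous.intervalIntegrable (by fun_prop) _ _)] at h4
  linarith

/-! ### Wirtinger derivatives and Green's formula in polar coordinates -/

/-- The derivative `ψ_z = (ψ_x - i ψ_y) / 2`. -/
def wirtingerDz (ψ : ℂ → ℂ) (z : ℂ) : ℂ := (fderiv ℝ ψ z 1 - Complex.I * fderiv ℝ ψ z Complex.I) / 2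

/-- The derivative `ψ_{z̄} = (ψ_x + i ψ_y) / 2`. -/
def wirtingerDbar (ψ : ℂ → ℂ) (z : ℂ) : ℂ :=
  (fderiv ℝ ψ z 1 + Complex.I * fderiv ℝ ψ z Complex.I) / 2

theorem fderiv_eq_wirtinger (ψ : ℂ → ℂ) (z v : ℂ) :
    fderiv ℝ ψ z v = wirtingerDz ψ z * v + wirtingerDbar ψ z * (starRingEnd ℂ) v := by
  have h : fderiv ℝ ψ z v = v.re * fderiv ℝ ψ z 1 + v.im * fderiv ℝ ψ z Complex.I := by
    conv_lhs => rw [show v = v.re • (1 : ℂ) + v.im • Complex.I by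
      simp [Complex.re_add_im]]
    rw [map_add, map_smul, map_smul, Complex.real_smul, Complex.real_smul]
  have h1 := Complex.re_add_im v
  have h2 : (starRingEnd ℂ) v = v.re - v.im * Complex.I := by
    apply Complex.ext <;> simp
  rw [h, h2, wirtingerDz, wirtingerDbar]
  nth_rw 3 [← h1]
  linear_combination (fderiv ℝ ψ z) Complex.I * v.im * Complex.I_mul_I

theorem continuous_wirtingerDz {ψ : ℂ → ℂ} (h : ContDiff ℝ 1 ψ) : Continuous (wirtingerDz ψ) := by
  have := h.continuous_fderiv one_ne_zero
  unfold wirtingerDz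
  fun_prop

theorem continuous_wirtingerDbar {ψ : ℂ → ℂ} (h : ContDiff ℝ 1 ψ) :
    Continuous (wirtingerDbar ψ) := by
  have := h.continuous_fderiv one_ne_zero
  unfold wirtingerDbar
  fun_prop

/-- Polar coordinates centered at `a`. -/
def polarPoint (a : ℂ) (x : ℝ × ℝ) : ℂ := a + x.1 * Complex.exp (x.2 * Complex.I)

theorem contDiff_polarPoint (a : ℂ) : ContDiff ℝ 2 (polarPoint a) := by
  unfold polarPoint
  have h1 : ContDiff ℝ 2 fun x : ℝ × ℝ => (x.1 : ℂ) := Complex.ofRealCLM.contDiff.comp contDiff_fst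
  have h2 : ContDiff ℝ 2 fun x : ℝ × ℝ => (x.2 : ℂ) := Complex.ofRealCLM.contDiff.comp contDiff_snd
  exact contDiff_const.add (h1.mul ((h2.mul contDiff_const).cexp))

theorem fderiv_polarPoint (a : ℂ) (x : ℝ × ℝ) :
    fderiv ℝ (polarPoint a) x (1, 0) = Complex.exp (x.2 * Complex.I) ∧
    fderiv ℝ (polarPoint a) x (0, 1) = x.1 * (Complex.exp (x.2 * Complex.I) * Complex.I) := by
  have hd : HasFDerivAt (polarPoint a) (fderiv ℝ (polarPoint a) x) x :=
    ((contDiff_polarPoint a).differentiable two_ne_zero x).hasFDerivAt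
  have e1 : HasDerivAt (fun s : ℝ => ((s : ℝ), x.2)) ((1 : ℝ), (0 : ℝ)) x.1 :=
    (hasDerivAt_id x.1).prodMk (hasDerivAt_const _ _)
  have e2 : HasDerivAt (fun s : ℝ => (x.1, (s : ℝ))) ((0 : ℝ), (1 : ℝ)) x.2 :=
    (hasDerivAt_const _ _).prodMk (hasDerivAt_id x.2)
  constructor
  · have h1 := hd.comp_hasDerivAt_of_eq x.1 e1 rfl
    have h2 : HasDerivAt (fun s : ℝ => a + (s : ℂ) * Complex.exp (x.2 * Complex.I))
        (1 * Complex.exp (x.2 * Complex.I)) x.1 :=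
      ((Complex.ofRealCLM.hasDerivAt (x := x.1)).mul_const _).const_add a
    rw [one_mul] at h2
    exact h1.unique h2
  · have h1 := hd.comp_hasDerivAt_of_eq x.2 e2 rfl
    have h2 : HasDerivAt (fun s : ℝ => a + (x.1 : ℂ) * Complex.exp (s * Complex.I))
        (x.1 * (Complex.exp (x.2 * Complex.I) * (1 * Complex.I))) x.2 :=
      ((((Complex.ofRealCLM.hasDerivAt (x := x.2)).mul_const Complex.I).cexp).const_mul _).const_add a
    rw [one_mul] at h2
    exact h1.unique h2

/-- Green's formula for the form `Im (ū du)`: by symmetry the second derivatives cancel, leaving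
twice the Jacobian. The hypothesis on the sides `θ = a` and `θ = b` makes their contributions
cancel. -/
theorem integral_divergence_conj {u : ℝ × ℝ → ℂ} (hu : ContDiff ℝ 2 u) (a b r : ℝ)
    (hper : ∀ s, (starRingEnd ℂ) (u (s, a)) * fderiv ℝ u (s, a) (1, 0) =
      (starRingEnd ℂ) (u (s, b)) * fderiv ℝ u (s, b) (1, 0)) :
    ∫ s in (0 : ℝ)..r, ∫ θ in a..b,
        2 * ((starRingEnd ℂ) (fderiv ℝ u (s, θ) (1, 0)) * fderiv ℝ u (s, θ) (0, 1)).im =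
      (∫ θ in a..b, ((starRingEnd ℂ) (u (r, θ)) * fderiv ℝ u (r, θ) (0, 1)).im) -
        ∫ θ in a..b, ((starRingEnd ℂ) (u (0, θ)) * fderiv ℝ u (0, θ) (0, 1)).im := by
  have hu1 : ∀ x, HasFDerivAt u (fderiv ℝ u x) x := fun x =>
    (hu.differentiable two_ne_zero x).hasFDerivAt
  have hfd : ContDiff ℝ 1 (fderiv ℝ u) := hu.fderiv_right (by norm_num)
  have hu2 : ∀ x, HasFDerivAt (fderiv ℝ u) (fderiv ℝ (fderiv ℝ u) x) x := fun x =>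
    (hfd.differentiable one_ne_zero x).hasFDerivAt
  have hsym : ∀ x, fderiv ℝ (fderiv ℝ u) x (1, 0) (0, 1) = fderiv ℝ (fderiv ℝ u) x (0, 1) (1, 0) :=
    fun x => (hu.contDiffAt.isSymmSndFDerivAt (by simp)) _ _
  have key : ∀ (v : ℝ × ℝ) (x : ℝ × ℝ),
      ∃ L : ℝ × ℝ →L[ℝ] ℝ, HasFDerivAt (fun x => ((starRingEnd ℂ) (u x) * fderiv ℝ u x v).im) L x ∧
        ∀ w, L w = ((starRingEnd ℂ) (fderiv ℝ u x w) * fderiv ℝ u x v +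
          (starRingEnd ℂ) (u x) * fderiv ℝ (fderiv ℝ u) x w v).im := by
    intro v x
    have h1 : HasFDerivAt (fun x => (starRingEnd ℂ) (u x))
        ((Complex.conjCLE : ℂ →L[ℝ] ℂ).comp (fderiv ℝ u x)) x :=
      (Complex.conjCLE : ℂ →L[ℝ] ℂ).hasFDerivAt.comp x (hu1 x)
    have h2 := (hu2 x).clm_apply (hasFDerivAt_const v x)
    have h3 := Complex.imCLM.hasFDerivAt.comp x (h1.mul h2)
    refine ⟨_, h3, fun w => ?_⟩
    simp
    ring
  choose Lf hLf hLf' using key (0, 1)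
  choose Lg hLg hLg' using key (1, 0)
  have hdiv : ∀ x, Lf x (1, 0) + (-Lg x) (0, 1) =
      2 * ((starRingEnd ℂ) (fderiv ℝ u x (1, 0)) * fderiv ℝ u x (0, 1)).im := by
    intro x
    rw [neg_apply, hLf', hLg', hsym]
    simp only [Complex.add_im, Complex.mul_im, Complex.conj_re, Complex.conj_im]
    ring
  have hcf : Continuous fun x => ((starRingEnd ℂ) (u x) * fderiv ℝ u x (0, 1)).im := by
    have := hu.continuous
    have := hfd.continuous
    fun_prop
  have hcg : Continuous fun x => ((starRingEnd ℂ) (u x) * fderiv ℝ u x (1, 0)).im := by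
    have := hu.continuous
    have := hfd.continuous
    fun_prop
  have hcd : Continuous fun x => 2 * ((starRingEnd ℂ) (fderiv ℝ u x (1, 0)) *
      fderiv ℝ u x (0, 1)).im := by
    have := hfd.continuous
    fun_prop
  have h := integral2_divergence_prod_of_hasFDerivAt
    (fun x => ((starRingEnd ℂ) (u x) * fderiv ℝ u x (0, 1)).im)
    (fun x => -((starRingEnd ℂ) (u x) * fderiv ℝ u x (1, 0)).im) Lf (fun x => -Lg x) 0 a r b
    hcf.continuousOn hcg.neg.continuousOn (fun x _ => hLf x) (fun x _ => (hLg x).neg)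
    (by
      simp only [hdiv]
      exact hcd.continuousOn.integrableOn_compact (isCompact_uIcc.prod isCompact_uIcc))
  simp only [hdiv, hper, sub_self, zero_add] at h
  exact h

/-- The Jacobian of a smooth map has over a disc an integral which is at most half the energy of the
boundary curve. -/
theorem integral_jacobian_le {ψ : ℂ → ℂ} (hψ : ContDiff ℝ 2 ψ) (a : ℂ) {r : ℝ} (hr : 0 ≤ r) :
    ∫ s in (0 : ℝ)..r, ∫ θ in (-Real.pi)..Real.pi,
        s * (‖wirtingerDz ψ (polarPoint a (s, θ))‖ ^ 2 -
          ‖wirtingerDbar ψ (polarPoint a (s, θ))‖ ^ 2) ≤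
      r ^ 2 / 2 * ∫ θ in (-Real.pi)..Real.pi, (‖wirtingerDz ψ (polarPoint a (r, θ))‖ +
          ‖wirtingerDbar ψ (polarPoint a (r, θ))‖) ^ 2 := by
  set u : ℝ × ℝ → ℂ := fun x => ψ (polarPoint a x) with hu
  have hu2 : ContDiff ℝ 2 u := hψ.comp (contDiff_polarPoint a)
  have hfd : ∀ x v, fderiv ℝ u x v = fderiv ℝ ψ (polarPoint a x) (fderiv ℝ (polarPoint a) x v) := by
    intro x v
    have h1 := (hψ.differentiable two_ne_zero (polarPoint a x)).hasFDerivAt.comp x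
      ((contDiff_polarPoint a).differentiable two_ne_zero x).hasFDerivAt
    rw [show fderiv ℝ u x = _ from h1.fderiv]; rfl
  have hus : ∀ x, fderiv ℝ u x (1, 0) = fderiv ℝ ψ (polarPoint a x)
      (Complex.exp (x.2 * Complex.I)) := fun x => by rw [hfd, (fderiv_polarPoint a x).1]
  have hut : ∀ x, fderiv ℝ u x (0, 1) = fderiv ℝ ψ (polarPoint a x)
      (x.1 * (Complex.exp (x.2 * Complex.I) * Complex.I)) :=
    fun x => by rw [hfd, (fderiv_polarPoint a x).2]
  have hepi : Complex.exp ((-Real.pi : ℝ) * Complex.I) = Complex.exp (Real.pi * Complex.I) := by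
    rw [Complex.exp_pi_mul_I]; push_cast; rw [neg_mul, Complex.exp_neg, Complex.exp_pi_mul_I]
    norm_num
  have hP : ∀ s, polarPoint a (s, -Real.pi) = polarPoint a (s, Real.pi) := fun s => by
    simp only [polarPoint, hepi]
  -- With `X` and `Y` the two Wirtinger terms rotated by unit factors, this is the identity `Im
  -- (conj (X + Y) * I * (X - Y)) = |X|² - |Y|²`.
  have hjac : ∀ x : ℝ × ℝ, ((starRingEnd ℂ) (fderiv ℝ u x (1, 0)) * fderiv ℝ u x (0, 1)).im =
      x.1 * (‖wirtingerDz ψ (polarPoint a x)‖ ^ 2 - ‖wirtingerDbar ψ (polarPoint a x)‖ ^ 2) := by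
    intro x
    rw [hus, hut, fderiv_eq_wirtinger, fderiv_eq_wirtinger]
    set e := Complex.exp (x.2 * Complex.I) with he
    have hne : ‖e‖ = 1 := Complex.norm_exp_ofReal_mul_I _
    set p := wirtingerDz ψ (polarPoint a x)
    set q := wirtingerDbar ψ (polarPoint a x)
    have hnp : ‖p‖ ^ 2 = ‖p * e‖ ^ 2 := by rw [norm_mul, hne, mul_one]
    have hnq : ‖q‖ ^ 2 = ‖q * (starRingEnd ℂ) e‖ ^ 2 := by
      rw [norm_mul, RCLike.norm_conj, hne, mul_one]
    rw [hnp, hnq, map_mul (starRingEnd ℂ) (x.1 : ℂ), map_mul (starRingEnd ℂ) e, Complex.conj_I,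
      Complex.conj_ofReal]
    generalize hX : p * e = X
    generalize hY : q * (starRingEnd ℂ) e = Y
    have e1 : p * (x.1 * (e * Complex.I)) + q * (x.1 * ((starRingEnd ℂ) e * -Complex.I)) =
        x.1 * (Complex.I * (X - Y)) := by rw [← hX, ← hY]; ring
    rw [e1, Complex.sq_norm, Complex.sq_norm, Complex.normSq_apply, Complex.normSq_apply]
    simp only [map_add, Complex.mul_im, Complex.mul_re, Complex.add_re, Complex.add_im,
      Complex.conj_re, Complex.conj_im, Complex.ofReal_re, Complex.ofReal_im, Complex.I_re,
      Complex.I_im, Complex.sub_re, Complex.sub_im]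
    ring
  have hdiv := integral_divergence_conj hu2 (-Real.pi) Real.pi r (fun s => by
    rw [hus, hus]; simp only [hu, hP, hepi])
  -- The edge `s = 0` collapses to the centre of the disc and contributes nothing.
  have hu0 : ∀ θ, fderiv ℝ u (0, θ) (0, 1) = 0 := fun θ => by rw [hut]; simp
  simp only [hjac, hu0, mul_zero, Complex.zero_im, intervalIntegral.integral_zero, sub_zero] at hdiv
  have hder : ∀ θ, HasDerivAt (fun θ => u (r, θ)) (fderiv ℝ u (r, θ) (0, 1)) θ := by
    intro θ
    have e2 : HasDerivAt (fun s : ℝ => (r, (s : ℝ))) ((0 : ℝ), (1 : ℝ)) θ :=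
      (hasDerivAt_const _ _).prodMk (hasDerivAt_id θ)
    exact (hu2.differentiable two_ne_zero (r, θ)).hasFDerivAt.comp_hasDerivAt_of_eq θ e2 rfl
  have hcont : Continuous fun θ => fderiv ℝ u (r, θ) (0, 1) := by
    have := hu2.continuous_fderiv two_ne_zero
    fun_prop
  have hiso := integral_im_conj_mul_le (γ := fun θ => u (r, θ)) (a := -Real.pi) (b := Real.pi)
    (by ring) hder hcont (by simp only [hu, hP])
  have hcz := continuous_wirtingerDz (hψ.of_le one_le_two)
  have hcb := continuous_wirtingerDbar (hψ.of_le one_le_two)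
  have hcP := (contDiff_polarPoint a).continuous
  have hbound : ∫ θ in (-Real.pi)..Real.pi, ‖fderiv ℝ u (r, θ) (0, 1)‖ ^ 2 ≤
      ∫ θ in (-Real.pi)..Real.pi, r ^ 2 * (‖wirtingerDz ψ (polarPoint a (r, θ))‖ +
          ‖wirtingerDbar ψ (polarPoint a (r, θ))‖) ^ 2 := by
    refine intervalIntegral.integral_mono_on (by linarith [Real.pi_pos])
      (Continuous.intervalIntegrable (by fun_prop) _ _)
      (Continuous.intervalIntegrable (by fun_prop) _ _) fun θ _ => ?_
    rw [hut, fderiv_eq_wirtinger, ← mul_pow]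
    refine pow_le_pow_left₀ (norm_nonneg _) ?_ 2
    have hne : ‖(r : ℂ) * (Complex.exp (θ * Complex.I) * Complex.I)‖ = r := by
      rw [norm_mul, norm_mul, Complex.norm_exp_ofReal_mul_I, Complex.norm_I, Complex.norm_real,
        Real.norm_of_nonneg hr]; ring
    refine (norm_add_le _ _).trans ?_
    rw [norm_mul (wirtingerDz ψ _), norm_mul (wirtingerDbar ψ _), RCLike.norm_conj, hne]
    linarith
  rw [intervalIntegral.integral_const_mul] at hbound
  have h2 : ∀ s : ℝ, ∫ θ in (-Real.pi)..Real.pi, 2 * (s *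
      (‖wirtingerDz ψ (polarPoint a (s, θ))‖ ^ 2 - ‖wirtingerDbar ψ (polarPoint a (s, θ))‖ ^ 2)) =
      2 * ∫ θ in (-Real.pi)..Real.pi, s * (‖wirtingerDz ψ (polarPoint a (s, θ))‖ ^ 2 -
        ‖wirtingerDbar ψ (polarPoint a (s, θ))‖ ^ 2) := fun s =>
    intervalIntegral.integral_const_mul _ _
  simp only [h2, intervalIntegral.integral_const_mul] at hdiv ⊢
  linarith

/-! ### Weighted energy inequality for smooth functions -/

/-- The truncated power weight `max(s, δ)^{-2β}`. -/
def radialWeight (β δ s : ℝ) : ℝ := (max s δ) ^ (-2 * β)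

theorem continuous_radialWeight (β : ℝ) {δ : ℝ} (hδ : 0 < δ) : Continuous (radialWeight β δ) := by
  unfold radialWeight
  exact (continuous_id.max continuous_const).rpow_const fun s =>
    Or.inl (lt_max_of_lt_right hδ).ne'

theorem radialWeight_nonneg (β : ℝ) {δ : ℝ} (hδ : 0 < δ) (s : ℝ) : 0 ≤ radialWeight β δ s :=
  Real.rpow_nonneg (hδ.le.trans (le_max_right _ _)) _

/-- Let `G r` be the integral of `p - q` up to `r`. Differentiating `r^{-2β} G r` produces `r^{-2β}
(p - q)` minus `2β r^{-2β-1} G r`, and the hypothesis bounds the latter by a multiple of `r^{-2β}`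
in which `p` has the coefficient `β (1 + η)`. For `β < 1` some `η` keeps this below `1`, so a
positive multiple of `p` survives. -/
theorem exists_weighted_integral_le {β : ℝ} (hβ0 : 0 < β) (hβ1 : β < 1) :
    ∃ c C : ℝ, 0 < c ∧ 0 < C ∧ ∀ (p q : ℝ → ℝ) (R : ℝ), Continuous p → Continuous q →
      (∀ s, 0 ≤ s → 0 ≤ p s) → (∀ s, 0 ≤ s → 0 ≤ q s) →
      (∀ r, 0 ≤ r → ∀ η > 0, ∫ s in (0 : ℝ)..r, (p s - q s) ≤
        r / 2 * ((1 + η) * p r + (1 + η⁻¹) * q r)) →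
      ∀ δ, 0 < δ → δ ≤ R → c * ∫ s in (0 : ℝ)..R, radialWeight β δ s * p s ≤
        R ^ (-2 * β) * (∫ s in (0 : ℝ)..R, p s) +
          C * ∫ s in (0 : ℝ)..R, radialWeight β δ s * q s := by
  -- Chosen so that `β (1 + η) = (1 + β) / 2`, halfway between `β` and `1`; what is left for `p` is
  -- `c = (1 - β) / 2`.
  set η := (1 - β) / (2 * β) with hη
  have hη0 : 0 < η := div_pos (by linarith) (by linarith)
  have hβη : β * (1 + η) = (1 + β) / 2 := by rw [hη]; field_simp; ring
  refine ⟨(1 - β) / 2, 1 + β * (1 + η⁻¹), by linarith, by positivity,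
    fun p q R hp hq hp0 hq0 h δ hδ hδR => ?_⟩
  have hR : 0 < R := hδ.trans_le hδR
  set c := (1 - β) / 2 with hc
  set C := 1 + β * (1 + η⁻¹) with hC
  have hC1 : 1 ≤ C := by
    have : 0 < β * (1 + η⁻¹) := by positivity
    linarith
  set G : ℝ → ℝ := fun r => ∫ s in (0 : ℝ)..r, (p s - q s) with hG
  have hGd : ∀ r, HasDerivAt G (p r - q r) r := fun r =>
    intervalIntegral.integral_hasDerivAt_right ((hp.sub hq).intervalIntegrable _ _)
      ((hp.sub hq).stronglyMeasurableAtFilter _ _) (hp.sub hq).continuousAt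
  have hGc : Continuous G := continuous_iff_continuousAt.2 fun r => (hGd r).continuousAt
  have hw := continuous_radialWeight β hδ
  have hw0 := radialWeight_nonneg β hδ
  have hii : ∀ {f : ℝ → ℝ} {a b : ℝ}, Continuous f → IntervalIntegrable f volume a b :=
    fun hf => hf.intervalIntegrable _ _
  have hu : ∀ r ∈ uIcc δ R, r ≠ 0 := fun r hr => by
    rw [uIcc_of_le hδR] at hr; linarith [hr.1]
  have hder : ∀ r ∈ uIcc δ R, HasDerivAt (fun r => r ^ (-2 * β) * G r)
      ((-2 * β) * r ^ (-2 * β - 1) * G r + r ^ (-2 * β) * (p r - q r)) r := fun r hr =>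
    (Real.hasDerivAt_rpow_const (Or.inl (hu r hr))).mul (hGd r)
  have hcontd : ContinuousOn (fun r => (-2 * β) * r ^ (-2 * β - 1) * G r +
      r ^ (-2 * β) * (p r - q r)) (uIcc δ R) := by
    refine ((continuousOn_const.mul (continuousOn_id.rpow_const fun r hr => Or.inl (hu r hr))).mul
      hGc.continuousOn).add ((continuousOn_id.rpow_const fun r hr => Or.inl (hu r hr)).mul
      (hp.sub hq).continuousOn)
  have hftc := intervalIntegral.integral_eq_sub_of_hasDerivAt hder hcontd.intervalIntegrable
  have hmono : ∫ r in δ..R, (radialWeight β δ r * (c * p r - C * q r)) ≤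
      ∫ r in δ..R, ((-2 * β) * r ^ (-2 * β - 1) * G r + r ^ (-2 * β) * (p r - q r)) := by
    refine intervalIntegral.integral_mono_on hδR (hii (by fun_prop)) hcontd.intervalIntegrable
      fun r hr => ?_
    have hr0 : 0 < r := hδ.trans_le hr.1
    have h1 := h r hr0.le η hη0
    have e1 : radialWeight β δ r = r ^ (-2 * β) := by rw [radialWeight, max_eq_left hr.1]
    have e2 : r ^ (-2 * β) = r ^ (-2 * β - 1) * r := by
      rw [Real.rpow_sub_one hr0.ne', div_mul_cancel₀ _ hr0.ne']
    have hpw : 0 < r ^ (-2 * β - 1) := Real.rpow_pos_of_pos hr0 _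
    have h2 : 2 * β * r ^ (-2 * β - 1) * G r ≤ 2 * β * r ^ (-2 * β - 1) *
        (r / 2 * ((1 + η) * p r + (1 + η⁻¹) * q r)) := by gcongr
    have h3 : 2 * β * r ^ (-2 * β - 1) * (r / 2 * ((1 + η) * p r + (1 + η⁻¹) * q r)) =
        r ^ (-2 * β) * (β * (1 + η) * p r + β * (1 + η⁻¹) * q r) := by rw [e2]; ring
    rw [h3, hβη] at h2
    rw [e1]
    have h4 : r ^ (-2 * β) * (c * p r - C * q r) = r ^ (-2 * β) * (p r - q r) -
        r ^ (-2 * β) * ((1 + β) / 2 * p r + β * (1 + η⁻¹) * q r) := by rw [hc, hC]; ring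
    rw [h4]
    linarith
  -- Below `δ` the weight is constant and `c ≤ 1 ≤ C`; this part is controlled by exactly the
  -- boundary term at `δ` from the other part.
  have hlow : ∫ r in (0 : ℝ)..δ, (radialWeight β δ r * (c * p r - C * q r)) ≤
      δ ^ (-2 * β) * G δ := by
    rw [hG, ← intervalIntegral.integral_const_mul]
    refine intervalIntegral.integral_mono_on hδ.le (hii (by fun_prop)) (hii (by fun_prop))
      fun r hr => ?_
    have e1 : radialWeight β δ r = δ ^ (-2 * β) := by rw [radialWeight, max_eq_right hr.2]
    rw [e1]
    have := hp0 r hr.1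
    have := hq0 r hr.1
    have hpos : 0 < δ ^ (-2 * β) := Real.rpow_pos_of_pos hδ _
    have h5 : c * p r ≤ p r := mul_le_of_le_one_left (hp0 r hr.1) (by rw [hc]; linarith)
    have h6 : q r ≤ C * q r := le_mul_of_one_le_left (hq0 r hr.1) hC1
    gcongr
  have hadd := intervalIntegral.integral_add_adjacent_intervals
    (hii (a := 0) (b := δ) (by fun_prop : Continuous fun r => radialWeight β δ r * (c * p r - C * q r)))
    (hii (a := δ) (b := R) (by fun_prop))
  have hGR : G R ≤ ∫ s in (0 : ℝ)..R, p s := by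
    refine intervalIntegral.integral_mono_on hR.le (hii (by fun_prop)) (hii hp) fun r hr => ?_
    linarith [hq0 r hr.1]
  have hRG : R ^ (-2 * β) * G R ≤ R ^ (-2 * β) * ∫ s in (0 : ℝ)..R, p s := by gcongr
  have hsplit : ∫ r in (0 : ℝ)..R, (radialWeight β δ r * (c * p r - C * q r)) =
      c * (∫ s in (0 : ℝ)..R, radialWeight β δ s * p s) -
        C * ∫ s in (0 : ℝ)..R, radialWeight β δ s * q s := by
    rw [← intervalIntegral.integral_const_mul, ← intervalIntegral.integral_const_mul,
      ← intervalIntegral.integral_sub (hii (by fun_prop)) (hii (by fun_prop))]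
    exact intervalIntegral.integral_congr fun r _ => by ring
  linarith

theorem norm_polarPoint_sub (a : ℂ) (x : ℝ × ℝ) : ‖polarPoint a x - a‖ = |x.1| := by
  rw [polarPoint, add_sub_cancel_left, norm_mul, Complex.norm_exp_ofReal_mul_I, mul_one,
    Complex.norm_real, Real.norm_eq_abs]

theorem continuous_polarPoint (a : ℂ) : Continuous (polarPoint a) := (contDiff_polarPoint a).continuous

theorem setIntegral_ball_eq_polar {F : ℂ → ℝ} (hF : Continuous F) (a : ℂ) {R : ℝ} (hR : 0 ≤ R) :
    ∫ z in Metric.ball a R, F z =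
      ∫ s in (0 : ℝ)..R, ∫ θ in (-Real.pi)..Real.pi, s * F (polarPoint a (s, θ)) := by
  have hpi := Real.pi_pos
  rw [← integral_indicator measurableSet_ball,
    ← integral_add_left_eq_self (fun z => (Metric.ball a R).indicator F z) a,
    ← Complex.integral_comp_polarCoord_symm]
  have e1 : ∀ p ∈ polarCoord.target, p.1 • (Metric.ball a R).indicator F
      (a + Complex.polarCoord.symm p) =
      (Ioo 0 R ×ˢ Ioo (-Real.pi) Real.pi).indicator (fun p => p.1 * F (polarPoint a p)) p := by
    intro p hp
    have hp1 : 0 < p.1 := hp.1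
    have hp2 : p.2 ∈ Ioo (-Real.pi) Real.pi := hp.2
    have e2 : a + Complex.polarCoord.symm p = polarPoint a p := by
      rw [Complex.polarCoord_symm_apply, polarPoint, Complex.exp_mul_I, Complex.ofReal_cos,
        Complex.ofReal_sin]
    rw [e2]
    by_cases hpR : p.1 < R
    · rw [indicator_of_mem, indicator_of_mem, smul_eq_mul]
      · exact ⟨⟨hp1, hpR⟩, hp2⟩
      · rw [mem_ball_iff_norm, norm_polarPoint_sub, abs_of_pos hp1]; exact hpR
    · rw [indicator_of_notMem, indicator_of_notMem, smul_zero]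
      · exact fun h => hpR h.1.2
      · rw [mem_ball_iff_norm, norm_polarPoint_sub, abs_of_pos hp1]; exact hpR
  have hcont : Continuous fun p : ℝ × ℝ => p.1 * F (polarPoint a p) := by
    have := continuous_polarPoint a
    fun_prop
  have hms : MeasurableSet (Ioo 0 R ×ˢ Ioo (-Real.pi) Real.pi) :=
    measurableSet_Ioo.prod measurableSet_Ioo
  rw [setIntegral_congr_fun polarCoord.open_target.measurableSet e1, setIntegral_indicator hms]
  have e3 : polarCoord.target ∩ Ioo 0 R ×ˢ Ioo (-Real.pi) Real.pi =
      Ioo 0 R ×ˢ Ioo (-Real.pi) Real.pi := by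
    refine inter_eq_right.2 ?_
    rintro p ⟨h1, h2⟩
    exact ⟨h1.1, h2⟩
  rw [e3, Measure.volume_eq_prod, setIntegral_prod]
  · rw [intervalIntegral.integral_of_le hR, integral_Ioc_eq_integral_Ioo]
    refine setIntegral_congr_fun measurableSet_Ioo fun s _ => ?_
    simp only
    rw [intervalIntegral.integral_of_le (by linarith), integral_Ioc_eq_integral_Ioo]
  · exact (hcont.continuousOn.integrableOn_compact (isCompact_Icc.prod isCompact_Icc)).mono_set
      (prod_mono Ioo_subset_Icc_self Ioo_subset_Icc_self)

theorem continuous_integral_circle {F : ℂ → ℝ} (hF : Continuous F) (a : ℂ) :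
    Continuous fun s : ℝ => ∫ θ in (-Real.pi)..Real.pi, s * F (polarPoint a (s, θ)) := by
  have := continuous_polarPoint a
  refine intervalIntegral.continuous_parametric_intervalIntegral_of_continuous' ?_ _ _
  fun_prop

/-- In polar coordinates `p` and `q` are the circular integrals of `|ψ_z|²` and `|ψ_{z̄}|²`. The
hypothesis of the one-dimensional lemma is the Jacobian estimate, after `(x + y)² ≤ (1 + η) x² + (1
+ η⁻¹) y²`. -/
theorem exists_weighted_energy_le {β : ℝ} (hβ0 : 0 < β) (hβ1 : β < 1) :
    ∃ c C : ℝ, 0 < c ∧ 0 < C ∧ ∀ (ψ : ℂ → ℂ), ContDiff ℝ 2 ψ → ∀ (a : ℂ) (δ R : ℝ), 0 < δ → δ ≤ R →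
      c * ∫ z in Metric.ball a R, radialWeight β δ ‖z - a‖ * ‖wirtingerDz ψ z‖ ^ 2 ≤
        R ^ (-2 * β) * (∫ z in Metric.ball a R, ‖wirtingerDz ψ z‖ ^ 2) +
        C * ∫ z in Metric.ball a R, radialWeight β δ ‖z - a‖ * ‖wirtingerDbar ψ z‖ ^ 2 := by
  obtain ⟨c, C, hc, hC, h⟩ := exists_weighted_integral_le hβ0 hβ1
  refine ⟨c, C, hc, hC, fun ψ hψ a δ R hδ hδR => ?_⟩
  have hR : 0 < R := hδ.trans_le hδR
  have hz : Continuous fun z => ‖wirtingerDz ψ z‖ ^ 2 :=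
    (continuous_wirtingerDz (hψ.of_le one_le_two)).norm.pow 2
  have hb : Continuous fun z => ‖wirtingerDbar ψ z‖ ^ 2 :=
    (continuous_wirtingerDbar (hψ.of_le one_le_two)).norm.pow 2
  have hcz := continuous_wirtingerDz (hψ.of_le one_le_two)
  have hcb := continuous_wirtingerDbar (hψ.of_le one_le_two)
  have hw := continuous_radialWeight β hδ
  have hpi := Real.pi_pos
  have hcP := continuous_polarPoint a
  have hweight : ∀ F : ℂ → ℝ, ∀ s ∈ uIcc 0 R, ∫ θ in (-Real.pi)..Real.pi,
      s * (radialWeight β δ ‖polarPoint a (s, θ) - a‖ * F (polarPoint a (s, θ))) =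
      radialWeight β δ s * ∫ θ in (-Real.pi)..Real.pi, s * F (polarPoint a (s, θ)) := by
    intro F s hs
    rw [uIcc_of_le hR.le] at hs
    rw [← intervalIntegral.integral_const_mul]
    refine intervalIntegral.integral_congr fun θ _ => ?_
    simp only [norm_polarPoint_sub, abs_of_nonneg hs.1]
    ring
  rw [setIntegral_ball_eq_polar (by fun_prop) a hR.le, setIntegral_ball_eq_polar hz a hR.le,
    setIntegral_ball_eq_polar (by fun_prop) a hR.le,
    intervalIntegral.integral_congr (hweight fun z => ‖wirtingerDz ψ z‖ ^ 2),
    intervalIntegral.integral_congr (hweight fun z => ‖wirtingerDbar ψ z‖ ^ 2)]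
  have hnn : ∀ f : ℂ → ℂ, ∀ s, 0 ≤ s → 0 ≤ ∫ θ in (-Real.pi)..Real.pi,
      s * ‖f (polarPoint a (s, θ))‖ ^ 2 := fun f s hs =>
    intervalIntegral.integral_nonneg (by linarith) fun θ _ => by positivity
  refine h _ _ R (continuous_integral_circle hz a) (continuous_integral_circle hb a)
    (hnn _) (hnn _) (fun r hr η hη => ?_) δ hδ hδR
  have hjac := integral_jacobian_le hψ a hr
  have hii : ∀ {f : ℝ → ℝ}, Continuous f → IntervalIntegrable f volume (-Real.pi) Real.pi :=
    fun hf => hf.intervalIntegrable _ _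
  have e1 : ∀ s : ℝ, (∫ θ in (-Real.pi)..Real.pi, s * ‖wirtingerDz ψ (polarPoint a (s, θ))‖ ^ 2) -
      (∫ θ in (-Real.pi)..Real.pi, s * ‖wirtingerDbar ψ (polarPoint a (s, θ))‖ ^ 2) =
      ∫ θ in (-Real.pi)..Real.pi, s * (‖wirtingerDz ψ (polarPoint a (s, θ))‖ ^ 2 -
        ‖wirtingerDbar ψ (polarPoint a (s, θ))‖ ^ 2) := by
    intro s
    rw [← intervalIntegral.integral_sub (hii (by fun_prop)) (hii (by fun_prop))]
    exact intervalIntegral.integral_congr fun θ _ => by ring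
  simp only [e1]
  refine hjac.trans ?_
  have h2 : ∫ θ in (-Real.pi)..Real.pi, (‖wirtingerDz ψ (polarPoint a (r, θ))‖ +
      ‖wirtingerDbar ψ (polarPoint a (r, θ))‖) ^ 2 ≤ ∫ θ in (-Real.pi)..Real.pi,
      ((1 + η) * ‖wirtingerDz ψ (polarPoint a (r, θ))‖ ^ 2 +
        (1 + η⁻¹) * ‖wirtingerDbar ψ (polarPoint a (r, θ))‖ ^ 2) := by
    refine intervalIntegral.integral_mono_on (by linarith) (hii (by fun_prop)) (hii (by fun_prop))
      fun θ _ => ?_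
    generalize ‖wirtingerDz ψ (polarPoint a (r, θ))‖ = x
    generalize ‖wirtingerDbar ψ (polarPoint a (r, θ))‖ = y
    have h3 : 0 ≤ η⁻¹ * (η * x - y) ^ 2 := by positivity
    have h4 : η⁻¹ * (η * x - y) ^ 2 = η * x ^ 2 - 2 * x * y + η⁻¹ * y ^ 2 := by field_simp; ring
    linarith
  rw [intervalIntegral.integral_add (hii (by fun_prop)) (hii (by fun_prop)),
    intervalIntegral.integral_const_mul, intervalIntegral.integral_const_mul] at h2
  rw [intervalIntegral.integral_const_mul, intervalIntegral.integral_const_mul]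
  calc _ ≤ r ^ 2 / 2 * _ := mul_le_mul_of_nonneg_left h2 (by positivity)
    _ = _ := by ring

/-! ### Morrey's estimate for smooth functions -/

/-- A bound for the norm of the derivative. -/
def gradNorm (ψ : ℂ → ℂ) (z : ℂ) : ℝ := ‖wirtingerDz ψ z‖ + ‖wirtingerDbar ψ z‖

theorem continuous_gradNorm {ψ : ℂ → ℂ} (h : ContDiff ℝ 1 ψ) : Continuous (gradNorm ψ) :=
  (continuous_wirtingerDz h).norm.add (continuous_wirtingerDbar h).norm

theorem gradNorm_nonneg (ψ : ℂ → ℂ) (z : ℂ) : 0 ≤ gradNorm ψ z := by unfold gradNorm; positivity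

theorem norm_sub_le_integral_gradNorm {ψ : ℂ → ℂ} (h : ContDiff ℝ 1 ψ) (a : ℂ) {s : ℝ} (hs : 0 ≤ s)
    (θ : ℝ) : ‖ψ (polarPoint a (s, θ)) - ψ a‖ ≤
      ∫ t in (0 : ℝ)..s, gradNorm ψ (polarPoint a (t, θ)) := by
  set e := Complex.exp (θ * Complex.I) with he
  have hne : ‖e‖ = 1 := Complex.norm_exp_ofReal_mul_I _
  have hd : ∀ t : ℝ, HasDerivAt (fun t : ℝ => ψ (polarPoint a (t, θ)))
      (fderiv ℝ ψ (polarPoint a (t, θ)) e) t := by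
    intro t
    have h2 : HasDerivAt (fun t : ℝ => a + (t : ℂ) * e) (1 * e) t :=
      ((Complex.ofRealCLM.hasDerivAt (x := t)).mul_const _).const_add a
    rw [one_mul] at h2
    change HasDerivAt (fun t : ℝ => polarPoint a (t, θ)) e t at h2
    exact ((h.differentiable one_ne_zero _).hasFDerivAt).comp_hasDerivAt t h2
  have hcP := continuous_polarPoint a
  have hcf := h.continuous_fderiv one_ne_zero
  have hcg := continuous_gradNorm h
  have hint := intervalIntegral.integral_eq_sub_of_hasDerivAt (a := 0) (b := s) (fun t _ => hd t)
    (Continuous.intervalIntegrable (by fun_prop) _ _)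
  have h0 : polarPoint a (0, θ) = a := by simp [polarPoint]
  rw [h0] at hint
  rw [← hint]
  refine intervalIntegral.norm_integral_le_of_norm_le hs (Eventually.of_forall fun t _ => ?_)
    (Continuous.intervalIntegrable (by fun_prop) _ _)
  rw [fderiv_eq_wirtinger, gradNorm]
  refine (norm_add_le _ _).trans ?_
  rw [norm_mul, norm_mul, RCLike.norm_conj, hne, mul_one, mul_one]

theorem integral_integral_swap_of_continuous {f : ℝ → ℝ → ℝ} (hf : Continuous (Function.uncurry f))
    {a b c d : ℝ} (hab : a ≤ b) (hcd : c ≤ d) :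
    ∫ x in a..b, ∫ y in c..d, f x y = ∫ y in c..d, ∫ x in a..b, f x y := by
  simp only [intervalIntegral.integral_of_le hab, intervalIntegral.integral_of_le hcd]
  refine integral_integral_swap ?_
  rw [Measure.prod_restrict, ← Measure.volume_eq_prod]
  exact (hf.continuousOn.integrableOn_compact (isCompact_Icc.prod isCompact_Icc)).mono_set
    (prod_mono Ioc_subset_Icc_self Ioc_subset_Icc_self)

/-- Bounding each increment along a ray by the integral of the gradient over the full radius leaves
the factor `∫ s ds = r² / 2`. -/
theorem integral_ball_norm_sub_le {ψ : ℂ → ℂ} (h : ContDiff ℝ 1 ψ) (a : ℂ) {r : ℝ} (hr : 0 ≤ r) :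
    ∫ z in Metric.ball a r, ‖ψ z - ψ a‖ ≤ r ^ 2 / 2 *
      ∫ t in (0 : ℝ)..r, ∫ θ in (-Real.pi)..Real.pi, gradNorm ψ (polarPoint a (t, θ)) := by
  have hpi := Real.pi_pos
  have hcψ := h.continuous
  have hcP := continuous_polarPoint a
  have hcg := continuous_gradNorm h
  rw [setIntegral_ball_eq_polar (by fun_prop) a hr, integral_integral_swap_of_continuous
    (f := fun t θ => gradNorm ψ (polarPoint a (t, θ))) (by fun_prop) hr (by linarith)]
  set V : ℝ := ∫ θ in (-Real.pi)..Real.pi, ∫ t in (0 : ℝ)..r, gradNorm ψ (polarPoint a (t, θ))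
  have h1 : ∀ s ∈ Icc (0 : ℝ) r, ∫ θ in (-Real.pi)..Real.pi,
      s * ‖ψ (polarPoint a (s, θ)) - ψ a‖ ≤ s * V := by
    intro s hs
    rw [intervalIntegral.integral_const_mul]
    refine mul_le_mul_of_nonneg_left ?_ hs.1
    refine intervalIntegral.integral_mono_on (by linarith)
      (Continuous.intervalIntegrable (by fun_prop) _ _) (Continuous.intervalIntegrable ?_ _ _)
      fun θ _ => ?_
    · refine intervalIntegral.continuous_parametric_intervalIntegral_of_continuous' ?_ _ _
      fun_prop
    · refine (norm_sub_le_integral_gradNorm h a hs.1 θ).trans ?_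
      refine intervalIntegral.integral_mono_interval le_rfl hs.1 hs.2
        (Eventually.of_forall fun t => gradNorm_nonneg _ _)
        (Continuous.intervalIntegrable (by fun_prop) _ _)
  have h2 := intervalIntegral.integral_mono_on (μ := volume) hr
    ((continuous_integral_circle (F := fun z => ‖ψ z - ψ a‖) (by fun_prop) a).intervalIntegrable _ _)
    (Continuous.intervalIntegrable (by fun_prop) _ _) h1
  refine h2.trans (le_of_eq ?_)
  rw [intervalIntegral.integral_mul_const, integral_id]
  ring

/-- Average the triangle inequality over the disc of radius `r / 2` about the midpoint, which lies
in both discs of radius `r`. Its area `π r² / 4` against the total bound `r² V` gives the constant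
`4 / π`. -/
theorem norm_sub_le_of_gradNorm {ψ : ℂ → ℂ} (h : ContDiff ℝ 1 ψ) {a b : ℂ} {r V : ℝ} (hr : 0 < r)
    (hab : ‖a - b‖ = r)
    (ha : ∫ t in (0 : ℝ)..r, ∫ θ in (-Real.pi)..Real.pi, gradNorm ψ (polarPoint a (t, θ)) ≤ V)
    (hb : ∫ t in (0 : ℝ)..r, ∫ θ in (-Real.pi)..Real.pi, gradNorm ψ (polarPoint b (t, θ)) ≤ V) :
    ‖ψ a - ψ b‖ ≤ 4 / Real.pi * V := by
  have hpi := Real.pi_pos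
  have hcψ := h.continuous
  set m : ℂ := (a + b) / 2 with hm
  have hma : Metric.ball m (r / 2) ⊆ Metric.ball a r := by
    refine Metric.ball_subset_ball' ?_
    have : dist m a = r / 2 := by
      rw [dist_comm, dist_eq_norm, show a - m = (a - b) / 2 by rw [hm]; ring, norm_div, hab]; simp
    rw [this]; linarith
  have hmb : Metric.ball m (r / 2) ⊆ Metric.ball b r := by
    refine Metric.ball_subset_ball' ?_
    have : dist m b = r / 2 := by
      rw [dist_eq_norm, show m - b = (a - b) / 2 by rw [hm]; ring, norm_div, hab]; simp
    rw [this]; linarith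
  have hio : ∀ {f : ℂ → ℝ} (x : ℂ) (s : ℝ), Continuous f → IntegrableOn f (Metric.ball x s) volume :=
    fun {f} x s hf => by
      have h0 : IntegrableOn f (Metric.closedBall x s) volume :=
        hf.continuousOn.integrableOn_compact (isCompact_closedBall x s)
      exact h0.mono_set Metric.ball_subset_closedBall
  have h1 : ∀ c : ℂ, Metric.ball m (r / 2) ⊆ Metric.ball c r →
      ∫ z in Metric.ball m (r / 2), ‖ψ z - ψ c‖ ≤ ∫ z in Metric.ball c r, ‖ψ z - ψ c‖ := fun c hc =>
    setIntegral_mono_set (hio _ _ (by fun_prop)) (Eventually.of_forall fun z => norm_nonneg _)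
      (Eventually.of_forall hc)
  have h2 : ∫ z in Metric.ball m (r / 2), ‖ψ a - ψ b‖ ≤
      ∫ z in Metric.ball m (r / 2), (‖ψ z - ψ a‖ + ‖ψ z - ψ b‖) := by
    refine setIntegral_mono_on (hio _ _ continuous_const) (hio _ _ (by fun_prop)) measurableSet_ball
      fun z _ => ?_
    rw [← norm_sub_rev (ψ a) (ψ z)]
    have := norm_add_le (ψ a - ψ z) (ψ z - ψ b)
    rwa [sub_add_sub_cancel] at this
  rw [integral_add (hio _ _ (by fun_prop)) (hio _ _ (by fun_prop)), setIntegral_const,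
    Measure.real, Complex.volume_ball, smul_eq_mul] at h2
  have h3 := integral_ball_norm_sub_le h a hr.le
  have h4 := integral_ball_norm_sub_le h b hr.le
  have h5 : r ^ 2 / 2 * _ ≤ r ^ 2 / 2 * V := mul_le_mul_of_nonneg_left ha (by positivity)
  have h6 : r ^ 2 / 2 * _ ≤ r ^ 2 / 2 * V := mul_le_mul_of_nonneg_left hb (by positivity)
  have h7 := h1 a hma
  have h8 := h1 b hmb
  have e : (ENNReal.ofReal (r / 2) ^ 2 * NNReal.pi : ℝ≥0∞).toReal = (r / 2) ^ 2 * Real.pi := by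
    rw [ENNReal.toReal_mul, ENNReal.toReal_pow, ENNReal.toReal_ofReal (by positivity)]; rfl
  rw [e] at h2
  rw [div_mul_eq_mul_div, le_div_iff₀ hpi]
  have h9 : r ^ 2 * (‖ψ a - ψ b‖ * Real.pi) ≤ r ^ 2 * (4 * V) := by linarith
  exact le_of_mul_le_mul_left h9 (by positivity)

/-- The weighted energy controls the gradient integral through `g ≤ (r^β / 2) t^{1-2β} g² + (r^{-β}
/ 2) t^{2β-1}`, whose last term is integrable at `0` because `β > 0`. The powers of `r` balance the
two contributions to order `r^β`. -/
theorem integral_gradNorm_le {ψ : ℂ → ℂ} (h : ContDiff ℝ 1 ψ) (a : ℂ) {β r E : ℝ} (hβ : 0 < β)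
    (hr : 0 < r)
    (hE : ∀ δ, 0 < δ → δ ≤ r →
      ∫ z in Metric.ball a r, radialWeight β δ ‖z - a‖ * gradNorm ψ z ^ 2 ≤ E) :
    ∫ t in (0 : ℝ)..r, ∫ θ in (-Real.pi)..Real.pi, gradNorm ψ (polarPoint a (t, θ)) ≤
      (E / 2 + Real.pi / (2 * β)) * r ^ β := by
  have hpi := Real.pi_pos
  have hcP := continuous_polarPoint a
  have hcg := continuous_gradNorm h
  have hII : ∀ {f : ℝ → ℝ}, Continuous f → ∀ x y, IntervalIntegrable f volume x y :=
    fun hf x y => hf.intervalIntegrable _ _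
  set k : ℝ → ℝ := fun t => ∫ θ in (-Real.pi)..Real.pi, gradNorm ψ (polarPoint a (t, θ)) with hk
  have hkc : Continuous k := by
    refine intervalIntegral.continuous_parametric_intervalIntegral_of_continuous' ?_ _ _
    fun_prop
  have hrβ : 0 < r ^ β := Real.rpow_pos_of_pos hr _
  -- The truncated weight equals `t^{-2β}` only for `t ≥ δ`; the bound does not depend on `δ`, which
  -- then tends to `0`.
  have key : ∀ δ, 0 < δ → δ ≤ r → ∫ t in δ..r, k t ≤ (E / 2 + Real.pi / (2 * β)) * r ^ β := by
    intro δ hδ hδr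
    have hw := continuous_radialWeight β hδ
    set S : ℝ → ℝ := fun t => ∫ θ in (-Real.pi)..Real.pi,
      t * (radialWeight β δ ‖polarPoint a (t, θ) - a‖ * gradNorm ψ (polarPoint a (t, θ)) ^ 2) with hS
    have hSc : Continuous S := continuous_integral_circle (F := fun z =>
      radialWeight β δ ‖z - a‖ * gradNorm ψ z ^ 2) (by fun_prop) a
    have hS1 := hE δ hδ hδr
    rw [setIntegral_ball_eq_polar (by fun_prop) a hr.le] at hS1
    have hS0 : ∀ t, 0 ≤ t → 0 ≤ S t := fun t ht =>
      intervalIntegral.integral_nonneg (by linarith) fun θ _ =>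
        mul_nonneg ht (mul_nonneg (radialWeight_nonneg β hδ _) (sq_nonneg _))
    have hSδ : ∫ t in δ..r, S t ≤ E := by
      refine le_trans ?_ hS1
      have h1 := intervalIntegral.integral_add_adjacent_intervals (hII hSc 0 δ) (hII hSc δ r)
      have h2 : 0 ≤ ∫ t in (0 : ℝ)..δ, S t :=
        intervalIntegral.integral_nonneg hδ.le fun t ht => hS0 t ht.1
      change _ ≤ ∫ t in (0 : ℝ)..r, S t
      linarith
    have hpt : ∀ t ∈ Icc δ r, k t ≤ r ^ β / 2 * S t + Real.pi * (r ^ β)⁻¹ * t ^ (2 * β - 1) := by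
      intro t ht
      have ht0 : 0 < t := hδ.trans_le ht.1
      have e1 : r ^ β / 2 * S t + Real.pi * (r ^ β)⁻¹ * t ^ (2 * β - 1) =
          ∫ θ in (-Real.pi)..Real.pi, (r ^ β / 2 * (t * (radialWeight β δ ‖polarPoint a (t, θ) - a‖ *
            gradNorm ψ (polarPoint a (t, θ)) ^ 2)) + (r ^ β)⁻¹ / 2 * t ^ (2 * β - 1)) := by
        rw [intervalIntegral.integral_add (hII (by fun_prop) _ _) (hII (by fun_prop) _ _),
          intervalIntegral.integral_const_mul, intervalIntegral.integral_const, smul_eq_mul]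
        ring
      rw [e1]
      refine intervalIntegral.integral_mono_on (by linarith) (hII (by fun_prop) _ _)
        (hII (by fun_prop) _ _) fun θ _ => ?_
      rw [norm_polarPoint_sub, abs_of_pos ht0, radialWeight, max_eq_left ht.1]
      generalize gradNorm ψ (polarPoint a (t, θ)) = g
      set X := t * t ^ (-2 * β) with hX
      have hX0 : 0 < X := mul_pos ht0 (Real.rpow_pos_of_pos ht0 _)
      have e2 : t ^ (2 * β - 1) = X⁻¹ := by
        rw [hX, mul_comm t, ← Real.rpow_add_one ht0.ne', ← Real.rpow_neg ht0.le]
        congr 1; ring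
      rw [e2]
      have h3 : 0 ≤ (r ^ β * X)⁻¹ / 2 * (r ^ β * X * g - 1) ^ 2 := by positivity
      have h4 : (r ^ β * X)⁻¹ / 2 * (r ^ β * X * g - 1) ^ 2 =
          r ^ β / 2 * (X * g ^ 2) - g + (r ^ β)⁻¹ / 2 * X⁻¹ := by field_simp; ring
      have h5 : t * (t ^ (-2 * β) * g ^ 2) = X * g ^ 2 := by rw [hX]; ring
      rw [h5]
      linarith
    have hci : IntervalIntegrable (fun t : ℝ => t ^ (2 * β - 1)) volume δ r :=
      intervalIntegral.intervalIntegrable_rpow (Or.inr (by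
        rw [uIcc_of_le hδr]; exact fun h0 => absurd h0.1 (not_le.2 hδ)))
    have h6 := intervalIntegral.integral_mono_on hδr (hII hkc _ _)
      (((hII hSc _ _).const_mul _).add (hci.const_mul _)) hpt
    rw [intervalIntegral.integral_add ((hII hSc _ _).const_mul _) (hci.const_mul _),
      intervalIntegral.integral_const_mul, intervalIntegral.integral_const_mul,
      integral_rpow (Or.inl (by linarith)), sub_add_cancel] at h6
    have h7 : r ^ β / 2 * ∫ t in δ..r, S t ≤ r ^ β / 2 * E := by gcongr
    have h8 : Real.pi * (r ^ β)⁻¹ * ((r ^ (2 * β) - δ ^ (2 * β)) / (2 * β)) ≤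
        Real.pi / (2 * β) * r ^ β := by
      have e3 : r ^ (2 * β) = r ^ β * r ^ β := by rw [← Real.rpow_add hr]; congr 1; ring
      have e4 : Real.pi / (2 * β) * r ^ β =
          Real.pi * (r ^ β)⁻¹ * (r ^ (2 * β) / (2 * β)) := by rw [e3]; field_simp
      rw [e4]
      have : 0 ≤ δ ^ (2 * β) := Real.rpow_nonneg hδ.le _
      gcongr
      linarith
    linarith
  have hlim : Tendsto (fun δ => ∫ t in δ..r, k t) (𝓝[>] 0) (𝓝 (∫ t in (0 : ℝ)..r, k t)) := by
    have hc : Continuous fun δ => ∫ t in δ..r, k t := by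
      have : (fun δ => ∫ t in δ..r, k t) = fun δ => -∫ t in r..δ, k t := by
        funext δ; rw [intervalIntegral.integral_symm]
      rw [this]
      exact (intervalIntegral.continuous_primitive (fun a b => hII hkc a b) r).neg
    exact (hc.tendsto 0).mono_left nhdsWithin_le_nhds
  refine le_of_tendsto hlim ?_
  filter_upwards [Ioc_mem_nhdsGT hr] with δ hδ
  exact key δ hδ.1 hδ.2

/-! ### Mollification -/

/-- The convolution of `g` with a normalized bump function. -/
def mollify (ρ : ContDiffBump (0 : ℂ)) (g : ℂ → ℂ) : ℂ → ℂ :=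
  convolution (ρ.normed volume) g (ContinuousLinearMap.lsmul ℝ ℝ) volume

theorem mollify_apply (ρ : ContDiffBump (0 : ℂ)) (g : ℂ → ℂ) (y : ℂ) :
    mollify ρ g y = ∫ t, ρ.normed volume t • g (y - t) := rfl

theorem mollify_apply' (ρ : ContDiffBump (0 : ℂ)) (g : ℂ → ℂ) (y : ℂ) :
    mollify ρ g y = ∫ s, ρ.normed volume (y - s) • g s := convolution_lsmul_swap

theorem contDiff_mollify (ρ : ContDiffBump (0 : ℂ)) {g : ℂ → ℂ} (hg : LocallyIntegrable g) {n : ℕ∞} :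
    ContDiff ℝ n (mollify ρ g) :=
  ρ.hasCompactSupport_normed.contDiff_convolution_left _ ρ.contDiff_normed hg

theorem integrable_normed_sub_smul (ρ : ContDiffBump (0 : ℂ)) {g : ℂ → ℂ} (hg : LocallyIntegrable g)
    (y : ℂ) : Integrable fun s => ρ.normed volume (y - s) • g s :=
  (ρ.hasCompactSupport_normed.convolutionExists_left (ContinuousLinearMap.lsmul ℝ ℝ)
    ρ.continuous_normed hg y).integrable_swap

/-- The derivative of the convolution falls on the bump, and `s ↦ ρ (y - s)` is an admissible test
function since its support lies in the closed ball about `y`. Its reflection accounts for the sign.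
-/
theorem hasWeakDeriv_fderiv_mollify (ρ : ContDiffBump (0 : ℂ)) {φ g : ℂ → ℂ} {O : Set ℂ} {v : ℂ}
    (hφ : LocallyIntegrable φ) (hw : HasWeakDeriv φ O v g) {y : ℂ}
    (hy : Metric.closedBall y ρ.rOut ⊆ O) :
    fderiv ℝ (mollify ρ φ) y v = mollify ρ g y := by
  have hρ : ContDiff ℝ ∞ (ρ.normed (volume : Measure ℂ)) := ρ.contDiff_normed (n := ⊤)
  have h1 := ρ.hasCompactSupport_normed.hasFDerivAt_convolution_left (μ := volume)
    (ContinuousLinearMap.lsmul ℝ ℝ) (ρ.contDiff_normed (μ := volume) (n := 1)) hφ y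
  have h2 : fderiv ℝ (mollify ρ φ) y v =
      ∫ s, (fderiv ℝ (ρ.normed volume) (y - s) v) • φ s := by
    have h3 : fderiv ℝ (mollify ρ φ) y = _ := h1.fderiv
    have hi : Integrable fun s => (ContinuousLinearMap.lsmul ℝ ℝ).precompL ℂ
        (fderiv ℝ (ρ.normed volume) (y - s)) (φ s) :=
      (((ρ.hasCompactSupport_normed (μ := volume)).fderiv ℝ).convolutionExists_left
        (ContinuousLinearMap.precompL ℂ (ContinuousLinearMap.lsmul ℝ ℝ : ℝ →L[ℝ] ℂ →L[ℝ] ℂ))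
        (hρ.continuous_fderiv (by simp)) hφ y).integrable_swap
    rw [h3, convolution_eq_swap, ContinuousLinearMap.integral_apply hi]
    rfl
  set χ : ℂ → ℝ := fun s => ρ.normed volume (y - s) with hχ
  have hχd : ∀ s, fderiv ℝ χ s v = -fderiv ℝ (ρ.normed volume) (y - s) v := by
    intro s
    have h4 : HasFDerivAt χ _ s := ((hρ.differentiable (by simp)) (y - s)).hasFDerivAt.comp s
      ((hasFDerivAt_id s).const_sub y)
    rw [h4.fderiv]
    simp
  have hts : tsupport χ ⊆ Metric.closedBall y ρ.rOut := by
    refine closure_minimal (fun s hs => ?_) Metric.isClosed_closedBall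
    have : y - s ∈ Function.support (ρ.normed volume) := hs
    rw [ρ.support_normed_eq, mem_ball_zero_iff] at this
    rw [Metric.mem_closedBall, dist_comm, dist_eq_norm]
    exact this.le
  have hχc : HasCompactSupport χ := (isCompact_closedBall y ρ.rOut).of_isClosed_subset
    (isClosed_tsupport _) hts
  have h5 := hw χ (hρ.comp (contDiff_const.sub contDiff_id)) hχc (hts.trans hy)
  rw [h2, mollify_apply', ← neg_neg (∫ s, _ • g s), ← h5, ← integral_neg]
  refine integral_congr_ae (Eventually.of_forall fun s => ?_)
  simp only [hχd, neg_smul, neg_neg]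

theorem wirtingerDz_mollify (ρ : ContDiffBump (0 : ℂ)) {φ gx gy : ℂ → ℂ} {O : Set ℂ}
    (hφ : LocallyIntegrable φ) (hgx : LocallyIntegrable gx) (hgy : LocallyIntegrable gy)
    (hx : HasWeakDeriv φ O 1 gx) (hy : HasWeakDeriv φ O Complex.I gy) {y : ℂ}
    (h : Metric.closedBall y ρ.rOut ⊆ O) :
    wirtingerDz (mollify ρ φ) y = mollify ρ (fun z => (gx z - Complex.I * gy z) / 2) y := by
  rw [wirtingerDz, hasWeakDeriv_fderiv_mollify ρ hφ hx h, hasWeakDeriv_fderiv_mollify ρ hφ hy h,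
    mollify_apply', mollify_apply', mollify_apply', ← integral_const_mul,
    ← integral_sub (integrable_normed_sub_smul ρ hgx y)
      ((integrable_normed_sub_smul ρ hgy y).const_mul _), ← integral_div]
  congr 1; funext s
  simp only [Complex.real_smul]
  ring

theorem wirtingerDbar_mollify (ρ : ContDiffBump (0 : ℂ)) {φ gx gy : ℂ → ℂ} {O : Set ℂ}
    (hφ : LocallyIntegrable φ) (hgx : LocallyIntegrable gx) (hgy : LocallyIntegrable gy)
    (hx : HasWeakDeriv φ O 1 gx) (hy : HasWeakDeriv φ O Complex.I gy) {y : ℂ}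
    (h : Metric.closedBall y ρ.rOut ⊆ O) :
    wirtingerDbar (mollify ρ φ) y = mollify ρ (fun z => (gx z + Complex.I * gy z) / 2) y := by
  rw [wirtingerDbar, hasWeakDeriv_fderiv_mollify ρ hφ hx h, hasWeakDeriv_fderiv_mollify ρ hφ hy h,
    mollify_apply', mollify_apply', mollify_apply', ← integral_const_mul,
    ← integral_add (integrable_normed_sub_smul ρ hgx y)
      ((integrable_normed_sub_smul ρ hgy y).const_mul _), ← integral_div]
  congr 1; funext s
  simp only [Complex.real_smul]
  ring

/-- Jensen's inequality for the square of a mollified function. -/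
theorem enorm_mollify_sq_le (ρ : ContDiffBump (0 : ℂ)) {g : ℂ → ℂ} (hg : Measurable g) (y : ℂ) :
    ‖mollify ρ g y‖ₑ ^ 2 ≤ ∫⁻ t, ENNReal.ofReal (ρ.normed volume t) * ‖g (y - t)‖ₑ ^ 2 := by
  set η : ℂ → ℝ≥0∞ := fun t => ENNReal.ofReal (ρ.normed volume t) with hη
  have hηm : Measurable η := ENNReal.measurable_ofReal.comp ρ.continuous_normed.measurable
  have hgm : Measurable fun t => ‖g (y - t)‖ₑ := (hg.comp (measurable_const.sub measurable_id)).enorm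
  have h1 : ∫⁻ t, η t = 1 := by
    rw [hη, ← ofReal_integral_eq_lintegral_ofReal ρ.integrable_normed
      (Eventually.of_forall ρ.nonneg_normed), ρ.integral_normed, ENNReal.ofReal_one]
  have : IsProbabilityMeasure (volume.withDensity η) := ⟨by
    rw [withDensity_apply _ MeasurableSet.univ, Measure.restrict_univ, h1]⟩
  have h2 : ‖mollify ρ g y‖ₑ ≤ ∫⁻ t, ‖g (y - t)‖ₑ ∂volume.withDensity η := by
    rw [lintegral_withDensity_eq_lintegral_mul _ hηm hgm, mollify_apply]
    refine (enorm_integral_le_lintegral_enorm _).trans (lintegral_mono fun t => ?_)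
    rw [enorm_smul, Real.enorm_eq_ofReal (ρ.nonneg_normed t)]
    rfl
  have h3 := eLpNorm_le_eLpNorm_of_exponent_le (μ := volume.withDensity η)
    (p := 1) (q := 2) (by norm_num)
    (f := fun t => g (y - t)) (hg.comp (measurable_const.sub measurable_id)).aestronglyMeasurable
  rw [eLpNorm_one_eq_lintegral_enorm] at h3
  have h4 := pow_le_pow_left' (h2.trans h3) 2
  refine h4.trans (le_of_eq ?_)
  have h5 := eLpNorm_nnreal_pow_eq_lintegral (μ := volume.withDensity η) (p := 2)
    (f := fun t => g (y - t)) (by norm_num)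
  simp only [NNReal.coe_ofNat, ENNReal.coe_ofNat, ENNReal.rpow_ofNat] at h5
  rw [h5, lintegral_withDensity_eq_lintegral_mul _ hηm (hgm.pow_const 2)]
  rfl

/-- By Jensen and Tonelli, mollification averages the weighted energy over translates of the weight
by vectors shorter than the bump radius. -/
theorem lintegral_mul_enorm_mollify_sq_le (ρ : ContDiffBump (0 : ℂ)) {g : ℂ → ℂ} (hg : Measurable g)
    {V : ℂ → ℝ≥0∞} (hV : Measurable V) {M : ℝ≥0∞}
    (h : ∀ t : ℂ, ‖t‖ < ρ.rOut → ∫⁻ y, V (y + t) * ‖g y‖ₑ ^ 2 ≤ M) :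
    ∫⁻ y, V y * ‖mollify ρ g y‖ₑ ^ 2 ≤ M := by
  have hηm : Measurable fun t => ENNReal.ofReal (ρ.normed volume t) :=
    ENNReal.measurable_ofReal.comp ρ.continuous_normed.measurable
  have h1 : ∫⁻ t, ENNReal.ofReal (ρ.normed volume t) = 1 := by
    rw [← ofReal_integral_eq_lintegral_ofReal ρ.integrable_normed
      (Eventually.of_forall ρ.nonneg_normed), ρ.integral_normed, ENNReal.ofReal_one]
  calc ∫⁻ y, V y * ‖mollify ρ g y‖ₑ ^ 2
      ≤ ∫⁻ y, ∫⁻ t, V y * (ENNReal.ofReal (ρ.normed volume t) * ‖g (y - t)‖ₑ ^ 2) := by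
        refine lintegral_mono fun y => ?_
        rw [lintegral_const_mul _ (by fun_prop)]
        exact mul_le_mul_right (enorm_mollify_sq_le ρ hg y) _
    _ = ∫⁻ t, ∫⁻ y, V y * (ENNReal.ofReal (ρ.normed volume t) * ‖g (y - t)‖ₑ ^ 2) := by
        refine lintegral_lintegral_swap (Measurable.aemeasurable ?_)
        exact (hV.comp measurable_fst).mul ((hηm.comp measurable_snd).mul
          ((hg.comp (measurable_fst.sub measurable_snd)).enorm.pow_const 2))
    _ ≤ ∫⁻ t, ENNReal.ofReal (ρ.normed volume t) * M := by
        refine lintegral_mono fun t => ?_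
        rcases lt_or_ge ‖t‖ ρ.rOut with ht | ht
        · have e : ∀ y, V y * (ENNReal.ofReal (ρ.normed volume t) * ‖g (y - t)‖ₑ ^ 2) =
              ENNReal.ofReal (ρ.normed volume t) * (V y * ‖g (y - t)‖ₑ ^ 2) := fun y => by ring
          simp only [e]
          rw [lintegral_const_mul _ (by fun_prop)]
          refine mul_le_mul_right ?_ _
          rw [← lintegral_add_right_eq_self _ t]
          simpa only [add_sub_cancel_right] using h t ht
        · have h0 : ρ.normed volume t = 0 := by
            rw [← Function.notMem_support, ρ.support_normed_eq, mem_ball_zero_iff]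
            exact not_lt.2 ht
          simp [h0]
    _ = M := by rw [lintegral_mul_const _ hηm, h1, one_mul]

/-! ### Weighted energy and Hölder estimate for Sobolev functions of small dilatation -/

/-- The truncated power weight on the plane, with values in `ℝ≥0∞`. -/
def diskWeight (β δ : ℝ) (z : ℂ) : ℝ≥0∞ := ENNReal.ofReal (radialWeight β δ ‖z‖)

theorem measurable_diskWeight (β : ℝ) {δ : ℝ} (hδ : 0 < δ) : Measurable (diskWeight β δ) :=
  ENNReal.measurable_ofReal.comp ((continuous_radialWeight β hδ).comp continuous_norm).measurable

theorem diskWeight_le_of_le {β δ s : ℝ} (hβ : 0 < β) (hs : 0 < s) {z : ℂ} (h : s ≤ max ‖z‖ δ) :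
    diskWeight β δ z ≤ ENNReal.ofReal (s ^ (-2 * β)) :=
  ENNReal.ofReal_le_ofReal (Real.rpow_le_rpow_of_nonpos hs h (by linarith))

/-- A shift by at most `δ` cannot reduce `max ‖z‖ δ` by more than half, and `2^{2β} ≤ 4`. Thus
mollifying below the truncation scale costs a factor `4`. -/
theorem diskWeight_add_le {β δ : ℝ} (hβ0 : 0 < β) (hβ1 : β < 1) (hδ : 0 < δ) (z : ℂ) {t : ℂ}
    (ht : ‖t‖ ≤ δ) : diskWeight β δ (z + t) ≤ 4 * diskWeight β δ z := by
  have h0 : 0 < max ‖z‖ δ := lt_max_of_lt_right hδ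
  have h1 : max ‖z‖ δ / 2 ≤ max ‖z + t‖ δ := by
    have h2 := norm_sub_le (z + t) t
    rw [add_sub_cancel_right] at h2
    have h3 := le_max_left ‖z + t‖ δ
    have h4 := le_max_right ‖z + t‖ δ
    rw [div_le_iff₀ two_pos]
    exact max_le (by linarith) (by linarith)
  refine (diskWeight_le_of_le hβ0 (by positivity) h1).trans ?_
  rw [diskWeight, radialWeight, show (4 : ℝ≥0∞) = ENNReal.ofReal 4 by simp,
    ← ENNReal.ofReal_mul (by norm_num)]
  refine ENNReal.ofReal_le_ofReal ?_
  rw [Real.div_rpow h0.le two_pos.le, div_eq_mul_inv, mul_comm, ← Real.rpow_neg two_pos.le]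
  refine mul_le_mul_of_nonneg_right ?_ (Real.rpow_nonneg h0.le _)
  calc (2 : ℝ) ^ (-(-2 * β)) ≤ 2 ^ (2 : ℝ) :=
        Real.rpow_le_rpow_of_exponent_le one_le_two (by linarith)
    _ = 4 := by norm_num

theorem ofReal_setIntegral_ball {f : ℂ → ℝ} (hf : Continuous f) (h0 : ∀ z, 0 ≤ f z) (a : ℂ) (r : ℝ) :
    ENNReal.ofReal (∫ z in Metric.ball a r, f z) = ∫⁻ z in Metric.ball a r, ENNReal.ofReal (f z) := by
  have h1 : IntegrableOn f (Metric.closedBall a r) volume :=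
    hf.continuousOn.integrableOn_compact (isCompact_closedBall a r)
  exact ofReal_integral_eq_lintegral_ofReal (h1.mono_set Metric.ball_subset_closedBall)
    (Eventually.of_forall h0)

theorem ofReal_radialWeight_mul (β δ : ℝ) (hδ : 0 < δ) (z w : ℂ) :
    ENNReal.ofReal (radialWeight β δ ‖z‖ * ‖w‖ ^ 2) = diskWeight β δ z * ‖w‖ₑ ^ 2 := by
  rw [ENNReal.ofReal_mul (radialWeight_nonneg β hδ _), ENNReal.ofReal_pow (norm_nonneg _),
    ofReal_norm, diskWeight]

theorem exists_weighted_energy_lintegral_le {β : ℝ} (hβ0 : 0 < β) (hβ1 : β < 1) :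
    ∃ c C : ℝ, 0 < c ∧ 0 < C ∧ ∀ (ψ : ℂ → ℂ), ContDiff ℝ 2 ψ → ∀ (a : ℂ) (δ R : ℝ), 0 < δ → δ ≤ R →
      ENNReal.ofReal c * ∫⁻ z in Metric.ball a R, diskWeight β δ (z - a) * ‖wirtingerDz ψ z‖ₑ ^ 2 ≤
        ENNReal.ofReal (R ^ (-2 * β)) * (∫⁻ z in Metric.ball a R, ‖wirtingerDz ψ z‖ₑ ^ 2) +
        ENNReal.ofReal C *
          ∫⁻ z in Metric.ball a R, diskWeight β δ (z - a) * ‖wirtingerDbar ψ z‖ₑ ^ 2 := by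
  obtain ⟨c, C, hc, hC, h⟩ := exists_weighted_energy_le hβ0 hβ1
  refine ⟨c, C, hc, hC, fun ψ hψ a δ R hδ hδR => ?_⟩
  have hcz := continuous_wirtingerDz (hψ.of_le one_le_two)
  have hcb := continuous_wirtingerDbar (hψ.of_le one_le_two)
  have hw := continuous_radialWeight β hδ
  have h1 := ENNReal.ofReal_le_ofReal (h ψ hψ a δ R hδ hδR)
  have hn : ∀ f : ℂ → ℝ, (∀ z, 0 ≤ f z) → 0 ≤ ∫ z in Metric.ball a R, f z :=
    fun f hf => integral_nonneg hf
  have hw0 : ∀ (f : ℂ → ℂ) (z : ℂ), 0 ≤ radialWeight β δ ‖z - a‖ * ‖f z‖ ^ 2 := fun f z =>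
    mul_nonneg (radialWeight_nonneg β hδ _) (sq_nonneg _)
  have hR : 0 ≤ R ^ (-2 * β) := Real.rpow_nonneg (hδ.le.trans hδR) _
  rw [ENNReal.ofReal_mul hc.le, ENNReal.ofReal_add (mul_nonneg hR (hn _ fun z => sq_nonneg _))
    (mul_nonneg hC.le (hn _ (hw0 _))), ENNReal.ofReal_mul hR, ENNReal.ofReal_mul hC.le,
    ofReal_setIntegral_ball (by fun_prop) (hw0 _), ofReal_setIntegral_ball (by fun_prop) (hw0 _),
    ofReal_setIntegral_ball (by fun_prop) fun z => sq_nonneg _] at h1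
  simpa only [ofReal_radialWeight_mul β δ hδ, ENNReal.ofReal_pow (norm_nonneg _), ofReal_norm] using h1

/-- The complex derivative `∂_z` from the derivatives in the coordinate directions. -/
def coordDz (gx gy : ℂ → ℂ) (z : ℂ) : ℂ := (gx z - Complex.I * gy z) / 2

/-- The complex derivative `∂_{z̄}` from the derivatives in the coordinate directions. -/
def coordDbar (gx gy : ℂ → ℂ) (z : ℂ) : ℂ := (gx z + Complex.I * gy z) / 2

/-- A globally defined locally integrable function with square integrable weak derivatives and small
complex dilatation on an open set. -/
structure SobolevData (φ gx gy : ℂ → ℂ) (O : Set ℂ) (k : ℝ) : Prop where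
  locallyIntegrable : LocallyIntegrable φ
  measurable_x : Measurable gx
  measurable_y : Measurable gy
  memLp_x : MemLp gx 2
  memLp_y : MemLp gy 2
  weak_x : HasWeakDeriv φ O 1 gx
  weak_y : HasWeakDeriv φ O Complex.I gy
  nonneg : 0 ≤ k
  dilatation : ∀ᵐ z, ‖coordDbar gx gy z‖ ≤ k * ‖coordDz gx gy z‖

namespace SobolevData

variable {φ gx gy : ℂ → ℂ} {O : Set ℂ} {k : ℝ}

theorem measurable_dz (h : SobolevData φ gx gy O k) : Measurable (coordDz gx gy) := by
  have := h.measurable_x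
  have := h.measurable_y
  unfold coordDz
  fun_prop

theorem measurable_dbar (h : SobolevData φ gx gy O k) : Measurable (coordDbar gx gy) := by
  have := h.measurable_x
  have := h.measurable_y
  unfold coordDbar
  fun_prop

theorem memLp_dz (h : SobolevData φ gx gy O k) : MemLp (coordDz gx gy) 2 := by
  have h1 := (h.memLp_x.sub (h.memLp_y.const_mul Complex.I)).const_mul (1 / 2 : ℂ)
  refine h1.ae_eq (Eventually.of_forall fun z => ?_)
  simp only [coordDz, Pi.sub_apply]
  ring

theorem energy_ne_top (h : SobolevData φ gx gy O k) : ∫⁻ z, ‖coordDz gx gy z‖ₑ ^ 2 ≠ ⊤ := by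
  have h5 := eLpNorm_nnreal_pow_eq_lintegral (μ := volume) (p := 2) (f := coordDz gx gy) (by norm_num)
  simp only [NNReal.coe_ofNat, ENNReal.coe_ofNat, ENNReal.rpow_ofNat] at h5
  rw [← h5]
  exact ENNReal.pow_ne_top h.memLp_dz.eLpNorm_ne_top

theorem lintegral_mul_dbar_le (h : SobolevData φ gx gy O k) (V : ℂ → ℝ≥0∞) :
    ∫⁻ z, V z * ‖coordDbar gx gy z‖ₑ ^ 2 ≤
      ENNReal.ofReal (k ^ 2) * ∫⁻ z, V z * ‖coordDz gx gy z‖ₑ ^ 2 := by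
  rw [← lintegral_const_mul' _ _ ENNReal.ofReal_ne_top]
  refine lintegral_mono_ae (h.dilatation.mono fun z hz => ?_)
  have h1 : ‖coordDbar gx gy z‖ₑ ≤ ENNReal.ofReal k * ‖coordDz gx gy z‖ₑ := by
    rw [← ofReal_norm, ← ofReal_norm, ← ENNReal.ofReal_mul h.nonneg]
    exact ENNReal.ofReal_le_ofReal hz
  calc V z * ‖coordDbar gx gy z‖ₑ ^ 2 ≤ V z * (ENNReal.ofReal k * ‖coordDz gx gy z‖ₑ) ^ 2 := by gcongr
    _ = _ := by rw [ENNReal.ofReal_pow h.nonneg]; ring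

theorem wirtingerDz_mollify (h : SobolevData φ gx gy O k) (ρ : ContDiffBump (0 : ℂ)) {y : ℂ}
    (hy : Metric.closedBall y ρ.rOut ⊆ O) :
    wirtingerDz (mollify ρ φ) y = mollify ρ (coordDz gx gy) y :=
  CircleDynamics.wirtingerDz_mollify ρ h.locallyIntegrable (h.memLp_x.locallyIntegrable one_le_two)
    (h.memLp_y.locallyIntegrable one_le_two) h.weak_x h.weak_y hy

theorem wirtingerDbar_mollify (h : SobolevData φ gx gy O k) (ρ : ContDiffBump (0 : ℂ)) {y : ℂ}
    (hy : Metric.closedBall y ρ.rOut ⊆ O) :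
    wirtingerDbar (mollify ρ φ) y = mollify ρ (coordDbar gx gy) y :=
  CircleDynamics.wirtingerDbar_mollify ρ h.locallyIntegrable (h.memLp_x.locallyIntegrable one_le_two)
    (h.memLp_y.locallyIntegrable one_le_two) h.weak_x h.weak_y hy

/-- Apply the smooth inequality to mollifications. The `∂_{z̄}` term is at most `4 C k²` times the
weighted energy, hence absorbed into the left side when `k` is small. The bound does not depend on
the truncation `δ`. -/
theorem weighted_energy_le (h : SobolevData φ gx gy O k) {β c C : ℝ} (hβ0 : 0 < β) (hβ1 : β < 1)
    (hc : 0 < c) (hC : 0 < C)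
    (hcC : ∀ (ψ : ℂ → ℂ), ContDiff ℝ 2 ψ → ∀ (a : ℂ) (δ R : ℝ), 0 < δ → δ ≤ R →
      ENNReal.ofReal c * ∫⁻ z in Metric.ball a R, diskWeight β δ (z - a) * ‖wirtingerDz ψ z‖ₑ ^ 2 ≤
        ENNReal.ofReal (R ^ (-2 * β)) * (∫⁻ z in Metric.ball a R, ‖wirtingerDz ψ z‖ₑ ^ 2) +
        ENNReal.ofReal C *
          ∫⁻ z in Metric.ball a R, diskWeight β δ (z - a) * ‖wirtingerDbar ψ z‖ₑ ^ 2)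
    (hk : C * (4 * k ^ 2) ≤ c / 2) {a : ℂ} {δ R : ℝ} (hδ : 0 < δ) (hδR : δ ≤ R)
    (ha : Metric.closedBall a (2 * R) ⊆ O) :
    ∫⁻ z, diskWeight β δ (z - a) * ‖coordDz gx gy z‖ₑ ^ 2 ≤
      ENNReal.ofReal (2 * (1 + c) / c * R ^ (-2 * β)) * ∫⁻ z, ‖coordDz gx gy z‖ₑ ^ 2 := by
  have hR : 0 < R := hδ.trans_le hδR
  set E := ∫⁻ z, ‖coordDz gx gy z‖ₑ ^ 2 with hE
  set Y := ∫⁻ z, diskWeight β δ (z - a) * ‖coordDz gx gy z‖ₑ ^ 2 with hY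
  set q := R ^ (-2 * β) with hq
  have hq0 : 0 ≤ q := Real.rpow_nonneg hR.le _
  have hW : Measurable fun z => diskWeight β δ (z - a) :=
    (measurable_diskWeight β hδ).comp (measurable_id.sub_const a)
  have hmz := h.measurable_dz
  have hEt : E ≠ ⊤ := h.energy_ne_top
  -- Finiteness, without which absorption is meaningless, is where the truncation of the weight is
  -- needed: it is bounded by `δ^{-2β}`.
  have hYt : Y ≠ ⊤ := by
    refine ne_top_of_le_ne_top (ENNReal.mul_ne_top (ENNReal.ofReal_ne_top (r := δ ^ (-2 * β))) hEt) ?_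
    rw [hE, ← lintegral_const_mul' _ _ ENNReal.ofReal_ne_top]
    exact lintegral_mono fun z => mul_le_mul_left (diskWeight_le_of_le hβ0 hδ (le_max_right _ _)) _
  set X := ∫⁻ z in Metric.ball a R, diskWeight β δ (z - a) * ‖coordDz gx gy z‖ₑ ^ 2 with hX
  -- Outside the disc the weight is at most `R^{-2β}`.
  have hYX : Y ≤ X + ENNReal.ofReal q * E := by
    rw [hY, ← lintegral_add_compl _ (measurableSet_ball (x := a) (ε := R))]
    refine add_le_add le_rfl ?_
    refine le_trans ?_ (mul_le_mul_right (setLIntegral_le_lintegral (Metric.ball a R)ᶜ _) _)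
    rw [← lintegral_const_mul' _ _ ENNReal.ofReal_ne_top]
    refine setLIntegral_mono' measurableSet_ball.compl fun z hz => mul_le_mul_left ?_ _
    refine diskWeight_le_of_le hβ0 hR (le_max_of_le_left ?_)
    rwa [mem_compl_iff, mem_ball_iff_norm, not_lt] at hz
  let ρ : ℕ → ContDiffBump (0 : ℂ) := fun n =>
    ⟨δ / (n + 1) / 2, δ / (n + 1), by positivity, half_lt_self (by positivity)⟩
  have hρδ : ∀ n, (ρ n).rOut ≤ δ := fun n => div_le_self hδ.le (by
    have : (0 : ℝ) ≤ n := n.cast_nonneg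
    linarith)
  have hρ0 : Tendsto (fun n => (ρ n).rOut) atTop (𝓝 0) := by
    have := (tendsto_one_div_add_atTop_nhds_zero_nat (𝕜 := ℝ)).const_mul δ
    simpa only [mul_one_div, mul_zero] using this
  have hXn : ∀ n, ENNReal.ofReal c * ∫⁻ z in Metric.ball a R,
      diskWeight β δ (z - a) * ‖mollify (ρ n) (coordDz gx gy) z‖ₑ ^ 2 ≤
      ENNReal.ofReal q * E + ENNReal.ofReal (c / 2) * Y := by
    intro n
    have h1 := hcC (mollify (ρ n) φ) (contDiff_mollify (ρ n) h.locallyIntegrable (n := 2)) a δ R hδ hδR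
    have hsub : ∀ z ∈ Metric.ball a R, Metric.closedBall z (ρ n).rOut ⊆ O := by
      intro z hz
      refine (Metric.closedBall_subset_closedBall' ?_).trans ha
      have := hρδ n
      rw [Metric.mem_ball] at hz
      linarith
    have ez : ∀ V : ℂ → ℝ≥0∞, ∫⁻ z in Metric.ball a R, V z * ‖wirtingerDz (mollify (ρ n) φ) z‖ₑ ^ 2 =
        ∫⁻ z in Metric.ball a R, V z * ‖mollify (ρ n) (coordDz gx gy) z‖ₑ ^ 2 := fun V =>
      setLIntegral_congr_fun measurableSet_ball fun z hz => by
        simp only [h.wirtingerDz_mollify (ρ n) (hsub z hz)]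
    have eb : ∀ V : ℂ → ℝ≥0∞, ∫⁻ z in Metric.ball a R, V z * ‖wirtingerDbar (mollify (ρ n) φ) z‖ₑ ^ 2 =
        ∫⁻ z in Metric.ball a R, V z * ‖mollify (ρ n) (coordDbar gx gy) z‖ₑ ^ 2 := fun V =>
      setLIntegral_congr_fun measurableSet_ball fun z hz => by
        simp only [h.wirtingerDbar_mollify (ρ n) (hsub z hz)]
    have e1 := ez fun _ => 1
    simp only [one_mul] at e1
    rw [ez, eb, e1] at h1
    refine h1.trans (add_le_add (mul_le_mul_right ?_ _) ?_)
    · refine (setLIntegral_le_lintegral _ _).trans ?_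
      have h2 := lintegral_mul_enorm_mollify_sq_le (ρ n) hmz (V := fun _ => 1) measurable_const (M := E)
        (fun t _ => by simp only [one_mul]; exact le_rfl)
      simpa only [one_mul] using h2
    · have h2 : ∫⁻ z in Metric.ball a R, diskWeight β δ (z - a) *
          ‖mollify (ρ n) (coordDbar gx gy) z‖ₑ ^ 2 ≤ 4 * (ENNReal.ofReal (k ^ 2) * Y) := by
        refine (setLIntegral_le_lintegral _ _).trans ?_
        refine lintegral_mul_enorm_mollify_sq_le (ρ n) h.measurable_dbar hW fun t ht => ?_
        refine le_trans ?_ (mul_le_mul_right (h.lintegral_mul_dbar_le _) _)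
        rw [← lintegral_const_mul' _ _ (by norm_num)]
        refine lintegral_mono fun z => ?_
        rw [← mul_assoc]
        refine mul_le_mul_left ?_ _
        rw [add_sub_right_comm]
        exact diskWeight_add_le hβ0 hβ1 hδ _ (ht.le.trans (hρδ n))
      refine (mul_le_mul_right h2 _).trans ?_
      rw [← mul_assoc, ← mul_assoc]
      refine mul_le_mul_left ?_ _
      rw [show (4 : ℝ≥0∞) = ENNReal.ofReal 4 by simp, ← ENNReal.ofReal_mul hC.le,
        ← ENNReal.ofReal_mul (by positivity)]
      exact ENNReal.ofReal_le_ofReal (by linarith)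
  -- The mollified derivatives converge almost everywhere, so Fatou's lemma passes the uniform bound
  -- to the limit.
  have hXle : ENNReal.ofReal c * X ≤ ENNReal.ofReal q * E + ENNReal.ofReal (c / 2) * Y := by
    have hae := ContDiffBump.ae_convolution_tendsto_right_of_locallyIntegrable (K := 2) hρ0
      (Eventually.of_forall fun n => by
        change δ / (n + 1) ≤ 2 * (δ / (n + 1) / 2)
        linarith) (h.memLp_dz.locallyIntegrable one_le_two)
    have hm : ∀ n, Measurable (mollify (ρ n) (coordDz gx gy)) := fun n =>
      (contDiff_mollify (ρ n) (h.memLp_dz.locallyIntegrable one_le_two) (n := 0)).continuous.measurable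
    rw [hX, ← lintegral_const_mul' _ _ ENNReal.ofReal_ne_top]
    calc ∫⁻ z in Metric.ball a R, ENNReal.ofReal c * (diskWeight β δ (z - a) * ‖coordDz gx gy z‖ₑ ^ 2)
        ≤ ∫⁻ z in Metric.ball a R, liminf (fun n => ENNReal.ofReal c *
            (diskWeight β δ (z - a) * ‖mollify (ρ n) (coordDz gx gy) z‖ₑ ^ 2)) atTop := by
          refine lintegral_mono_ae ((ae_restrict_of_ae hae).mono fun z hz => ?_)
          refine le_of_eq (Tendsto.liminf_eq ?_).symm
          refine ENNReal.Tendsto.const_mul (ENNReal.Tendsto.const_mul (((ENNReal.continuous_pow 2).tendsto _).comp hz.enorm)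
            (Or.inr ENNReal.ofReal_ne_top)) (Or.inr ENNReal.ofReal_ne_top)
      _ ≤ liminf (fun n => ∫⁻ z in Metric.ball a R, ENNReal.ofReal c *
            (diskWeight β δ (z - a) * ‖mollify (ρ n) (coordDz gx gy) z‖ₑ ^ 2)) atTop :=
          lintegral_liminf_le fun n => measurable_const.mul (hW.mul ((hm n).enorm.pow_const 2))
      _ ≤ liminf (fun _ : ℕ => ENNReal.ofReal q * E + ENNReal.ofReal (c / 2) * Y) atTop := by
          refine liminf_le_liminf (Eventually.of_forall fun n => ?_)
          rw [lintegral_const_mul' _ _ ENNReal.ofReal_ne_top]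
          exact hXn n
      _ = _ := liminf_const _
  have hfin : ENNReal.ofReal c * Y ≤
      ENNReal.ofReal c * (ENNReal.ofReal q * E) + (ENNReal.ofReal q * E + ENNReal.ofReal (c / 2) * Y) := by
    refine (mul_le_mul_right hYX _).trans ?_
    rw [mul_add, add_comm]
    gcongr
  rw [← ENNReal.ofReal_toReal hEt, ← ENNReal.ofReal_toReal hYt] at hfin ⊢
  have he := ENNReal.toReal_nonneg (a := E)
  have hy := ENNReal.toReal_nonneg (a := Y)
  rw [← ENNReal.ofReal_mul hc.le, ← ENNReal.ofReal_mul hq0, ← ENNReal.ofReal_mul hc.le,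
    ← ENNReal.ofReal_mul (by positivity), ← ENNReal.ofReal_add (by positivity) (by positivity),
    ← ENNReal.ofReal_add (by positivity) (by positivity),
    ENNReal.ofReal_le_ofReal_iff (by positivity)] at hfin
  rw [← ENNReal.ofReal_mul (by positivity)]
  refine ENNReal.ofReal_le_ofReal ?_
  rw [div_mul_eq_mul_div, div_mul_eq_mul_div, le_div_iff₀ hc]
  linarith

/-- For `k ≤ 1` both complex derivatives have weighted energy at most `M`, uniformly in the centre,
and `(x + y)² ≤ 2x² + 2y²` gives `4M`. The radius `3R` leaves room to move the centre by a
mollification shift and still apply the bound with `2R`. -/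
theorem integral_gradNorm_mollify_le (h : SobolevData φ gx gy O k) (hk1 : k ≤ 1) {β R : ℝ} {M : ℝ≥0∞}
    (hM : M ≠ ⊤) (hMle : ∀ (a : ℂ) (δ : ℝ), 0 < δ → δ ≤ R → Metric.closedBall a (2 * R) ⊆ O →
      ∫⁻ z, diskWeight β δ (z - a) * ‖coordDz gx gy z‖ₑ ^ 2 ≤ M) {a : ℂ} {r δ : ℝ} (hδ : 0 < δ)
    (hδr : δ ≤ r) (hr : r ≤ R) (ha : Metric.closedBall a (3 * R) ⊆ O) (ρ : ContDiffBump (0 : ℂ))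
    (hρ : ρ.rOut ≤ R) :
    ∫ z in Metric.ball a r, radialWeight β δ ‖z - a‖ * gradNorm (mollify ρ φ) z ^ 2 ≤
      4 * M.toReal := by
  have hψ : ContDiff ℝ 1 (mollify ρ φ) := contDiff_mollify ρ h.locallyIntegrable (n := 1)
  have hcg := continuous_gradNorm hψ
  have hw := continuous_radialWeight β hδ
  have hW : Measurable fun z => diskWeight β δ (z - a) :=
    (measurable_diskWeight β hδ).comp (measurable_id.sub_const a)
  have hzM : ∀ t : ℂ, ‖t‖ < ρ.rOut →
      ∫⁻ z, diskWeight β δ (z + t - a) * ‖coordDz gx gy z‖ₑ ^ 2 ≤ M := by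
    intro t ht
    have h1 := hMle (a - t) δ hδ (hδr.trans hr) ((Metric.closedBall_subset_closedBall' (by
      rw [dist_eq_norm, sub_sub_cancel_left, norm_neg]
      linarith)).trans ha)
    refine le_trans (le_of_eq ?_) h1
    refine lintegral_congr fun z => ?_
    rw [sub_sub_eq_add_sub]
  have hz := lintegral_mul_enorm_mollify_sq_le ρ h.measurable_dz hW hzM
  have hb := lintegral_mul_enorm_mollify_sq_le ρ h.measurable_dbar hW fun t ht =>
    (h.lintegral_mul_dbar_le _).trans ((mul_le_mul_left (ENNReal.ofReal_le_one.2
      (pow_le_one₀ h.nonneg hk1)) _).trans ((one_mul _).trans_le (hzM t ht)))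
  have hmz : Measurable (mollify ρ (coordDz gx gy)) :=
    (contDiff_mollify ρ (h.memLp_dz.locallyIntegrable one_le_two) (n := 0)).continuous.measurable
  have hsub : ∀ z ∈ Metric.ball a r, Metric.closedBall z ρ.rOut ⊆ O := by
    intro z hz
    refine (Metric.closedBall_subset_closedBall' ?_).trans ha
    rw [Metric.mem_ball] at hz
    linarith
  rw [← ENNReal.ofReal_le_ofReal_iff (by positivity), ofReal_setIntegral_ball (by fun_prop)
    fun z => mul_nonneg (radialWeight_nonneg β hδ _) (sq_nonneg _)]
  calc ∫⁻ z in Metric.ball a r,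
        ENNReal.ofReal (radialWeight β δ ‖z - a‖ * gradNorm (mollify ρ φ) z ^ 2)
      ≤ ∫⁻ z in Metric.ball a r, (2 * (diskWeight β δ (z - a) * ‖mollify ρ (coordDz gx gy) z‖ₑ ^ 2) +
          2 * (diskWeight β δ (z - a) * ‖mollify ρ (coordDbar gx gy) z‖ₑ ^ 2)) := by
        refine setLIntegral_mono' measurableSet_ball fun z hz => ?_
        rw [gradNorm, h.wirtingerDz_mollify ρ (hsub z hz), h.wirtingerDbar_mollify ρ (hsub z hz),
          ← ofReal_radialWeight_mul β δ hδ, ← ofReal_radialWeight_mul β δ hδ,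
          show (2 : ℝ≥0∞) = ENNReal.ofReal 2 by simp, ← ENNReal.ofReal_mul two_pos.le,
          ← ENNReal.ofReal_mul two_pos.le]
        have hw0 := radialWeight_nonneg β hδ ‖z - a‖
        rw [← ENNReal.ofReal_add (by positivity) (by positivity)]
        refine ENNReal.ofReal_le_ofReal ?_
        have h3 : 0 ≤ radialWeight β δ ‖z - a‖ *
            (‖mollify ρ (coordDz gx gy) z‖ - ‖mollify ρ (coordDbar gx gy) z‖) ^ 2 := by positivity
        linarith
    _ ≤ ∫⁻ z, (2 * (diskWeight β δ (z - a) * ‖mollify ρ (coordDz gx gy) z‖ₑ ^ 2) +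
          2 * (diskWeight β δ (z - a) * ‖mollify ρ (coordDbar gx gy) z‖ₑ ^ 2)) :=
        setLIntegral_le_lintegral _ _
    _ ≤ 2 * M + 2 * M := by
        have hm : Measurable fun z =>
            2 * (diskWeight β δ (z - a) * ‖mollify ρ (coordDz gx gy) z‖ₑ ^ 2) :=
          (hW.mul (hmz.enorm.pow_const 2)).const_mul 2
        rw [lintegral_add_left hm,
          lintegral_const_mul' _ _ (by norm_num), lintegral_const_mul' _ _ (by norm_num)]
        gcongr
    _ = ENNReal.ofReal (4 * M.toReal) := by
        rw [ENNReal.ofReal_mul (by norm_num), ENNReal.ofReal_toReal hM]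
        simp only [ENNReal.ofReal_ofNat]
        ring

/-- Local Hölder continuity of functions of small complex dilatation. -/
theorem exists_norm_sub_le {β : ℝ} (hβ0 : 0 < β) (hβ1 : β < 1) : ∃ k₀ : ℝ, 0 < k₀ ∧ k₀ < 1 ∧
    ∀ {φ gx gy : ℂ → ℂ} {O : Set ℂ} {k : ℝ}, SobolevData φ gx gy O k → k < k₀ →
    ∀ R : ℝ, 0 < R → ∃ K : ℝ, ∀ a b : ℂ, ContinuousAt φ a → ContinuousAt φ b → ‖a - b‖ ≤ R →
      Metric.closedBall a (3 * R) ⊆ O → Metric.closedBall b (3 * R) ⊆ O →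
      ‖φ a - φ b‖ ≤ K * ‖a - b‖ ^ β := by
  obtain ⟨c, C, hc, hC, hcC⟩ := exists_weighted_energy_lintegral_le hβ0 hβ1
  have hq : 0 < c / (8 * C) := by positivity
  -- For `k < 1 / 2` one has `k² ≤ k`, so `k < c / (8C)` gives `4 C k² ≤ c / 2`, the absorption
  -- condition.
  refine ⟨min (1 / 2) (c / (8 * C)), by positivity, by
    have := min_le_left (1 / 2 : ℝ) (c / (8 * C)); linarith, ?_⟩
  intro φ gx gy O k h hk R hR
  have hk1 : k < 1 / 2 := hk.trans_le (min_le_left _ _)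
  have hk2 : k < c / (8 * C) := hk.trans_le (min_le_right _ _)
  have hk3 : C * (4 * k ^ 2) ≤ c / 2 := by
    rw [lt_div_iff₀ (by positivity)] at hk2
    have h0 := h.nonneg
    have h1 : k ^ 2 ≤ k := by
      rw [sq]
      exact mul_le_of_le_one_left h0 (by linarith)
    have h2 : C * k ^ 2 ≤ C * k := by gcongr
    linarith
  set M : ℝ≥0∞ := ENNReal.ofReal (2 * (1 + c) / c * R ^ (-2 * β)) * ∫⁻ z, ‖coordDz gx gy z‖ₑ ^ 2
  have hM : M ≠ ⊤ := ENNReal.mul_ne_top ENNReal.ofReal_ne_top h.energy_ne_top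
  refine ⟨4 / Real.pi * (4 * M.toReal / 2 + Real.pi / (2 * β)), fun a b hφa hφb hab ha hb => ?_⟩
  rcases eq_or_ne a b with rfl | hne
  · simp [Real.zero_rpow hβ0.ne']
  have hr : 0 < ‖a - b‖ := norm_pos_iff.2 (sub_ne_zero.2 hne)
  let ρ : ℕ → ContDiffBump (0 : ℂ) := fun n =>
    ⟨R / (n + 1) / 2, R / (n + 1), by positivity, half_lt_self (by positivity)⟩
  have hρR : ∀ n, (ρ n).rOut ≤ R := fun n => div_le_self hR.le (by
    have : (0 : ℝ) ≤ n := n.cast_nonneg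
    linarith)
  have hρ0 : Tendsto (fun n => (ρ n).rOut) atTop (𝓝 0) := by
    have := (tendsto_one_div_add_atTop_nhds_zero_nat (𝕜 := ℝ)).const_mul R
    simpa only [mul_one_div, mul_zero] using this
  have hlim : ∀ x, ContinuousAt φ x → Tendsto (fun n => mollify (ρ n) φ x) atTop (𝓝 (φ x)) :=
    fun x hx => ContDiffBump.convolution_tendsto_right hρ0
      (Eventually.of_forall fun _ => h.locallyIntegrable.aestronglyMeasurable)
      (hx.tendsto.comp tendsto_snd) tendsto_const_nhds
  refine le_of_tendsto ((hlim a hφa).sub (hlim b hφb)).norm (Eventually.of_forall fun n => ?_)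
  have hψ : ContDiff ℝ 1 (mollify (ρ n) φ) := contDiff_mollify (ρ n) h.locallyIntegrable (n := 1)
  have key : ∀ x, Metric.closedBall x (3 * R) ⊆ O → _ := fun x hx =>
    integral_gradNorm_le hψ x hβ0 hr fun δ hδ hδr =>
      h.integral_gradNorm_mollify_le (by linarith) hM
        (fun a δ hδ hδR ha => h.weighted_energy_le hβ0 hβ1 hc hC hcC hk3 hδ hδR ha)
        hδ hδr hab hx (ρ n) (hρR n)
  refine (norm_sub_le_of_gradNorm hψ hr rfl (key a ha) (key b hb)).trans (le_of_eq ?_)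
  ring

end SobolevData

/-! ### Boundary dilatation one implies Hölder continuity -/

/-- Cutting off at a compact set makes the function and its derivatives global without affecting the
weak derivatives in the interior, as test functions supported there do not see the cut. Measurable
representatives replace the given derivatives. -/
theorem IsQuasiconformalOn.exists_sobolevData {φ : ℂ → ℂ} {U : Set ℂ} {k : ℝ}
    (h : IsQuasiconformalOn φ U k) {N : Set ℂ} (hN : IsCompact N) (hNU : N ⊆ U) :
    ∃ gx gy : ℂ → ℂ, SobolevData (N.indicator φ) gx gy (interior N) k := by
  obtain ⟨φx, φy, hL, hx, hy, hd⟩ := h.dilatation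
  obtain ⟨hLx, hLy⟩ := hL N hNU hN
  have hNm : MeasurableSet N := hN.measurableSet
  have hφ : ContinuousOn φ N :=
    (continuousOn_iff_continuous_domRestrict.2 h.embedding.continuous).mono hNU
  have hweak : ∀ (v : ℂ) (f : ℂ → ℂ) (hf : AEStronglyMeasurable f (volume.restrict N)),
      HasWeakDeriv φ U v f →
      HasWeakDeriv (N.indicator φ) (interior N) v (N.indicator (hf.mk f)) := by
    intro v f hf hw χ hχ hc hs
    have h1 := hw χ hχ hc (hs.trans (interior_subset.trans hNU))
    have h2 : ∀ z ∉ N, χ z = 0 := fun z hz => by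
      by_contra h0
      exact hz (interior_subset (hs (subset_tsupport χ h0)))
    have h3 : ∀ z ∉ N, fderiv ℝ χ z v = 0 := fun z hz => by
      have : fderiv ℝ χ z = 0 := by
        by_contra h0
        exact hz (interior_subset (hs (support_fderiv_subset ℝ h0)))
      rw [this]; rfl
    have e1 : ∀ z, fderiv ℝ χ z v • N.indicator φ z = fderiv ℝ χ z v • φ z := fun z => by
      by_cases hz : z ∈ N
      · rw [indicator_of_mem hz]
      · rw [h3 z hz, zero_smul, zero_smul]
    simp only [e1]
    rw [h1]
    congr 1
    refine integral_congr_ae ?_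
    have h4 := (ae_restrict_iff' hNm).1 hf.ae_eq_mk
    filter_upwards [h4] with z hz
    by_cases hzN : z ∈ N
    · rw [indicator_of_mem hzN, hz hzN]
    · rw [h2 z hzN, zero_smul, zero_smul]
  have hmem : ∀ (f : ℂ → ℂ) (hf : MemLp f 2 (volume.restrict N)),
      MemLp (N.indicator (hf.1.mk f)) 2 := fun f hf =>
    (memLp_indicator_iff_restrict hNm).2 (hf.ae_eq hf.1.ae_eq_mk)
  refine ⟨N.indicator (hLx.1.mk φx), N.indicator (hLy.1.mk φy), ?_,
    hLx.1.stronglyMeasurable_mk.measurable.indicator hNm,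
    hLy.1.stronglyMeasurable_mk.measurable.indicator hNm, hmem φx hLx, hmem φy hLy,
    hweak 1 φx hLx.1 hx, hweak Complex.I φy hLy.1 hy, h.nonneg, ?_⟩
  · have h1 : IntegrableOn φ N volume := hφ.integrableOn_compact hN
    exact ((integrable_indicator_iff hNm).2 h1).locallyIntegrable
  · have h1 := (ae_restrict_iff' hNm).1 hLx.1.ae_eq_mk
    have h2 := (ae_restrict_iff' hNm).1 hLy.1.ae_eq_mk
    have h3 := (ae_restrict_iff' h.isOpen.measurableSet).1 hd
    filter_upwards [h1, h2, h3] with z z1 z2 z3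
    by_cases hz : z ∈ N
    · simp only [coordDz, coordDbar, indicator_of_mem hz, ← z1 hz, ← z2 hz]
      exact z3 (hNU hz)
    · simp [coordDz, coordDbar, indicator_of_notMem hz]

/-! ### Chords and arcs of the circle -/

theorem norm_circleCover (x : ℝ) : ‖circleCover x‖ = 1 := by
  rw [circleCover, Complex.norm_exp]
  simp

theorem norm_circleCover_sub (x y : ℝ) :
    ‖circleCover x - circleCover y‖ = 2 * |Real.sin (Real.pi * (x - y))| := by
  have e : circleCover x - circleCover y =
      circleCover y * (Complex.exp (Complex.I * ((2 * Real.pi * (x - y) : ℝ) : ℂ)) - 1) := by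
    rw [circleCover, circleCover, mul_sub, ← Complex.exp_add, mul_one]
    congr 2
    push_cast
    ring
  rw [e, norm_mul, norm_circleCover, one_mul, Complex.norm_exp_I_mul_ofReal_sub_one, norm_mul,
    Real.norm_eq_abs, Real.norm_eq_abs, abs_two]
  congr 3
  ring

theorem norm_circleCover_sub_le (x y : ℝ) :
    ‖circleCover x - circleCover y‖ ≤ 2 * Real.pi * |x - y| := by
  rw [norm_circleCover_sub, mul_assoc]
  refine mul_le_mul_of_nonneg_left ?_ two_pos.le
  refine Real.abs_sin_le_abs.trans (le_of_eq ?_)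
  rw [abs_mul, abs_of_pos Real.pi_pos]

theorem le_norm_circleCover_sub {x y : ℝ} (h : |x - y| ≤ 1 / 2) :
    4 * |x - y| ≤ ‖circleCover x - circleCover y‖ := by
  have hpi := Real.pi_pos
  have h1 := Real.mul_le_sin (x := Real.pi * |x - y|) (by positivity) (by nlinarith)
  have h2 : 2 / Real.pi * (Real.pi * |x - y|) = 2 * |x - y| := by field_simp
  rw [norm_circleCover_sub]
  have h3 : |Real.sin (Real.pi * (x - y))| = |Real.sin (Real.pi * |x - y|)| := by
    rcases abs_choice (x - y) with h0 | h0 <;> rw [h0]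
    rw [mul_neg, Real.sin_neg, abs_neg]
  have h4 := le_abs_self (Real.sin (Real.pi * |x - y|))
  rw [h3]
  linarith

/-- An extension of dilatation below the threshold for `β` is locally `β`-Hölder near the circle,
and chords are comparable with short arcs. Distant points are handled by `|H x - H y| ≤ 1`. -/
theorem exists_holder_of_boundaryDilatation_eq_one {H : ℝ ≃o ℝ} (h : boundaryDilatation H = 1)
    (h1 : ∀ x, H (x + 1) = H x + 1) {β : ℝ} (hβ0 : 0 < β) (hβ1 : β < 1) :
    ∃ C, ∀ x ∈ Icc (0 : ℝ) 1, ∀ y ∈ Icc (0 : ℝ) 1, |H x - H y| ≤ C * |x - y| ^ β := by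
  obtain ⟨k₀, hk₀, hk₁, hK⟩ := SobolevData.exists_norm_sub_le hβ0 hβ1
  obtain ⟨U, φ, k, hk, hφ⟩ := exists_isQCExtension_of_boundaryDilatation_eq_one h hk₀ hk₁
  obtain ⟨ε, hε, hεU⟩ := (isCompact_sphere (0 : ℂ) 1).exists_cthickening_subset_open
    hφ.quasiconformal.isOpen hφ.circle_subset
  set N := Metric.cthickening ε (Metric.sphere (0 : ℂ) 1)
  have hN : IsCompact N := (isCompact_sphere (0 : ℂ) 1).cthickening
  obtain ⟨gx, gy, hS⟩ := hφ.quasiconformal.exists_sobolevData hN hεU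
  obtain ⟨K, hKab⟩ := hK hS hk (ε / 4) (by positivity)
  have hcirc : ∀ x, circleCover x ∈ Metric.sphere (0 : ℂ) 1 := fun x => by
    rw [mem_sphere_zero_iff_norm, norm_circleCover]
  have hball : ∀ x, Metric.closedBall (circleCover x) (3 * (ε / 4)) ⊆ interior N := fun x =>
    ((Metric.closedBall_subset_ball (by linarith)).trans
      (Metric.ball_subset_thickening (hcirc x) ε)).trans (Metric.thickening_subset_interior_cthickening _ _)
  have hmem : ∀ x, circleCover x ∈ interior N := fun x =>
    hball x (Metric.mem_closedBall_self (by positivity))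
  have hcont : ∀ x, ContinuousAt (N.indicator φ) (circleCover x) := fun x => by
    have h2 : ContinuousAt φ (circleCover x) :=
      (continuousOn_iff_continuous_domRestrict.2 hφ.quasiconformal.embedding.continuous).continuousAt
        (hφ.quasiconformal.isOpen.mem_nhds (hφ.circle_subset (hcirc x)))
    refine h2.congr ?_
    filter_upwards [isOpen_interior.mem_nhds (hmem x)] with z hz
    rw [indicator_of_mem (interior_subset hz)]
  have hval : ∀ x, N.indicator φ (circleCover x) = circleCover (H x) := fun x => by
    rw [indicator_of_mem (interior_subset (hmem x)), hφ.extends_map]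
  have hpi := Real.pi_pos
  -- Chords bound arcs only up to half a turn, so `x` and `y` must be close enough that `H x` and `H
  -- y` differ by less than `1 / 2`.
  obtain ⟨δ, hδ, hδH⟩ := Metric.uniformContinuousOn_iff.1
    (isCompact_Icc.uniformContinuousOn_of_continuous (s := Icc (0 : ℝ) 1) H.continuous.continuousOn)
    (1 / 2) (by norm_num)
  set η := min δ (ε / 4 / (2 * Real.pi)) with hη
  have hη0 : 0 < η := by positivity
  refine ⟨|K| * (2 * Real.pi) ^ β + (η ^ β)⁻¹, fun x hx y hy => ?_⟩
  have hp : 0 ≤ |x - y| ^ β := Real.rpow_nonneg (abs_nonneg _) _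
  have hq : 0 < η ^ β := Real.rpow_pos_of_pos hη0 _
  have hr : 0 ≤ (2 * Real.pi) ^ β := Real.rpow_nonneg (by positivity) _
  rw [add_mul]
  rcases lt_or_ge |x - y| η with hxy | hxy
  · have h2 := hδH x hx y hy (by rw [Real.dist_eq]; exact hxy.trans_le (min_le_left _ _))
    rw [Real.dist_eq] at h2
    have h3 := le_norm_circleCover_sub h2.le
    have h4 : ‖circleCover x - circleCover y‖ ≤ ε / 4 := by
      refine (norm_circleCover_sub_le x y).trans ?_
      have := hxy.le.trans (min_le_right _ _)
      rwa [le_div_iff₀ (by positivity), mul_comm] at this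
    have h5 := hKab _ _ (hcont x) (hcont y) h4 (hball x) (hball y)
    rw [hval, hval] at h5
    have h6 : ‖circleCover x - circleCover y‖ ^ β ≤ (2 * Real.pi) ^ β * |x - y| ^ β := by
      rw [← Real.mul_rpow (by positivity) (abs_nonneg _)]
      exact Real.rpow_le_rpow (norm_nonneg _) (norm_circleCover_sub_le x y) hβ0.le
    have h7 : K * ‖circleCover x - circleCover y‖ ^ β ≤ |K| * ((2 * Real.pi) ^ β * |x - y| ^ β) :=
      mul_le_mul (le_abs_self K) h6 (Real.rpow_nonneg (norm_nonneg _) _) (abs_nonneg K)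
    have h8 := abs_nonneg (H x - H y)
    have h9 : 0 ≤ (η ^ β)⁻¹ * |x - y| ^ β := by positivity
    linarith
  · have h2 : 1 ≤ (η ^ β)⁻¹ * |x - y| ^ β := by
      rw [inv_mul_eq_div, one_le_div hq]
      exact Real.rpow_le_rpow hη0.le hxy hβ0.le
    have h3 : |H x - H y| ≤ 1 := by
      have e := h1 0
      rw [zero_add] at e
      have a1 := H.monotone hx.1
      have a2 := H.monotone hx.2
      have a3 := H.monotone hy.1
      have a4 := H.monotone hy.2
      rw [abs_le]
      constructor <;> linarith
    have h4 : 0 ≤ |K| * (2 * Real.pi) ^ β * |x - y| ^ β := by positivity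
    linarith

/-! ### The Teichmüller space of marked circle endomorphisms -/

theorem IsC1Diffeo.deriv_ne_zero {H : ℝ ≃o ℝ} (h : IsC1Diffeo H) (x : ℝ) : deriv H x ≠ 0 := by
  intro h0
  have h1 := ((h.1.differentiable one_ne_zero) x).hasDerivAt
  have h2 := ((h.2.differentiable one_ne_zero) (H x)).hasDerivAt.comp x h1
  rw [h0, mul_zero] at h2
  have e : ⇑H.symm ∘ ⇑H = id := funext H.symm_apply_apply
  rw [e] at h2
  exact zero_ne_one (h2.unique (hasDerivAt_id x))

theorem teichEquiv_iff_dualDerivative_eq {d : ℕ} (hd : 2 ≤ d) (f g : MarkedMap d) :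
    TeichEquiv f g ↔ dualDerivative f.map.1 = dualDerivative g.map.1 := by
  obtain ⟨hf1, hf2⟩ := f.map.2
  obtain ⟨hg1, hg2⟩ := g.map.2
  have h := MarkedMap.isConj f g
  refine ⟨fun hT => h.dualDerivative_eq hf1 hf2 hg1 hg2
    ((hT.1.differentiable one_ne_zero) 0).hasDerivAt (hT.deriv_ne_zero 0), fun hD => ?_⟩
  obtain ⟨C, hC0, hC⟩ := IsConj.exists_markovLength_le_of_dualDerivative_eq hd hf1 hf2 hg1 hg2 hD
  exact IsConj.isC1Diffeo_of_markovLength_le hd h hf1 hf2 hg1 hg2 hC0 hC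

theorem teichDist_eq_zero_iff_boundaryDilatation {d : ℕ} (f g : MarkedMap d) :
    teichDist f g = 0 ↔ boundaryDilatation (f.conjugacy g) = 1 := by
  rw [teichDist, mul_eq_zero, ENNReal.log_eq_one_iff]
  refine or_iff_right ?_
  rw [EReal.coe_eq_zero]
  norm_num

/-- Boundary dilatation `1` makes the conjugacy Hölder of every exponent below `1`, hence Markov
lengths comparable, hence the conjugacy `C^1`; the converse is the explicit annulus extension. -/
theorem teichDist_eq_zero_iff {d : ℕ} (hd : 2 ≤ d) (f g : MarkedMap d) :
    teichDist f g = 0 ↔ TeichEquiv f g := by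
  rw [teichDist_eq_zero_iff_boundaryDilatation]
  obtain ⟨hf1, hf2⟩ := f.map.2
  obtain ⟨hg1, hg2⟩ := g.map.2
  have h := MarkedMap.isConj f g
  refine ⟨fun hB => ?_, fun hT => boundaryDilatation_eq_one _ h.map_add_one hT⟩
  obtain ⟨C, hC0, hC⟩ := h.exists_markovLength_le_of_holder hf1 hf2 hg1 hg2 fun β hβ =>
    exists_holder_of_boundaryDilatation_eq_one hB h.map_add_one hβ.1 hβ.2
  exact IsConj.isC1Diffeo_of_markovLength_le hd h hf1 hf2 hg1 hg2 hC0 hC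

/-- The dual derivative as a function on the Teichmüller space. -/
def teichDualDerivative {d : ℕ} (hd : 2 ≤ d) : TeichSpace d → HolderDualDerivatives d :=
  Quotient.lift (s := teichSetoid d)
    (fun f => ⟨dualDerivative f.map.1, isHolderDual f.map.2.1 f.map.2.2, f.map,
      hasDualDerivative f.map.2.1 f.map.2.2, rfl⟩)
    fun f g h => Subtype.ext ((teichEquiv_iff_dualDerivative_eq hd f g).1 h)

/-- Injectivity is the completeness of the dual derivative as an invariant; surjectivity only needs
every map to have a marking. -/
theorem bijective_teichDualDerivative {d : ℕ} (hd : 2 ≤ d) :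
    Function.Bijective (teichDualDerivative hd) := by
  constructor
  · rintro ⟨f⟩ ⟨g⟩ h
    exact Quotient.sound (s := teichSetoid d)
      ((teichEquiv_iff_dualDerivative_eq hd f g).2 (congrArg Subtype.val h))
  · rintro ⟨D, hD, F, hF, rfl⟩
    obtain ⟨H, hH⟩ := CircleEndo.exists_isMarking hd F.2.1 F.2.2
    exact ⟨Quotient.mk (teichSetoid d) ⟨F, H, hH⟩, rfl⟩

end CircleDynamics

end

theorem mainTheorem3 (d : ℕ) (hd : 2 ≤ d) :
    -- every map in the space has exactly one marking
    (∀ F : C1Plus d, ∃! H : ℝ ≃o ℝ, IsMarking F.1 H) ∧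
    -- its dual derivative exists, is positive and Hölder continuous
    (∀ F : C1Plus d, HasDualDerivative F.1 ∧ IsHolderDual (dualDerivative F.1)) ∧
    -- Teichmüller equivalence is equality of the dual derivatives
    (∀ f g : MarkedMap d,
      TeichEquiv f g ↔ dualDerivative f.map.1 = dualDerivative g.map.1) ∧
    -- the Teichmüller distance separates points, whichever representatives are used
    (∀ (P P' : TeichSpace d) (f g : MarkedMap d),
      Quotient.mk (teichSetoid d) f = P → Quotient.mk (teichSetoid d) g = P' →
        (teichDist f g = 0 ↔ P = P')) ∧
    -- the Teichmüller space is identified with the space of Hölder continuous dual derivatives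
    (∃ e : TeichSpace d ≃ HolderDualDerivatives d, ∀ f : MarkedMap d,
      (e (Quotient.mk (teichSetoid d) f) : DualSpace d → ℝ) = dualDerivative f.map.1) := by
  refine ⟨fun F => ?_, fun F => ⟨hasDualDerivative F.2.1 F.2.2, isHolderDual F.2.1 F.2.2⟩,
    teichEquiv_iff_dualDerivative_eq hd, ?_,
    Equiv.ofBijective _ (bijective_teichDualDerivative hd), fun f => rfl⟩
  · obtain ⟨H, hH⟩ := CircleEndo.exists_isMarking hd F.2.1 F.2.2
    exact ⟨H, hH, fun H' hH' => IsMarking.unique hd hH' hH⟩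
  · rintro P P' f g rfl rfl
    rw [teichDist_eq_zero_iff hd]
    exact (Quotient.eq (r := teichSetoid d)).symm
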